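/- **Model.** Computations take place on a unit-cost word RAM with words of $w=\Theta(\log n)$ bits, where $2(\lfloor\log_2 n\rfloor+1)+\kappa\le w\le A(\lfloor\log_2 n\rfloor+1)$ with $\kappa$ a constant of the program and $A$ an arbitrary constant; the program is the same for all $n$, $w$ and inputs. The constant in the time bound is absolute; the constants implied in the $O(\log\log n/\log n)$ term may depend on $A$. The working memory (the program's constant number of registers together with a word-addressed random-access memory, both with arbitrary initial contents) is counted in bits; the output stream is write-only. The input is read-only: a directed graph $G=(V,E)$ with $n\ge 1$ vertices and $m$ edges, $E\subseteq V\times V$, is given by in/out adjacency arrays in arbitrary order with cross links, that is, in constant time one can find the number $n$, the indegree and the outdegree of a given vertex, its $i$th inneighbor or outneighbor, and, for each edge $(u,v)$, the position of $u$ in the array of inneighbors of $v$ from the position of $v$ in the array of outneighbors of $u$, and vice versa. **Notation.** $\log=\log_2$. For an integer $k$, let $$L_k(G)=\sum_{v\in V,\ d_v+k\ge 2}\lceil\log(d_v+k)\rceil,\qquad L_k^{\mathrm{in}}(G)=\sum_{v\in V,\ d^{\mathrm{in}}_v+k\ge 2}\lceil\log(d^{\mathrm{in}}_v+k)\rceil,$$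 where $d_v$ is the total degree (indegree plus outdegree) and $d^{\mathrm{in}}_v$ the indegree of $v$. A strongly connected component is an equivalence class of the relation "there is a path from $u$ to $v$ and one from $v$ to $u$"; computing the strongly connected components means outputting their vertex sets one by one, each followed by a separator symbol. **Theorem.** The strongly connected components of a directed graph $G$ with $n$ vertices and $m$ edges can be computed in $O(n+m)$ time with at most $$\bigl(2n+L_{-1}(G)+2L_1^{\mathrm{in}}(G)\bigr)\Bigl(1+O\Bigl(\frac{\log\log n}{\log n}\Bigr)\Bigr)\ \le\ 3n\log\Bigl(2+\frac{4m}{n}\Bigr)\Bigl(1+O\Bigl(\frac{\log\log n}{\log n}\Bigr)\Bigr)$$ bits of working memory. -/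

import Mathlib

open Filter Asymptotics

noncomputable section

/-! Directed graphs are Mathlib's `Digraph` (a set of ordered pairs of vertices) on `Fin n`. -/

namespace DirGraph

variable {n : ℕ}

def outDegree (G : Digraph (Fin n)) (v : Fin n) : ℕ := {u | G.Adj v u}.ncard

def inDegree (G : Digraph (Fin n)) (v : Fin n) : ℕ := {u | G.Adj u v}.ncard

/-- Total degree. -/
def degree (G : Digraph (Fin n)) (v : Fin n) : ℕ := inDegree G v + outDegree G v

/-- The number `m` of edges. -/
def numEdges (G : Digraph (Fin n)) : ℕ := {p : Fin n × Fin n | G.Adj p.1 p.2}.ncard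

/-- `∑ ⌈log₂ (d v + k)⌉`, the sum being over the vertices `v` with `d v + k ≥ 2`. -/
def sumCeilLog (d : Fin n → ℕ) (k : ℤ) : ℤ :=
  ∑ v : Fin n, if 2 ≤ (d v : ℤ) + k then ⌈Real.logb 2 ((d v : ℝ) + (k : ℝ))⌉ else 0

/-- `L_k(G)`. -/
def L (k : ℤ) (G : Digraph (Fin n)) : ℤ := sumCeilLog (degree G) k

/-- `L_k^in(G)`. -/
def Lin (k : ℤ) (G : Digraph (Fin n)) : ℤ := sumCeilLog (inDegree G) k

/-- There is a path from `u` to `v` and one from `v` to `u`. -/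
def StronglyEquiv (G : Digraph (Fin n)) (u v : Fin n) : Prop :=
  Relation.ReflTransGen G.Adj u v ∧ Relation.ReflTransGen G.Adj v u

/-- `S` is the vertex set of a strongly connected component of `G`. -/
def IsSCC (G : Digraph (Fin n)) (S : Set (Fin n)) : Prop :=
  ∃ v, S = {u | StronglyEquiv G v u}

/-- In/out adjacency arrays of `G`, with an arbitrary order of the neighbors of each vertex. -/
structure AdjArrays (G : Digraph (Fin n)) where
  out : Fin n → List (Fin n)
  out_nodup : ∀ v, (out v).Nodup
  mem_out : ∀ v u, u ∈ out v ↔ G.Adj v u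
  inn : Fin n → List (Fin n)
  inn_nodup : ∀ v, (inn v).Nodup
  mem_inn : ∀ v u, u ∈ inn v ↔ G.Adj u v

end DirGraph

namespace WordRAM

open DirGraph

/-! ### Access to the read-only input -/

/-- The access functions of an adjacency-array representation. -/
inductive Access
  | outdeg | outhead | outmate
  | indeg | inhead | inmate

/-- The values of the access functions at vertex number `v` and array position `i` (ignored by
`outdeg` and `indeg`). The cross link `outmate v i` is the position of `v` in the array of the
inneighbors of `outhead v i`, and vice versa for `inmate`. Invalid arguments yield `0`. -/
def Access.value {n : ℕ} {G : Digraph (Fin n)} (R : AdjArrays G) (q : Access) (v i : ℕ) : ℕ :=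
  if h : v < n then
    match q with
    | .outdeg => (R.out ⟨v, h⟩).length
    | .outhead => (((R.out ⟨v, h⟩)[i]?).map fun u => (u : ℕ)).getD 0
    | .outmate => (((R.out ⟨v, h⟩)[i]?).map fun u => (R.inn u).idxOf ⟨v, h⟩).getD 0
    | .indeg => (R.inn ⟨v, h⟩).length
    | .inhead => (((R.inn ⟨v, h⟩)[i]?).map fun u => (u : ℕ)).getD 0
    | .inmate => (((R.inn ⟨v, h⟩)[i]?).map fun u => (R.out u).idxOf ⟨v, h⟩).getD 0
  else 0

/-! ### The machine: `k` registers, a random-access memory, words of `w` bits -/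

/-- Words are natural numbers smaller than `2 ^ w`. The memory is addressed by words. The output
is a write-only stream of words (`some x`) and separator symbols (`none`). -/
structure State (k : ℕ) where
  reg : Fin k → ℕ
  mem : ℕ → ℕ
  out : List (Option ℕ)

/-- Nothing has been output; the words in registers and memory are arbitrary. -/
def State.Initial {k : ℕ} (w : ℕ) (s : State k) : Prop :=
  (∀ r, s.reg r < 2 ^ w) ∧ (∀ a, s.mem a < 2 ^ w) ∧ s.out = []

inductive Op
  | add | sub | mul | div | mod | and | or | xor | shl | shr

/-- The value of an operation on words; it is reduced modulo `2 ^ w` when stored. -/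
def Op.eval (w : ℕ) : Op → ℕ → ℕ → ℕ
  | .add, x, y => x + y
  | .sub, x, y => x + (2 ^ w - y)
  | .mul, x, y => x * y
  | .div, x, y => x / y
  | .mod, x, y => x % y
  | .and, x, y => x &&& y
  | .or, x, y => x ||| y
  | .xor, x, y => x ^^^ y
  | .shl, x, y => x <<< y
  | .shr, x, y => x >>> y

/-- Unit-cost instructions. -/
inductive Instr (k : ℕ)
  /-- `d := c` -/
  | const (d : Fin k) (c : ℕ)
  /-- `d := x` -/
  | move (d x : Fin k)
  /-- `d := x op y` -/
  | binop (o : Op) (d x y : Fin k)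
  /-- `d := mem[a]` -/
  | load (d a : Fin k)
  /-- `mem[a] := x` -/
  | store (a x : Fin k)
  /-- `d := n`, the number of vertices of the input graph -/
  | numVerts (d : Fin k)
  /-- `d := w`, the word length -/
  | wordLen (d : Fin k)
  /-- `d := q(v, i)` -/
  | access (q : Access) (d v i : Fin k)
  /-- output the word in `x` -/
  | emit (x : Fin k)
  /-- output a separator symbol -/
  | separator

inductive Test (k : ℕ)
  | eq (x y : Fin k)
  | lt (x y : Fin k)

def Test.holds {k : ℕ} (s : State k) : Test k → Prop
  | .eq x y => s.reg x = s.reg y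
  | .lt x y => s.reg x < s.reg y

/-- Programs. There is no recursion, so that the control needs no memory. -/
inductive Program (k : ℕ)
  | skip
  | instr (i : Instr k)
  | seq (p q : Program k)
  | ite (b : Test k) (p q : Program k)
  | loop (b : Test k) (p : Program k)

def State.setReg {k : ℕ} (w : ℕ) (s : State k) (d : Fin k) (x : ℕ) : State k :=
  { s with reg := Function.update s.reg d (x % 2 ^ w) }

def Instr.step {k n : ℕ} {G : Digraph (Fin n)} (R : AdjArrays G) (w : ℕ) (s : State k) :
    Instr k → State k
  | .const d c => s.setReg w d c
  | .move d x => s.setReg w d (s.reg x)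
  | .binop o d x y => s.setReg w d (o.eval w (s.reg x) (s.reg y))
  | .load d a => s.setReg w d (s.mem (s.reg a))
  | .store a x => { s with mem := Function.update s.mem (s.reg a) (s.reg x) }
  | .numVerts d => s.setReg w d n
  | .wordLen d => s.setReg w d w
  | .access q d v i => s.setReg w d (q.value R (s.reg v) (s.reg i))
  | .emit x => { s with out := s.out ++ [some (s.reg x)] }
  | .separator => { s with out := s.out ++ [none] }

/-- The least `S` such that all memory accesses of the instruction are to words `0, …, S - 1`. -/
def Instr.space {k : ℕ} (s : State k) : Instr k → ℕ
  | .load _ a => s.reg a + 1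
  | .store a _ => s.reg a + 1
  | _ => 0

/-- `Exec R w p s s' t S`: on the input `R` and with words of `w` bits, the program `p`, started in
state `s`, halts in state `s'` after `t` steps, `S` being the least number such that all accesses
to memory are to the words `0, …, S - 1`. -/
inductive Exec {k n : ℕ} {G : Digraph (Fin n)} (R : AdjArrays G) (w : ℕ) :
    Program k → State k → State k → ℕ → ℕ → Prop
  | skip (s : State k) : Exec R w .skip s s 0 0
  | instr (i : Instr k) (s : State k) : Exec R w (.instr i) s (i.step R w s) 1 (i.space s)
  | seq {p q : Program k} {s s' s'' : State k} {t t' S S' : ℕ} :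
      Exec R w p s s' t S → Exec R w q s' s'' t' S' →
      Exec R w (.seq p q) s s'' (t + t') (max S S')
  | ite_true {b : Test k} {p q : Program k} {s s' : State k} {t S : ℕ} :
      b.holds s → Exec R w p s s' t S → Exec R w (.ite b p q) s s' (t + 1) S
  | ite_false {b : Test k} {p q : Program k} {s s' : State k} {t S : ℕ} :
      ¬ b.holds s → Exec R w q s s' t S → Exec R w (.ite b p q) s s' (t + 1) S
  | loop_true {b : Test k} {p : Program k} {s s' s'' : State k} {t t' S S' : ℕ} :
      b.holds s → Exec R w p s s' t S → Exec R w (.loop b p) s' s'' t' S' →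
      Exec R w (.loop b p) s s'' (t + t' + 1) (max S S')
  | loop_false {b : Test k} {p : Program k} {s : State k} :
      ¬ b.holds s → Exec R w (.loop b p) s s 1 0

/-- The output lists the vertices of the strongly connected components of `G`, one component after
the other, each followed by a separator; every component and every vertex occurs exactly once. -/
def OutputsSCCs {n : ℕ} (G : Digraph (Fin n)) (out : List (Option ℕ)) : Prop :=
  ∃ comps : List (List (Fin n)),
    out = comps.flatMap (fun C => C.map (fun v => some (v : ℕ)) ++ [none]) ∧
    (∀ C ∈ comps, IsSCC G {v | v ∈ C}) ∧
    (∀ v, v ∈ comps.flatten) ∧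
    comps.flatten.Nodup

end WordRAM

end

/-!
The algorithm is Kosaraju's, with the second search run along the first one in reverse.

*Correctness.* A depth-first search of the whole graph is made from an additional vertex with edges
to all others (`Dfs`), and it is then run backwards step by step. Backwards, vertices are entered in
the order of decreasing finishing times. When the component of the vertex `v` entered has not yet
been output, a search of the reversed graph from `v` that avoids the vertices already output finds
exactly the component of `v` (`reverse_search`): a vertex `y` from which `v` can be reached is
in the component of `v`, or its component contains a vertex that finishes later than `v`
(`Inv.later`). The latter is a consequence of the invariant `Inv`.

*Space.* Write `|x|` for the length `Nat.size x` of the binary representation of `x`; it equals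
`⌈log (x + 1)⌉`. To return from a vertex, or to recognize a tree edge when running
backwards, the search stores with each vertex `v` of indegree `i` the position of its tree edge in
the array of inneighbors, a number of `|i|` bits; cross links give the rest. Two bit arrays of
`N = n + ∑ |i|` bits hold these fields, one bit plane after the other. The first array marks the
vertices that have a bit in the next plane, so that counting its ones before a position gives the
position of the next bit of the same field (`pos_next`). The second array holds the bits, plane 0
being used as visited marks and later as marks of the unassigned vertices. The reverse searches use
a stack on which a vertex of total degree `d` takes `|d - 2|` bits, because it has an ingoing edge
and hence outgoing edges have positions at most `d - 2`. Together this makes exactly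
`2 n + L₋₁(G) + 2 L₁ⁱⁿ(G)` bits (`arrayBits_eq`). Ones are counted in constant time with a table
of popcounts of chunks of about half of `log n` bits and a two-level directory. These structures,
the registers and the incomplete use of words cost a factor of `1 + O(log log n / log n)`
(`space_le`).

*Time.* A field of `|i|` bits takes time `O(|i|)` to read or write, which is done a constant number
of times. To decide whether an edge is a tree edge, its code is compared with the field of its head
from the lowest bit on, up to the first difference. The codes of the edges into one vertex are
different numbers of `|i|` bits, so that the comparisons take constant time on average
(`sum_agree`). No loop depends on the word length, so that the constant is absolute.

*The bound in `n` and `m`* follows from the concavity of the logarithm (`arrayBits_le_log`).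

The program is written in a small imperative language, compiled to the machine by `Sm.comp`; `WP` is
the total-correctness assertion for compiled statements, with a clock and a bound on addresses.
-/

namespace SpaceSCC

open DirGraph WordRAM

/-! ### A small imperative language and its compilation to the machine -/

/-- Expressions over the variables `0, …, 31`: variables, constants, operations, contents of memory
words, values of access functions, the number of vertices, and the word length. -/
inductive Ex
  | var (x : ℕ)
  | lit (c : ℕ)
  | bin (o : Op) (a b : Ex)
  | ld (a : Ex)
  | acc (q : Access) (v i : Ex)
  | nv
  | wl

/-- The state seen by the language: variables, memory and output. -/
structure St where
  v : ℕ → ℕ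
  mem : ℕ → ℕ
  out : List (Option ℕ)

/-- Assignment to a variable. -/
def St.set (σ : St) (x a : ℕ) : St := { σ with v := Function.update σ.v x a }

/-- Writing a memory word. -/
def St.put (σ : St) (a x : ℕ) : St := { σ with mem := Function.update σ.mem a x }

/-- Writing to the output stream. -/
def St.emit (σ : St) (o : Option ℕ) : St := { σ with out := σ.out ++ [o] }

@[simp] theorem St.set_v (σ : St) (x a y : ℕ) : (σ.set x a).v y = if y = x then a else σ.v y := by
  simp [St.set, Function.update_apply]
@[simp] theorem St.set_mem (σ : St) (x a : ℕ) : (σ.set x a).mem = σ.mem := rfl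
@[simp] theorem St.set_out (σ : St) (x a : ℕ) : (σ.set x a).out = σ.out := rfl
@[simp] theorem St.put_v (σ : St) (x a : ℕ) : (σ.put x a).v = σ.v := rfl
@[simp] theorem St.put_mem (σ : St) (x a y : ℕ) :
    (σ.put x a).mem y = if y = x then a else σ.mem y := by
  simp [St.put, Function.update_apply]
@[simp] theorem St.put_out (σ : St) (x a : ℕ) : (σ.put x a).out = σ.out := rfl
@[simp] theorem St.emit_v (σ : St) (o : Option ℕ) : (σ.emit o).v = σ.v := rfl
@[simp] theorem St.emit_mem (σ : St) (o : Option ℕ) : (σ.emit o).mem = σ.mem := rfl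
@[simp] theorem St.emit_out (σ : St) (o : Option ℕ) : (σ.emit o).out = σ.out ++ [o] := rfl

/-- The operations on natural numbers, without reduction modulo the word size. -/
def opVal : Op → ℕ → ℕ → ℕ
  | .add, x, y => x + y
  | .sub, x, y => x - y
  | .mul, x, y => x * y
  | .div, x, y => x / y
  | .mod, x, y => x % y
  | .and, x, y => x &&& y
  | .or, x, y => x ||| y
  | .xor, x, y => x ^^^ y
  | .shl, x, y => x * 2 ^ y
  | .shr, x, y => x / 2 ^ y

/-- Conditions under which the machine operation agrees with `opVal`. -/
def opSafe (w : ℕ) : Op → ℕ → ℕ → Prop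
  | .add, x, y => x + y < 2 ^ w
  | .sub, x, y => y ≤ x
  | .mul, x, y => x * y < 2 ^ w
  | .shl, x, y => x * 2 ^ y < 2 ^ w
  | _, _, _ => True

section Eval

variable {n : ℕ} {G : Digraph (Fin n)} (R : AdjArrays G) (w M : ℕ)

/-- The value of an expression. -/
def Ex.eval : Ex → St → ℕ
  | .var x, σ => σ.v x
  | .lit c, _ => c
  | .bin o a b, σ => opVal o (a.eval σ) (b.eval σ)
  | .ld a, σ => σ.mem (a.eval σ)
  | .acc q v i, σ => q.value R (v.eval σ) (i.eval σ)
  | .nv, _ => n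
  | .wl, _ => w

/-- No overflow occurs, and only the memory words `0, …, M - 1` are read. -/
def Ex.safe : Ex → St → Prop
  | .var _, _ => True
  | .lit c, _ => c < 2 ^ w
  | .bin o a b, σ => a.safe σ ∧ b.safe σ ∧ opSafe w o (a.eval R w σ) (b.eval R w σ)
  | .ld a, σ => a.safe σ ∧ a.eval R w σ < M
  | .acc _ v i, σ => v.safe σ ∧ i.safe σ
  | .nv, _ => True
  | .wl, _ => True

end Eval

/-- Number of instructions for evaluating an expression. -/
def Ex.cost : Ex → ℕ
  | .var _ => 1
  | .lit _ => 1
  | .bin _ a b => a.cost + b.cost + 1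
  | .ld a => a.cost + 1
  | .acc _ v i => v.cost + i.cost + 1
  | .nv => 1
  | .wl => 1

/-- The variables are among `0, …, 31`, and the registers from `d` on suffice for evaluation. -/
def Ex.fits : Ex → ℕ → Bool
  | .var x, d => x < 32 && d < 48
  | .lit _, d => d < 48
  | .bin _ a b, d => a.fits d && b.fits (d + 1) && d + 1 < 48
  | .ld a, d => a.fits d && d < 48
  | .acc _ v i, d => v.fits d && i.fits (d + 1) && d + 1 < 48
  | .nv, d => d < 48
  | .wl, d => d < 48

/-- Register number `i`. -/
def rg (i : ℕ) : Fin 48 := Fin.ofNat 48 i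

theorem rg_inj {i j : ℕ} (hi : i < 48) (hj : j < 48) : rg i = rg j ↔ i = j := by
  simp [rg, Fin.ofNat, Fin.ext_iff, Nat.mod_eq_of_lt hi, Nat.mod_eq_of_lt hj]

/-- Code that evaluates an expression into register `d`, using only registers from `d` on. -/
def Ex.comp : Ex → ℕ → Program 48
  | .var x, d => .instr (.move (rg d) (rg x))
  | .lit c, d => .instr (.const (rg d) c)
  | .bin o a b, d => .seq (a.comp d) (.seq (b.comp (d + 1))
      (.instr (.binop o (rg d) (rg d) (rg (d + 1)))))
  | .ld a, d => .seq (a.comp d) (.instr (.load (rg d) (rg d)))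
  | .acc q v i, d => .seq (v.comp d) (.seq (i.comp (d + 1))
      (.instr (.access q (rg d) (rg d) (rg (d + 1)))))
  | .nv, d => .instr (.numVerts (rg d))
  | .wl, d => .instr (.wordLen (rg d))

/-- Comparisons. -/
inductive Cmp
  | eq
  | lt

def Cmp.holds : Cmp → ℕ → ℕ → Prop
  | .eq, x, y => x = y
  | .lt, x, y => x < y

/-- The operands of a comparison are evaluated into the registers 32 and 33. -/
def Cmp.test : Cmp → Test 48
  | .eq => .eq (rg 32) (rg 33)
  | .lt => .lt (rg 32) (rg 33)

/-- Statements: no operation, assignment, storing in memory, output of a word or a separator,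
sequence, conditional and loop. -/
inductive Sm
  | skip
  | asg (x : ℕ) (e : Ex)
  | st (a e : Ex)
  | emit (e : Ex)
  | sep
  | seq (p q : Sm)
  | ite (c : Cmp) (a b : Ex) (p q : Sm)
  | wh (c : Cmp) (a b : Ex) (p : Sm)
  /-- a statement marked as a unit for verification -/
  | blk (p : Sm)

/-- All variables are among `0, …, 31`, and the registers suffice for all expressions. -/
def Sm.fits : Sm → Bool
  | .skip => true
  | .asg x e => x < 32 && e.fits 32
  | .st a e => a.fits 32 && e.fits 33
  | .emit e => e.fits 32
  | .sep => true
  | .seq p q => p.fits && q.fits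
  | .ite _ a b p q => a.fits 32 && b.fits 33 && p.fits && q.fits
  | .wh _ a b p => a.fits 32 && b.fits 33 && p.fits
  | .blk p => p.fits

/-- Compilation. -/
def Sm.comp : Sm → Program 48
  | .skip => .skip
  | .asg x e => .seq (e.comp 32) (.instr (.move (rg x) (rg 32)))
  | .st a e => .seq (a.comp 32) (.seq (e.comp 33) (.instr (.store (rg 32) (rg 33))))
  | .emit e => .seq (e.comp 32) (.instr (.emit (rg 32)))
  | .sep => .instr .separator
  | .seq p q => .seq p.comp q.comp
  | .ite c a b p q => .seq (.seq (a.comp 32) (b.comp 33)) (.ite c.test p.comp q.comp)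
  | .wh c a b p => .seq (.seq (a.comp 32) (b.comp 33))
      (.loop c.test (.seq p.comp (.seq (a.comp 32) (b.comp 33))))
  | .blk p => p.comp

/-- The machine state `s` represents `σ`. -/
structure Rel (w : ℕ) (σ : St) (s : State 48) : Prop where
  reg : ∀ i < 32, s.reg (rg i) = σ.v i
  mem : s.mem = σ.mem
  out : s.out = σ.out
  reg_lt : ∀ r, s.reg r < 2 ^ w
  mem_lt : ∀ a, s.mem a < 2 ^ w

section Comp

variable {n : ℕ} {G : Digraph (Fin n)} (R : AdjArrays G) (w M : ℕ)

/-- Since all values of the access functions are at most `n`, they fit into a word. -/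
theorem value_le (q : Access) (v i : ℕ) : q.value R v i ≤ n := by
  have hlen : ∀ l : List (Fin n), l.Nodup → l.length ≤ n := fun l h => by
    simpa using h.length_le_card
  unfold Access.value
  split
  · rename_i h
    cases q <;> simp only
    · exact hlen _ (R.out_nodup _)
    · cases (R.out ⟨v, h⟩)[i]? with
      | none => simp
      | some u => simp
    · cases (R.out ⟨v, h⟩)[i]? with
      | none => simp
      | some u => simpa using List.idxOf_le_length.trans (hlen _ (R.inn_nodup u))
    · exact hlen _ (R.inn_nodup _)
    · cases (R.inn ⟨v, h⟩)[i]? with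
      | none => simp
      | some u => simp
    · cases (R.inn ⟨v, h⟩)[i]? with
      | none => simp
      | some u => simpa using List.idxOf_le_length.trans (hlen _ (R.out_nodup u))
  · exact Nat.zero_le _

/-- Reduction modulo the word size has no effect if the operation is safe. -/
theorem opEval {o : Op} {x y : ℕ} (hx : x < 2 ^ w) (hy : y < 2 ^ w) (h : opSafe w o x y) :
    o.eval w x y % 2 ^ w = opVal o x y := by
  cases o <;> simp only [Op.eval, opVal, opSafe] at *
  · exact Nat.mod_eq_of_lt h
  · rw [show x + (2 ^ w - y) = (x - y) + 2 ^ w by omega, Nat.add_mod_right]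
    exact Nat.mod_eq_of_lt (by omega)
  · exact Nat.mod_eq_of_lt h
  · exact Nat.mod_eq_of_lt ((Nat.div_le_self _ _).trans_lt hx)
  · exact Nat.mod_eq_of_lt ((Nat.mod_le _ _).trans_lt hx)
  · exact Nat.mod_eq_of_lt (Nat.and_lt_two_pow _ hy)
  · exact Nat.mod_eq_of_lt (Nat.or_lt_two_pow hx hy)
  · exact Nat.mod_eq_of_lt (Nat.xor_lt_two_pow hx hy)
  · rw [Nat.shiftLeft_eq]; exact Nat.mod_eq_of_lt h
  · rw [Nat.shiftRight_eq_div_pow]; exact Nat.mod_eq_of_lt ((Nat.div_le_self _ _).trans_lt hx)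

/-- Correctness of the code for expressions. -/
theorem Ex.comp_spec (hn : n < 2 ^ w) (σ : St) : ∀ (e : Ex) (d : ℕ) (s : State 48), Rel w σ s →
    32 ≤ d → e.fits d → e.safe R w M σ →
    ∃ s' S, Exec R w (e.comp d) s s' e.cost S ∧ S ≤ M ∧ Rel w σ s' ∧
      s'.reg (rg d) = e.eval R w σ ∧ ∀ i < d, s'.reg (rg i) = s.reg (rg i) := by
  have key : ∀ (s : State 48) (d x : ℕ), Rel w σ s → 32 ≤ d → d < 48 → x < 2 ^ w →
      Rel w σ (s.setReg w (rg d) x) ∧ (s.setReg w (rg d) x).reg (rg d) = x ∧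
      ∀ i < d, (s.setReg w (rg d) x).reg (rg i) = s.reg (rg i) := by
    intro s d x hs hd hd' hx
    have hlow : ∀ i < d, (s.setReg w (rg d) x).reg (rg i) = s.reg (rg i) := by
      intro i hi
      have : rg i ≠ rg d := fun h => by
        rw [rg_inj (by omega) hd'] at h; omega
      simp [State.setReg, this]
    refine ⟨⟨fun i hi => ?_, hs.mem, hs.out, fun r => ?_, hs.mem_lt⟩, ?_, hlow⟩
    · rw [hlow i (by omega), hs.reg i hi]
    · by_cases h : r = rg d
      · subst h; simp [State.setReg, Nat.mod_lt]
      · simpa [State.setReg, h] using hs.reg_lt r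
    · simp [State.setReg, Nat.mod_eq_of_lt hx]
  intro e
  induction e with
  | var x =>
    intro d s hs hd hf _
    simp only [Ex.fits, Bool.and_eq_true, decide_eq_true_eq] at hf
    obtain ⟨h1, h2, h3⟩ := key s d (s.reg (rg x)) hs hd hf.2 (hs.reg_lt _)
    exact ⟨_, _, .instr _ _, Nat.zero_le _, h1, by rw [Instr.step, h2, hs.reg x hf.1, Ex.eval], h3⟩
  | lit c =>
    intro d s hs hd hf hsf
    simp only [Ex.fits, decide_eq_true_eq] at hf
    obtain ⟨h1, h2, h3⟩ := key s d c hs hd hf hsf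
    exact ⟨_, _, .instr _ _, Nat.zero_le _, h1, h2, h3⟩
  | bin o a b iha ihb =>
    intro d s hs hd hf ⟨sa, sb, so⟩
    simp only [Ex.fits, Bool.and_eq_true, decide_eq_true_eq] at hf
    obtain ⟨s1, S1, e1, m1, r1, v1, l1⟩ := iha d s hs hd hf.1.1 sa
    obtain ⟨s2, S2, e2, m2, r2, v2, l2⟩ := ihb (d + 1) s1 r1 (by omega) hf.1.2 sb
    have ha : s2.reg (rg d) = a.eval R w σ := by rw [l2 d (by omega), v1]
    have hv : o.eval w (s2.reg (rg d)) (s2.reg (rg (d + 1))) % 2 ^ w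
        = opVal o (a.eval R w σ) (b.eval R w σ) := by
      rw [ha, v2]
      exact opEval w (ha ▸ r2.reg_lt _) (v2 ▸ r2.reg_lt _) so
    have hx : opVal o (a.eval R w σ) (b.eval R w σ) < 2 ^ w := by
      rw [← hv]; exact Nat.mod_lt _ (by positivity)
    obtain ⟨h1, h2, h3⟩ := key s2 d _ r2 hd (by omega) hx
    have hst : Instr.step R w s2 (.binop o (rg d) (rg d) (rg (d + 1))) =
        s2.setReg w (rg d) (opVal o (a.eval R w σ) (b.eval R w σ)) := by
      simp only [Instr.step, State.setReg, hv, Nat.mod_eq_of_lt hx]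
    refine ⟨_, max S1 (max S2 0), ?_, ?_, h1, h2,
      fun i hi => by rw [h3 i hi, l2 i (by omega), l1 i hi]⟩
    · have := Exec.seq e1 (Exec.seq e2 (Exec.instr (.binop o (rg d) (rg d) (rg (d + 1))) s2))
      rw [hst] at this
      simpa [Ex.comp, Ex.cost, Instr.space, add_assoc] using this
    · simp [m1, m2]
  | ld a iha =>
    intro d s hs hd hf ⟨sa, sm⟩
    simp only [Ex.fits, Bool.and_eq_true, decide_eq_true_eq] at hf
    obtain ⟨s1, S1, e1, m1, r1, v1, l1⟩ := iha d s hs hd hf.1 sa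
    obtain ⟨h1, h2, h3⟩ := key s1 d (s1.mem (s1.reg (rg d))) r1 hd hf.2 (r1.mem_lt _)
    refine ⟨_, _, .seq e1 (.instr _ _), ?_, h1, ?_, fun i hi => ?_⟩
    · simp only [Instr.space, v1]; exact max_le m1 sm
    · rw [Instr.step, h2, v1, r1.mem]; rfl
    · rw [Instr.step, h3 i hi, l1 i hi]
  | acc q v i ihv ihi =>
    intro d s hs hd hf ⟨sa, sb⟩
    simp only [Ex.fits, Bool.and_eq_true, decide_eq_true_eq] at hf
    obtain ⟨s1, S1, e1, m1, r1, v1, l1⟩ := ihv d s hs hd hf.1.1 sa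
    obtain ⟨s2, S2, e2, m2, r2, v2, l2⟩ := ihi (d + 1) s1 r1 (by omega) hf.1.2 sb
    have ha : s2.reg (rg d) = v.eval R w σ := by rw [l2 d (by omega), v1]
    have hx : q.value R (v.eval R w σ) (i.eval R w σ) < 2 ^ w := (value_le R q _ _).trans_lt hn
    obtain ⟨h1, h2, h3⟩ := key s2 d _ r2 hd (by omega) hx
    have hst : Instr.step R w s2 (.access q (rg d) (rg d) (rg (d + 1))) =
        s2.setReg w (rg d) (q.value R (v.eval R w σ) (i.eval R w σ)) := by
      simp only [Instr.step, ha, v2]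
    refine ⟨_, max S1 (max S2 0), ?_, ?_, h1, h2,
      fun i hi => by rw [h3 i hi, l2 i (by omega), l1 i hi]⟩
    · have := Exec.seq e1 (Exec.seq e2 (Exec.instr (.access q (rg d) (rg d) (rg (d + 1))) s2))
      rw [hst] at this
      simpa [Ex.comp, Ex.cost, Instr.space, add_assoc] using this
    · simp [m1, m2]
  | nv =>
    intro d s hs hd hf _
    simp only [Ex.fits, decide_eq_true_eq] at hf
    obtain ⟨h1, h2, h3⟩ := key s d n hs hd hf hn
    exact ⟨_, _, .instr _ _, Nat.zero_le _, h1, h2, h3⟩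
  | wl =>
    intro d s hs hd hf _
    simp only [Ex.fits, decide_eq_true_eq] at hf
    obtain ⟨h1, h2, h3⟩ := key s d w hs hd hf Nat.lt_two_pow_self
    exact ⟨_, _, .instr _ _, Nat.zero_le _, h1, h2, h3⟩

/-- `WP R w M p σ t Q`: started in `σ` after `t` steps, the compiled statement halts, reads and
writes only the memory words `0, …, M - 1`, and `Q` holds of the final state and the number of
steps made until then. -/
def WP (p : Sm) (σ : St) (t : ℕ) (Q : St → ℕ → Prop) : Prop :=
  n < 2 ^ w → p.fits → ∀ s, Rel w σ s →
    ∃ s' t' S σ', Exec R w p.comp s s' t' S ∧ S ≤ M ∧ Rel w σ' s' ∧ Q σ' (t + t')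

variable {R w M}

theorem WP.mono {p : Sm} {σ : St} {t : ℕ} {Q Q' : St → ℕ → Prop} (h : WP R w M p σ t Q)
    (hQ : ∀ σ' t', Q σ' t' → Q' σ' t') : WP R w M p σ t Q' := fun hn hf s hs => by
  obtain ⟨s', t', S, σ', h1, h2, h3, h4⟩ := h hn hf s hs
  exact ⟨s', t', S, σ', h1, h2, h3, hQ _ _ h4⟩

theorem WP.skip {σ : St} {t : ℕ} {Q : St → ℕ → Prop} (h : Q σ t) : WP R w M .skip σ t Q :=
  fun _ _ s hs => ⟨s, 0, 0, σ, .skip s, Nat.zero_le _, hs, h⟩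

theorem WP.asg {x : ℕ} {e : Ex} {σ : St} {t : ℕ} {Q : St → ℕ → Prop} (he : e.safe R w M σ)
    (h : Q (σ.set x (e.eval R w σ)) (t + (e.cost + 1))) : WP R w M (.asg x e) σ t Q := by
  intro hn hf s hs
  simp only [Sm.fits, Bool.and_eq_true, decide_eq_true_eq] at hf
  obtain ⟨s1, S1, e1, m1, r1, v1, -⟩ := e.comp_spec R w M hn σ 32 s hs le_rfl hf.2 he
  have hlt : s1.reg (rg 32) < 2 ^ w := r1.reg_lt _
  refine ⟨_, _, _, _, .seq e1 (.instr _ _), ?_, ?_, h⟩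
  · simpa [Instr.space] using m1
  · refine ⟨fun i hi => ?_, r1.mem, r1.out, fun r => ?_, r1.mem_lt⟩
    · by_cases hix : i = x
      · subst hix
        simp [Instr.step, State.setReg, ← v1, Nat.mod_eq_of_lt hlt]
      · have : rg i ≠ rg x := fun h => hix ((rg_inj (by omega) (by omega)).1 h)
        simp [Instr.step, State.setReg, this, hix, r1.reg i hi]
    · by_cases hr : r = rg x
      · subst hr; simp [Instr.step, State.setReg, Nat.mod_lt]
      · simpa [Instr.step, State.setReg, hr] using r1.reg_lt r

/-- Evaluating two expressions into registers 32 and 33. -/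
theorem comp_pair (hn : n < 2 ^ w) {a b : Ex} {σ : St} (ha : a.safe R w M σ)
    (hb : b.safe R w M σ) (fa : a.fits 32) (fb : b.fits 33) {s : State 48} (hs : Rel w σ s) :
    ∃ s' S, Exec R w (.seq (a.comp 32) (b.comp 33)) s s' (a.cost + b.cost) S ∧ S ≤ M ∧ Rel w σ s' ∧
      s'.reg (rg 32) = a.eval R w σ ∧ s'.reg (rg 33) = b.eval R w σ := by
  obtain ⟨s1, S1, e1, m1, r1, v1, l1⟩ := a.comp_spec R w M hn σ 32 s hs le_rfl fa ha
  obtain ⟨s2, S2, e2, m2, r2, v2, l2⟩ := b.comp_spec R w M hn σ 33 s1 r1 (by omega) fb hb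
  exact ⟨s2, _, .seq e1 e2, max_le m1 m2, r2, by rw [l2 32 (by omega), v1], v2⟩

theorem WP.st {a e : Ex} {σ : St} {t : ℕ} {Q : St → ℕ → Prop} (ha : a.safe R w M σ)
    (he : e.safe R w M σ) (hM : a.eval R w σ < M)
    (h : Q (σ.put (a.eval R w σ) (e.eval R w σ)) (t + (a.cost + e.cost + 1))) :
    WP R w M (.st a e) σ t Q := by
  intro hn hf s hs
  simp only [Sm.fits, Bool.and_eq_true] at hf
  obtain ⟨s1, S1, e1, m1, r1, v1, l1⟩ := a.comp_spec R w M hn σ 32 s hs le_rfl hf.1 ha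
  obtain ⟨s2, S2, e2, m2, r2, v2, l2⟩ := e.comp_spec R w M hn σ 33 s1 r1 (by omega) hf.2 he
  have hva : s2.reg (rg 32) = a.eval R w σ := by rw [l2 32 (by omega), v1]
  refine ⟨_, _, _, _, .seq e1 (.seq e2 (.instr _ _)), ?_, ?_,
    by rw [← add_assoc a.cost]; exact h⟩
  · simp only [Instr.space, hva]; exact max_le m1 (max_le m2 hM)
  · refine ⟨r2.reg, ?_, r2.out, r2.reg_lt, fun x => ?_⟩
    · simp [Instr.step, St.put, r2.mem, hva, v2]
    · by_cases hx : x = s2.reg (rg 32)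
      · subst hx; simpa [Instr.step] using r2.reg_lt _
      · simpa [Instr.step, hx] using r2.mem_lt x

theorem WP.emit {e : Ex} {σ : St} {t : ℕ} {Q : St → ℕ → Prop} (he : e.safe R w M σ)
    (h : Q (σ.emit (some (e.eval R w σ))) (t + (e.cost + 1))) : WP R w M (.emit e) σ t Q := by
  intro hn hf s hs
  obtain ⟨s1, S1, e1, m1, r1, v1, -⟩ := e.comp_spec R w M hn σ 32 s hs le_rfl hf he
  refine ⟨_, _, _, _, .seq e1 (.instr _ _), ?_, ?_, h⟩
  · simpa [Instr.space] using m1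
  · exact ⟨r1.reg, r1.mem, by simp [Instr.step, St.emit, r1.out, v1], r1.reg_lt, r1.mem_lt⟩

theorem WP.sep {σ : St} {t : ℕ} {Q : St → ℕ → Prop} (h : Q (σ.emit none) (t + 1)) :
    WP R w M .sep σ t Q := by
  intro hn hf s hs
  exact ⟨_, _, _, σ.emit none, .instr _ _, Nat.zero_le _, ⟨hs.reg, hs.mem,
    by simp [Instr.step, St.emit, hs.out], hs.reg_lt, hs.mem_lt⟩, h⟩

theorem WP.seq {p q : Sm} {σ : St} {t : ℕ} {Q : St → ℕ → Prop}
    (h : WP R w M p σ t (fun σ' t' => WP R w M q σ' t' Q)) : WP R w M (.seq p q) σ t Q := by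
  intro hn hf s hs
  simp only [Sm.fits, Bool.and_eq_true] at hf
  obtain ⟨s1, t1, S1, σ1, h1, m1, r1, q1⟩ := h hn hf.1 s hs
  obtain ⟨s2, t2, S2, σ2, h2, m2, r2, q2⟩ := q1 hn hf.2 s1 r1
  exact ⟨s2, _, _, σ2, .seq h1 h2, max_le m1 m2, r2, by rwa [← add_assoc]⟩

theorem test_holds {c : Cmp} {s : State 48} {x y : ℕ} (hx : s.reg (rg 32) = x)
    (hy : s.reg (rg 33) = y) : c.test.holds s ↔ c.holds x y := by
  cases c <;> simp [Cmp.test, Cmp.holds, Test.holds, hx, hy]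

theorem WP.ite {c : Cmp} {a b : Ex} {p q : Sm} {σ : St} {t : ℕ} {Q : St → ℕ → Prop}
    (ha : a.safe R w M σ) (hb : b.safe R w M σ)
    (h1 : c.holds (a.eval R w σ) (b.eval R w σ) → WP R w M p σ (t + (a.cost + b.cost + 1)) Q)
    (h2 : ¬ c.holds (a.eval R w σ) (b.eval R w σ) → WP R w M q σ (t + (a.cost + b.cost + 1)) Q) :
    WP R w M (.ite c a b p q) σ t Q := by
  intro hn hf s hs
  simp only [Sm.fits, Bool.and_eq_true] at hf
  obtain ⟨s1, S1, e1, m1, r1, va, vb⟩ := comp_pair hn ha hb hf.1.1.1 hf.1.1.2 hs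
  by_cases hc : c.holds (a.eval R w σ) (b.eval R w σ)
  · obtain ⟨s2, t2, S2, σ2, e2, m2, r2, q2⟩ := h1 hc hn hf.1.2 s1 r1
    refine ⟨s2, _, _, σ2, .seq e1 (.ite_true ((test_holds va vb).2 hc) e2), max_le m1 m2, r2, ?_⟩
    convert q2 using 1; ring
  · obtain ⟨s2, t2, S2, σ2, e2, m2, r2, q2⟩ := h2 hc hn hf.2 s1 r1
    refine ⟨s2, _, _, σ2, .seq e1 (.ite_false (fun h => hc ((test_holds va vb).1 h)) e2),
      max_le m1 m2, r2, ?_⟩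
    convert q2 using 1; ring

theorem WP.wh_false {c : Cmp} {a b : Ex} {p : Sm} {σ : St} {t : ℕ} {Q : St → ℕ → Prop}
    (ha : a.safe R w M σ) (hb : b.safe R w M σ)
    (hc : ¬ c.holds (a.eval R w σ) (b.eval R w σ))
    (h : Q σ (t + (a.cost + b.cost + 1))) : WP R w M (.wh c a b p) σ t Q := by
  intro hn hf s hs
  simp only [Sm.fits, Bool.and_eq_true] at hf
  obtain ⟨s1, S1, e1, m1, r1, va, vb⟩ := comp_pair hn ha hb hf.1.1 hf.1.2 hs
  exact ⟨s1, _, _, σ, .seq e1 (.loop_false (fun h => hc ((test_holds va vb).1 h))),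
    max_le m1 (Nat.zero_le _), r1, h⟩

theorem WP.wh_true {c : Cmp} {a b : Ex} {p : Sm} {σ : St} {t : ℕ} {Q : St → ℕ → Prop}
    (ha : a.safe R w M σ) (hb : b.safe R w M σ)
    (hc : c.holds (a.eval R w σ) (b.eval R w σ))
    (h : WP R w M p σ (t + (a.cost + b.cost + 1))
      (fun σ' t' => WP R w M (.wh c a b p) σ' t' Q)) : WP R w M (.wh c a b p) σ t Q := by
  intro hn hf s hs
  have hf' := hf
  simp only [Sm.fits, Bool.and_eq_true] at hf
  obtain ⟨s1, S1, e1, m1, r1, va, vb⟩ := comp_pair hn ha hb hf.1.1 hf.1.2 hs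
  obtain ⟨s2, t2, S2, σ2, e2, m2, r2, q2⟩ := h hn hf.2 s1 r1
  obtain ⟨s3, t3, S3, σ3, e3, m3, r3, q3⟩ := q2 hn hf' s2 r2
  cases e3 with
  | seq e4 e5 =>
    refine ⟨s3, _, _, σ3, .seq e1 (.loop_true ((test_holds va vb).2 hc) (.seq e2 e4) e5), ?_, r3, ?_⟩
    · simp only [max_le_iff] at m3 ⊢
      exact ⟨m1, ⟨m2, m3.1⟩, m3.2⟩
    · convert q3 using 1; ring

/-- Loop rule: a loop of exactly `k` iterations, `Inv i` holding when `i` iterations remain. -/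
theorem WP.wh_count {c : Cmp} {a b : Ex} {p : Sm} {Q : St → ℕ → Prop} (Inv : ℕ → St → ℕ → Prop)
    (hs : ∀ i σ t, Inv i σ t → a.safe R w M σ ∧ b.safe R w M σ ∧
      (c.holds (a.eval R w σ) (b.eval R w σ) ↔ 0 < i))
    (hstep : ∀ i σ t, Inv (i + 1) σ t → WP R w M p σ (t + (a.cost + b.cost + 1)) (Inv i))
    (hend : ∀ σ t, Inv 0 σ t → Q σ (t + (a.cost + b.cost + 1))) :
    ∀ (k : ℕ) (σ : St) (t : ℕ), Inv k σ t → WP R w M (.wh c a b p) σ t Q := by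
  intro k
  induction k with
  | zero =>
    intro σ t h
    obtain ⟨h1, h2, h3⟩ := hs _ _ _ h
    exact .wh_false h1 h2 (by simp [h3]) (hend _ _ h)
  | succ k ih =>
    intro σ t h
    obtain ⟨h1, h2, h3⟩ := hs _ _ _ h
    exact .wh_true h1 h2 (by simp [h3]) ((hstep _ _ _ h).mono ih)

variable (R w M)

/-- Weakest precondition by recursion over the statement; loops and marked units are left to
`WP`. -/
def Sm.wp : Sm → St → ℕ → (St → ℕ → Prop) → Prop
  | .skip, σ, t, Q => Q σ t
  | .asg x e, σ, t, Q => e.safe R w M σ ∧ Q (σ.set x (e.eval R w σ)) (t + (e.cost + 1))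
  | .st a e, σ, t, Q => a.safe R w M σ ∧ e.safe R w M σ ∧ a.eval R w σ < M ∧
      Q (σ.put (a.eval R w σ) (e.eval R w σ)) (t + (a.cost + e.cost + 1))
  | .emit e, σ, t, Q => e.safe R w M σ ∧ Q (σ.emit (some (e.eval R w σ))) (t + (e.cost + 1))
  | .sep, σ, t, Q => Q (σ.emit none) (t + 1)
  | .seq p q, σ, t, Q => p.wp σ t (fun σ' t' => q.wp σ' t' Q)
  | .ite c a b p q, σ, t, Q => a.safe R w M σ ∧ b.safe R w M σ ∧
      (c.holds (a.eval R w σ) (b.eval R w σ) → p.wp σ (t + (a.cost + b.cost + 1)) Q) ∧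
      (¬ c.holds (a.eval R w σ) (b.eval R w σ) → q.wp σ (t + (a.cost + b.cost + 1)) Q)
  | .wh c a b p, σ, t, Q => WP R w M (.wh c a b p) σ t Q
  | .blk p, σ, t, Q => WP R w M p σ t Q

variable {R w M}

/-- Verification of straight-line code by computing `Sm.wp`. -/
theorem WP.of_wp {p : Sm} : ∀ {σ : St} {t : ℕ} {Q : St → ℕ → Prop}, p.wp R w M σ t Q →
    WP R w M p σ t Q := by
  induction p with
  | skip => exact fun h => .skip h
  | asg x e => exact fun h => .asg h.1 h.2
  | st a e => exact fun h => .st h.1 h.2.1 h.2.2.1 h.2.2.2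
  | emit e => exact fun h => .emit h.1 h.2
  | sep => exact fun h => .sep h
  | seq p q ihp ihq => exact fun h => .seq ((ihp h).mono fun _ _ => ihq)
  | ite c a b p q ihp ihq =>
    exact fun h => .ite h.1 h.2.1 (fun hc => ihp (h.2.2.1 hc)) (fun hc => ihq (h.2.2.2 hc))
  | wh c a b p => exact fun h => h
  | blk p => exact fun h => h

end Comp

/-! Arithmetic notation for expressions. -/

instance : Add Ex := ⟨.bin .add⟩
instance : Sub Ex := ⟨.bin .sub⟩
instance : Mul Ex := ⟨.bin .mul⟩
instance : Div Ex := ⟨.bin .div⟩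
instance : Mod Ex := ⟨.bin .mod⟩
instance (c : ℕ) : OfNat Ex c := ⟨.lit c⟩

infixr:60 " ;; " => Sm.seq

section EvalSimp

variable {n : ℕ} {G : Digraph (Fin n)} {R : AdjArrays G} {w M : ℕ} {σ : St}

theorem eval_var (x : ℕ) : (Ex.var x).eval R w σ = σ.v x := rfl
theorem eval_lit (c : ℕ) : (Ex.lit c).eval R w σ = c := rfl
theorem eval_num (c : ℕ) : (no_index (OfNat.ofNat c) : Ex).eval R w σ = OfNat.ofNat c := rfl
theorem eval_add (a b : Ex) : (a + b).eval R w σ = a.eval R w σ + b.eval R w σ := rfl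
theorem eval_sub (a b : Ex) : (a - b).eval R w σ = a.eval R w σ - b.eval R w σ := rfl
theorem eval_mul (a b : Ex) : (a * b).eval R w σ = a.eval R w σ * b.eval R w σ := rfl
theorem eval_div (a b : Ex) : (a / b).eval R w σ = a.eval R w σ / b.eval R w σ := rfl
theorem eval_mod (a b : Ex) : (a % b).eval R w σ = a.eval R w σ % b.eval R w σ := rfl
theorem eval_shl (a b : Ex) : (Ex.bin .shl a b).eval R w σ = a.eval R w σ * 2 ^ b.eval R w σ := rfl
theorem eval_shr (a b : Ex) : (Ex.bin .shr a b).eval R w σ = a.eval R w σ / 2 ^ b.eval R w σ := rfl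
theorem eval_xor (a b : Ex) : (Ex.bin .xor a b).eval R w σ = a.eval R w σ ^^^ b.eval R w σ := rfl
theorem eval_ld (a : Ex) : (Ex.ld a).eval R w σ = σ.mem (a.eval R w σ) := rfl
theorem eval_acc (q : Access) (a b : Ex) :
    (Ex.acc q a b).eval R w σ = q.value R (a.eval R w σ) (b.eval R w σ) := rfl
theorem eval_nv : Ex.nv.eval R w σ = n := rfl
theorem eval_wl : Ex.wl.eval R w σ = w := rfl

theorem safe_var (x : ℕ) : (Ex.var x).safe R w M σ ↔ True := Iff.rfl
theorem safe_lit (c : ℕ) : (Ex.lit c).safe R w M σ ↔ c < 2 ^ w := Iff.rfl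
theorem safe_num (c : ℕ) :
    (no_index (OfNat.ofNat c) : Ex).safe R w M σ ↔ OfNat.ofNat c < 2 ^ w := Iff.rfl
theorem safe_add (a b : Ex) : (a + b).safe R w M σ ↔ a.safe R w M σ ∧ b.safe R w M σ ∧
    a.eval R w σ + b.eval R w σ < 2 ^ w := Iff.rfl
theorem safe_sub (a b : Ex) : (a - b).safe R w M σ ↔ a.safe R w M σ ∧ b.safe R w M σ ∧
    b.eval R w σ ≤ a.eval R w σ := Iff.rfl
theorem safe_mul (a b : Ex) : (a * b).safe R w M σ ↔ a.safe R w M σ ∧ b.safe R w M σ ∧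
    a.eval R w σ * b.eval R w σ < 2 ^ w := Iff.rfl
theorem safe_div (a b : Ex) : (a / b).safe R w M σ ↔ a.safe R w M σ ∧ b.safe R w M σ := by
  change _ ∧ _ ∧ True ↔ _; simp
theorem safe_mod (a b : Ex) : (a % b).safe R w M σ ↔ a.safe R w M σ ∧ b.safe R w M σ := by
  change _ ∧ _ ∧ True ↔ _; simp
theorem safe_shl (a b : Ex) : (Ex.bin .shl a b).safe R w M σ ↔ a.safe R w M σ ∧ b.safe R w M σ ∧
    a.eval R w σ * 2 ^ b.eval R w σ < 2 ^ w := Iff.rfl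
theorem safe_shr (a b : Ex) :
    (Ex.bin .shr a b).safe R w M σ ↔ a.safe R w M σ ∧ b.safe R w M σ := by
  change _ ∧ _ ∧ True ↔ _; simp
theorem safe_xor (a b : Ex) :
    (Ex.bin .xor a b).safe R w M σ ↔ a.safe R w M σ ∧ b.safe R w M σ := by
  change _ ∧ _ ∧ True ↔ _; simp
theorem safe_ld (a : Ex) : (Ex.ld a).safe R w M σ ↔ a.safe R w M σ ∧ a.eval R w σ < M := Iff.rfl
theorem safe_acc (q : Access) (a b : Ex) : (Ex.acc q a b).safe R w M σ ↔
    a.safe R w M σ ∧ b.safe R w M σ := Iff.rfl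
theorem safe_nv : Ex.nv.safe R w M σ ↔ True := Iff.rfl
theorem safe_wl : Ex.wl.safe R w M σ ↔ True := Iff.rfl

theorem cost_num (c : ℕ) : (no_index (OfNat.ofNat c) : Ex).cost = 1 := rfl
theorem cost_add (a b : Ex) : (a + b).cost = a.cost + b.cost + 1 := rfl
theorem cost_sub (a b : Ex) : (a - b).cost = a.cost + b.cost + 1 := rfl
theorem cost_mul (a b : Ex) : (a * b).cost = a.cost + b.cost + 1 := rfl
theorem cost_div (a b : Ex) : (a / b).cost = a.cost + b.cost + 1 := rfl
theorem cost_mod (a b : Ex) : (a % b).cost = a.cost + b.cost + 1 := rfl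

attribute [simp] eval_var eval_lit eval_num eval_add eval_sub eval_mul eval_div eval_mod eval_shl
  eval_shr eval_xor eval_ld eval_acc eval_nv eval_wl safe_var safe_lit safe_num safe_add safe_sub
  safe_mul safe_div safe_mod safe_shl safe_shr safe_xor safe_ld safe_acc safe_nv safe_wl
  cost_num cost_add cost_sub cost_mul cost_div cost_mod Ex.cost Cmp.holds

end EvalSimp

/-! ### Depth-first search -/

section Dfs

variable (nb : ℕ → ℕ → ℕ) (dg : ℕ → ℕ)

/-- Depth-first search in the graph in which `nb u 0, …, nb u (dg u - 1)` are the neighbors of `u`,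
in big-step form: `Dfs vis pe u j vis' pe'` says that the search, about to inspect the `j`th
neighbor of `u` when the vertices in `vis` have been visited, has visited the vertices in `vis'`
when it is done with `u`. The functions `pe`, `pe'` record for a visited vertex the tree edge
`(u, j)` through which it was discovered. -/
inductive Dfs : Finset ℕ → (ℕ → ℕ × ℕ) → ℕ → ℕ → Finset ℕ → (ℕ → ℕ × ℕ) → Prop
  | done (vis : Finset ℕ) (pe : ℕ → ℕ × ℕ) (u : ℕ) : Dfs vis pe u (dg u) vis pe
  | skip {vis vis' : Finset ℕ} {pe pe' : ℕ → ℕ × ℕ} {u j : ℕ} :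
      j < dg u → nb u j ∈ vis → Dfs vis pe u (j + 1) vis' pe' → Dfs vis pe u j vis' pe'
  | visit {vis vis₁ vis' : Finset ℕ} {pe pe₁ pe' : ℕ → ℕ × ℕ} {u j : ℕ} :
      j < dg u → nb u j ∉ vis →
      Dfs (insert (nb u j) vis) (Function.update pe (nb u j) (u, j)) (nb u j) 0 vis₁ pe₁ →
      Dfs vis₁ pe₁ u (j + 1) vis' pe' → Dfs vis pe u j vis' pe'

/-- The edge relation. -/
def Edge (a b : ℕ) : Prop := ∃ k < dg a, nb a k = b

/-- Reachability. -/
def Reach : ℕ → ℕ → Prop := Relation.ReflTransGen (Edge nb dg)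

/-- Strong connectivity. -/
def SC (a b : ℕ) : Prop := Reach nb dg a b ∧ Reach nb dg b a

variable {nb dg}

theorem SC.symm {a b : ℕ} (h : SC nb dg a b) : SC nb dg b a := ⟨h.2, h.1⟩
theorem SC.trans {a b c : ℕ} (h : SC nb dg a b) (h' : SC nb dg b c) : SC nb dg a c :=
  ⟨h.1.trans h'.1, h'.2.trans h.2⟩
theorem SC.refl (a : ℕ) : SC nb dg a a := ⟨.refl, .refl⟩

theorem Dfs.subset {vis vis' : Finset ℕ} {pe pe' : ℕ → ℕ × ℕ} {u j : ℕ}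
    (h : Dfs nb dg vis pe u j vis' pe') : vis ⊆ vis' := by
  induction h with
  | done => exact subset_rfl
  | skip _ _ _ ih => exact ih
  | visit _ _ _ _ ih1 ih2 => exact (Finset.subset_insert _ _).trans (ih1.trans ih2)

/-- The search does not leave a set closed under taking neighbors. -/
theorem Dfs.subset_of {F vis vis' : Finset ℕ} {pe pe' : ℕ → ℕ × ℕ} {u j : ℕ}
    (hF : ∀ a ∈ F, ∀ k < dg a, nb a k ∈ F) (h : Dfs nb dg vis pe u j vis' pe') (hu : u ∈ F)
    (hv : vis ⊆ F) : vis' ⊆ F := by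
  induction h with
  | done => exact hv
  | skip _ _ _ ih => exact ih hu hv
  | visit h1 _ _ _ ih1 ih2 =>
    have := hF _ hu _ h1
    exact ih2 hu (ih1 this (Finset.insert_subset this hv))

/-- The search terminates. -/
theorem Dfs.exists {F : Finset ℕ} (hF : ∀ a ∈ F, ∀ k < dg a, nb a k ∈ F) :
    ∀ (vis : Finset ℕ) (pe : ℕ → ℕ × ℕ) (u j : ℕ), vis ⊆ F → u ∈ F → j ≤ dg u →
      ∃ vis' pe', Dfs nb dg vis pe u j vis' pe' := by
  -- the number `a` of vertices not yet visited decreases or, failing that, the number `b` of edges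
  -- of `u` left
  suffices H : ∀ (a b : ℕ) (vis : Finset ℕ) (pe : ℕ → ℕ × ℕ) (u j : ℕ), vis ⊆ F → u ∈ F →
      j ≤ dg u → (F \ vis).card ≤ a → dg u - j = b → ∃ vis' pe', Dfs nb dg vis pe u j vis' pe' from
    fun vis pe u j h1 h2 h3 => H _ _ vis pe u j h1 h2 h3 le_rfl rfl
  intro a
  induction a with
  | zero =>
    intro b
    induction b with
    | zero =>
      intro vis pe u j _ _ hj _ hb
      obtain rfl : j = dg u := by omega
      exact ⟨_, _, .done _ _ _⟩
    | succ b ih =>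
      intro vis pe u j hv hu hj hc hb
      obtain ⟨vis', pe', h⟩ := ih vis pe u (j + 1) hv hu (by omega) hc (by omega)
      have : F ⊆ vis := by
        rw [← Finset.sdiff_eq_empty_iff_subset, ← Finset.card_eq_zero]; omega
      exact ⟨_, _, .skip (by omega) (this (hF _ hu _ (by omega))) h⟩
  | succ a iha =>
    intro b
    induction b with
    | zero =>
      intro vis pe u j _ _ hj _ hb
      obtain rfl : j = dg u := by omega
      exact ⟨_, _, .done _ _ _⟩
    | succ b ih =>
      intro vis pe u j hv hu hj hc hb
      by_cases hn : nb u j ∈ vis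
      · obtain ⟨vis', pe', h⟩ := ih vis pe u (j + 1) hv hu (by omega) hc (by omega)
        exact ⟨_, _, .skip (by omega) hn h⟩
      · have hmem := hF _ hu j (by omega)
        have hv1 := Finset.insert_subset hmem hv
        have hlt : (F \ insert (nb u j) vis).card < (F \ vis).card := by
          apply Finset.card_lt_card
          rw [Finset.ssubset_iff_of_subset (Finset.sdiff_subset_sdiff subset_rfl (by simp))]
          exact ⟨nb u j, by simp [hmem, hn], by simp⟩
        obtain ⟨vis1, pe1, h1⟩ := iha _ (insert (nb u j) vis) (Function.update pe (nb u j) (u, j))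
          (nb u j) 0 hv1 hmem (Nat.zero_le _) (by omega) rfl
        have hs : vis1 ⊆ F := h1.subset_of hF hmem hv1
        have hc1 : (F \ vis1).card ≤ a := by
          have := Finset.card_le_card (Finset.sdiff_subset_sdiff (subset_refl F) h1.subset)
          omega
        obtain ⟨vis', pe', h2⟩ := iha _ vis1 pe1 u (j + 1) hs hu (by omega) hc1 rfl
        exact ⟨_, _, .visit (by omega) hn h1 h2⟩

/-- All neighbors inspected have been visited in the end. -/
theorem Dfs.closed {vis vis' : Finset ℕ} {pe pe' : ℕ → ℕ × ℕ} {u j : ℕ}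
    (h : Dfs nb dg vis pe u j vis' pe') :
    (∀ k, j ≤ k → k < dg u → nb u k ∈ vis') ∧
    ∀ x ∈ vis', x ∉ vis → ∀ k < dg x, nb x k ∈ vis' := by
  induction h with
  | done vis pe u => exact ⟨fun k h1 h2 => by omega, fun x h h' => absurd h h'⟩
  | @skip vis vis' pe pe' u j h1 h2 h3 ih =>
    refine ⟨fun k hk hk' => ?_, ih.2⟩
    rcases hk.eq_or_lt with rfl | hk
    · exact h3.subset h2
    · exact ih.1 k hk hk'
  | @visit vis vis₁ vis' pe pe₁ pe' u j h1 h2 h3 h4 ih1 ih2 =>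
    refine ⟨fun k hk hk' => ?_, fun x hx hxv k hk => ?_⟩
    · rcases hk.eq_or_lt with rfl | hk
      · exact h4.subset (h3.subset (Finset.mem_insert_self _ _))
      · exact ih2.1 k hk hk'
    · by_cases hx1 : x ∈ vis₁
      · by_cases hxn : x = nb u j
        · subst hxn; exact h4.subset (ih1.1 k (Nat.zero_le _) hk)
        · exact h4.subset (ih1.2 x hx1 (by simp [hxn, hxv]) k hk)
      · exact ih2.2 x hx hx1 k hk

/-- Everything visited is reachable. -/
theorem Dfs.reach {vis vis' : Finset ℕ} {pe pe' : ℕ → ℕ × ℕ} {u j : ℕ}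
    (h : Dfs nb dg vis pe u j vis' pe') : ∀ x ∈ vis', x ∉ vis → Reach nb dg u x := by
  induction h with
  | done vis pe u => exact fun x h h' => absurd h h'
  | skip h1 h2 h3 ih => exact ih
  | @visit vis vis₁ vis' pe pe₁ pe' u j h1 h2 h3 h4 ih1 ih2 =>
    intro x hx hxv
    have hE : Edge nb dg u (nb u j) := ⟨j, h1, rfl⟩
    by_cases hx1 : x ∈ vis₁
    · by_cases hxn : x = nb u j
      · subst hxn; exact .single hE
      · exact .head hE (ih1 x hx1 (by simp [hxn, hxv]))
    · exact ih2 x hx hx1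

/-- Tree edges of visited vertices do not change. -/
theorem Dfs.pe_eq {vis vis' : Finset ℕ} {pe pe' : ℕ → ℕ × ℕ} {u j : ℕ}
    (h : Dfs nb dg vis pe u j vis' pe') : ∀ x ∈ vis, pe' x = pe x := by
  induction h with
  | done vis pe u => exact fun x _ => rfl
  | skip h1 h2 h3 ih => exact ih
  | @visit vis vis₁ vis' pe pe₁ pe' u j h1 h2 h3 h4 ih1 ih2 =>
    intro x hx
    have hne : x ≠ nb u j := fun h => h2 (h ▸ hx)
    rw [ih2 x (h3.subset (Finset.mem_insert_of_mem hx)), ih1 x (Finset.mem_insert_of_mem hx),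
      Function.update_of_ne hne]

/-- The tree edges of the newly visited vertices. -/
theorem Dfs.pe_new {vis vis' : Finset ℕ} {pe pe' : ℕ → ℕ × ℕ} {u j : ℕ}
    (h : Dfs nb dg vis pe u j vis' pe') : ∀ x ∈ vis', x ∉ vis →
      nb (pe' x).1 (pe' x).2 = x ∧ (pe' x).2 < dg (pe' x).1 ∧
      ((pe' x).1 = u ∨ (pe' x).1 ∈ vis' ∧ (pe' x).1 ∉ vis) := by
  induction h with
  | done vis pe u => exact fun x h h' => absurd h h'
  | skip h1 h2 h3 ih => exact ih
  | @visit vis vis₁ vis' pe pe₁ pe' u j h1 h2 h3 h4 ih1 ih2 =>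
    intro x hx hxv
    have hnb : nb u j ∈ vis₁ := h3.subset (Finset.mem_insert_self _ _)
    by_cases hx1 : x ∈ vis₁
    · rw [h4.pe_eq x hx1]
      by_cases hxn : x = nb u j
      · subst hxn
        rw [h3.pe_eq _ (Finset.mem_insert_self _ _)]
        simp [h1]
      · obtain ⟨a, b, c⟩ := ih1 x hx1 (by simp [hxn, hxv])
        refine ⟨a, b, .inr ?_⟩
        rcases c with c | c
        · rw [c]; exact ⟨h4.subset hnb, h2⟩
        · exact ⟨h4.subset c.1, fun h => c.2 (Finset.mem_insert_of_mem h)⟩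
    · obtain ⟨a, b, c⟩ := ih2 x hx hx1
      refine ⟨a, b, c.imp_right fun c => ⟨c.1, fun h => c.2 ?_⟩⟩
      exact h3.subset (Finset.mem_insert_of_mem h)

variable (nb dg) in
/-- The invariant of a depth-first search started at `rt`, when the vertices in `gray` have been
entered but not left and the `j`th neighbor of `u` is about to be inspected. The last property of
vertices that have been left (those in `vis` but not in `gray`) is the reason why the
algorithm works: if the strong component of such a vertex has no vertex in `gray`, then everything
reachable from it has been left. -/
structure Inv (rt : ℕ) (vis : Finset ℕ) (pe : ℕ → ℕ × ℕ) (gray : Finset ℕ) (u j : ℕ) : Prop where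
  gray_sub : gray ⊆ vis
  cur : u ∈ gray
  reach : ∀ g ∈ gray, Reach nb dg g u
  seen : ∀ k < j, k < dg u → nb u k ∈ vis
  tree : ∀ x ∈ vis, x ≠ rt → nb (pe x).1 (pe x).2 = x ∧ (pe x).2 < dg (pe x).1 ∧
    (pe x).1 ∈ vis ∧ ((pe x).1 = u → (pe x).2 < j)
  left : ∀ x ∈ vis, x ∉ gray → ∀ k < dg x, nb x k ∈ vis
  comp : ∀ y ∈ vis, y ∉ gray → (∀ g ∈ gray, ¬ SC nb dg y g) →
    ∀ z, Reach nb dg y z → z ∈ vis ∧ z ∉ gray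

variable {rt : ℕ} {vis vis₁ gray : Finset ℕ} {pe pe₁ : ℕ → ℕ × ℕ} {u j : ℕ}

/-- Passing an edge to a vertex visited before. -/
theorem Inv.skip (h : Inv nb dg rt vis pe gray u j) (hn : nb u j ∈ vis) :
    Inv nb dg rt vis pe gray u (j + 1) where
  gray_sub := h.gray_sub
  cur := h.cur
  reach := h.reach
  seen k hk hk' := by
    rcases Nat.lt_succ_iff_lt_or_eq.1 hk with hk | rfl
    · exact h.seen k hk hk'
    · exact hn
  tree x hx hxr := by
    obtain ⟨a, b, c, d⟩ := h.tree x hx hxr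
    exact ⟨a, b, c, fun e => (d e).trans (Nat.lt_succ_self _)⟩
  left := h.left
  comp := h.comp

/-- Entering a vertex. -/
theorem Inv.visit (h : Inv nb dg rt vis pe gray u j) (hj : j < dg u) (hn : nb u j ∉ vis) :
    Inv nb dg rt (insert (nb u j) vis) (Function.update pe (nb u j) (u, j))
      (insert (nb u j) gray) (nb u j) 0 where
  gray_sub := Finset.insert_subset_insert _ h.gray_sub
  cur := Finset.mem_insert_self _ _
  reach g hg := by
    rcases Finset.mem_insert.1 hg with rfl | hg
    · exact .refl
    · exact (h.reach g hg).tail ⟨j, hj, rfl⟩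
  seen k hk := by omega
  tree x hx hxr := by
    rcases Finset.mem_insert.1 hx with rfl | hx
    · have huv : u ∈ vis := h.gray_sub h.cur
      rw [Function.update_self]
      refine ⟨rfl, hj, Finset.mem_insert_of_mem huv, fun e => absurd huv ?_⟩
      rwa [show u = nb u j from e]
    · rw [Function.update_of_ne (show x ≠ nb u j from fun e => hn (e ▸ hx))]
      obtain ⟨a, b, c, d⟩ := h.tree x hx hxr
      refine ⟨a, b, Finset.mem_insert_of_mem c, fun e => absurd c ?_⟩
      rwa [e]
  left x hx hxg k hk := by
    rw [Finset.mem_insert, not_or] at hxg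
    exact Finset.mem_insert_of_mem
      (h.left x ((Finset.mem_insert.1 hx).resolve_left hxg.1) hxg.2 k hk)
  comp y hy hyg hg z hz := by
    rw [Finset.mem_insert, not_or] at hyg
    obtain ⟨a, b⟩ := h.comp y ((Finset.mem_insert.1 hy).resolve_left hyg.1) hyg.2
      (fun g hg' => hg g (Finset.mem_insert_of_mem hg')) z hz
    refine ⟨Finset.mem_insert_of_mem a, fun hc => ?_⟩
    rcases Finset.mem_insert.1 hc with rfl | hc
    · exact hn a
    · exact b hc

/-- Leaving a vertex. -/
theorem Inv.leave (h : Inv nb dg rt vis pe gray u j) (hj : j < dg u) (hn : nb u j ∉ vis)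
    (hd : Dfs nb dg (insert (nb u j) vis) (Function.update pe (nb u j) (u, j)) (nb u j) 0 vis₁ pe₁)
    (h1 : Inv nb dg rt vis₁ pe₁ (insert (nb u j) gray) (nb u j) (dg (nb u j))) :
    Inv nb dg rt vis₁ pe₁ gray u (j + 1) := by
  set v := nb u j with hv
  have hsub : vis ⊆ vis₁ := (Finset.subset_insert _ _).trans hd.subset
  have hv1 : v ∈ vis₁ := h1.gray_sub h1.cur
  have huv : u ∈ vis := h.gray_sub h.cur
  have hvg : v ∉ gray := fun e => hn (h.gray_sub e)
  refine ⟨h.gray_sub.trans hsub, h.cur, h.reach, ?_, ?_, ?_, ?_⟩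
  · intro k hk hk'
    rcases Nat.lt_succ_iff_lt_or_eq.1 hk with hk | rfl
    · exact hsub (h.seen k hk hk')
    · exact hv1
  · intro x hx hxr
    obtain ⟨a, b, c, -⟩ := h1.tree x hx hxr
    refine ⟨a, b, c, fun e => ?_⟩
    by_cases hx0 : x ∈ insert v vis
    · rw [hd.pe_eq x hx0] at e ⊢
      by_cases hxv : x = v
      · subst hxv; simp
      · rw [Function.update_of_ne hxv] at e ⊢
        have := (h.tree x (Finset.mem_of_mem_insert_of_ne hx0 hxv) hxr).2.2.2 e
        omega
    · rcases (hd.pe_new x hx hx0).2.2 with c | c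
      · exact absurd (c ▸ e ▸ huv) hn
      · exact absurd (e ▸ Finset.mem_insert_of_mem huv) c.2
  · intro x hx hxg k hk
    by_cases hxv : x = v
    · exact hxv ▸ h1.seen k (hxv ▸ hk) (hxv ▸ hk)
    · exact h1.left x hx (by simp [hxv, hxg]) k hk
  · -- a component without gray vertices that is left together with `v`
    have key : (∀ g ∈ gray, ¬ SC nb dg v g) → ∀ z, Reach nb dg v z → z ∈ vis₁ ∧ z ∉ gray := by
      intro hg z hz
      induction hz with
      | refl => exact ⟨hv1, hvg⟩
      | @tail b c hb hbc ih =>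
        obtain ⟨k, hk, rfl⟩ := hbc
        have hmem : nb b k ∈ vis₁ := by
          by_cases hbv : b = v
          · exact hbv ▸ h1.seen k (hbv ▸ hk) (hbv ▸ hk)
          · exact h1.left b ih.1 (by simp [hbv, ih.2]) k hk
        refine ⟨hmem, fun hgr => hg _ hgr ⟨hb.tail ⟨k, hk, rfl⟩, ?_⟩⟩
        exact (h.reach _ hgr).tail ⟨j, hj, rfl⟩
    intro y hy hyg hg z hz
    by_cases hyv : SC nb dg y v
    · exact key (fun g hgg hc => hg g hgg (hyv.trans hc)) z (hyv.2.trans hz)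
    · have hne : y ≠ v := fun e => hyv (e ▸ SC.refl _)
      obtain ⟨a, b⟩ := h1.comp y hy (by simp [hne, hyg]) (fun g hgg => by
        rcases Finset.mem_insert.1 hgg with rfl | hgg
        · exact hyv
        · exact hg g hgg) z hz
      exact ⟨a, fun hc => b (Finset.mem_insert_of_mem hc)⟩

/-- The invariant holds in the end if it holds in the beginning. -/
theorem Dfs.inv {vis vis' : Finset ℕ} {pe pe' : ℕ → ℕ × ℕ} {u j : ℕ}
    (h : Dfs nb dg vis pe u j vis' pe') :
    ∀ {gray : Finset ℕ}, Inv nb dg rt vis pe gray u j → Inv nb dg rt vis' pe' gray u (dg u) := by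
  induction h with
  | done vis pe u => exact fun h => h
  | skip h1 h2 h3 ih => exact fun h => ih (h.skip h2)
  | visit h1 h2 h3 h4 ih1 ih2 => exact fun h => ih2 (h.leave h1 h2 h3 (ih1 (h.visit h1 h2)))

/-- When a vertex `v` is about to be left, a vertex `y` from which `v` can be reached is in the
strong component of `v`, or that component contains a vertex other than `v` that has not yet
been left. -/
theorem Inv.later (h : Inv nb dg rt vis pe gray u j) {y : ℕ} (hy : Reach nb dg y u) :
    SC nb dg y u ∨ ∃ a, SC nb dg y a ∧ a ≠ u ∧ (a ∉ vis ∨ a ∈ gray) := by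
  by_contra! hc
  obtain ⟨h1, h2⟩ := hc
  have h3 : ∀ a, SC nb dg y a → a ∈ vis ∧ a ∉ gray := fun a ha =>
    h2 a ha (fun e => h1 (e ▸ ha))
  obtain ⟨a, b⟩ := h3 y (SC.refl _)
  exact (h.comp y a b (fun g hg hs => (h3 g hs).2 hg) u hy).2 h.cur

end Dfs

/-! ### The input graph on natural numbers -/

section Graph

variable {n : ℕ} {G : Digraph (Fin n)} (R : AdjArrays G)

/-- Outdegree of vertex number `v`. This and the following functions are the access functions, with
value 0 for invalid arguments. -/
def od (v : ℕ) : ℕ := Access.outdeg.value R v 0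
/-- The `i`th outneighbor of vertex number `v`. -/
def oh (v i : ℕ) : ℕ := Access.outhead.value R v i
/-- The position of `v` among the inneighbors of its `i`th outneighbor. -/
def om (v i : ℕ) : ℕ := Access.outmate.value R v i
/-- Indegree of vertex number `v`. -/
def idg (v : ℕ) : ℕ := Access.indeg.value R v 0
/-- The `i`th inneighbor of vertex number `v`. -/
def ih (v i : ℕ) : ℕ := Access.inhead.value R v i
/-- The position of `v` among the outneighbors of its `i`th inneighbor. -/
def im (v i : ℕ) : ℕ := Access.inmate.value R v i

/-- The graph with all edges reversed. -/
def flipGraph (G : Digraph (Fin n)) : Digraph (Fin n) := ⟨fun a b => G.Adj b a⟩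

/-- Exchanging in-arrays and out-arrays represents the reversed graph. -/
def flipArrays : AdjArrays (flipGraph G) where
  out := R.inn
  out_nodup := R.inn_nodup
  mem_out := fun v u => R.mem_inn v u
  inn := R.out
  inn_nodup := R.out_nodup
  mem_inn := fun v u => R.mem_out v u

theorem od_eq (v : Fin n) : od R v = (R.out v).length := by
  simp [od, Access.value]

theorem idg_eq (v : Fin n) : idg R v = (R.inn v).length := by
  simp [idg, Access.value]

theorem oh_eq (v : Fin n) (i : ℕ) (h : i < (R.out v).length) : oh R v i = (R.out v)[i] := by
  simp [oh, Access.value, h]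

theorem ih_eq (v : Fin n) (i : ℕ) (h : i < (R.inn v).length) : ih R v i = (R.inn v)[i] := by
  simp [ih, Access.value, h]

theorem om_eq (v : Fin n) (i : ℕ) (h : i < (R.out v).length) :
    om R v i = (R.inn (R.out v)[i]).idxOf v := by
  simp [om, Access.value, h]

theorem im_eq (v : Fin n) (i : ℕ) (h : i < (R.inn v).length) :
    im R v i = (R.out (R.inn v)[i]).idxOf v := by
  simp [im, Access.value, h]

/-- The cross links. -/
theorem out_spec {v i : ℕ} (hv : v < n) (hi : i < od R v) :
    oh R v i < n ∧ om R v i < idg R (oh R v i) ∧ ih R (oh R v i) (om R v i) = v ∧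
      im R (oh R v i) (om R v i) = i := by
  have hi' : i < (R.out ⟨v, hv⟩).length := by rwa [← od_eq R ⟨v, hv⟩]
  have h1 := oh_eq R ⟨v, hv⟩ i hi'
  have h2 := om_eq R ⟨v, hv⟩ i hi'
  simp only at h1 h2
  set u := (R.out ⟨v, hv⟩)[i] with hu
  have hmem : (⟨v, hv⟩ : Fin n) ∈ R.inn u := by
    rw [R.mem_inn, ← R.mem_out]; exact List.getElem_mem _
  have hlt : om R v i < (R.inn u).length := by rw [h2]; exact List.idxOf_lt_length_of_mem hmem
  have hget : (R.inn u)[om R v i] = ⟨v, hv⟩ := by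
    simp only [h2]; exact List.getElem_idxOf _
  refine ⟨by rw [h1]; exact u.2, by rwa [h1, idg_eq], ?_, ?_⟩
  · rw [h1, ih_eq R u _ hlt, hget]
  · rw [h1, im_eq R u _ hlt, hget]
    exact (R.out_nodup _).idxOf_getElem i hi'

/-- The cross links in the other direction, by symmetry. -/
theorem in_spec {v i : ℕ} (hv : v < n) (hi : i < idg R v) :
    ih R v i < n ∧ im R v i < od R (ih R v i) ∧ oh R (ih R v i) (im R v i) = v ∧
      om R (ih R v i) (im R v i) = i :=
  out_spec (flipArrays R) hv hi

theorem adj_iff {u v : Fin n} : G.Adj u v ↔ ∃ i < od R u, oh R u i = v := by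
  rw [← R.mem_out, List.mem_iff_getElem, od_eq]
  constructor
  · rintro ⟨i, hi, h⟩
    exact ⟨i, hi, by rw [oh_eq R u i hi, h]⟩
  · rintro ⟨i, hi, h⟩
    exact ⟨i, hi, by rw [oh_eq R u i hi] at h; exact Fin.ext h⟩

theorem od_eq_outDegree (v : Fin n) : od R v = outDegree G v := by
  rw [od_eq, outDegree, ← List.toFinset_card_of_nodup (R.out_nodup v), ← Set.ncard_coe_finset]
  congr 1; ext u; simp [R.mem_out]

theorem idg_eq_inDegree (v : Fin n) : idg R v = inDegree G v := by
  rw [idg_eq, inDegree, ← List.toFinset_card_of_nodup (R.inn_nodup v), ← Set.ncard_coe_finset]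
  congr 1; ext u; simp [R.mem_inn]

theorem numEdges_eq_od : numEdges G = ∑ v ∈ Finset.range n, od R v := by
  classical
  rw [Finset.sum_range, numEdges]
  have : {p : Fin n × Fin n | G.Adj p.1 p.2} =
      ((Finset.univ.sigma fun v => (R.out v).toFinset).map
        ⟨fun x : (_ : Fin n) × Fin n => (x.1, x.2), fun a b h => by
          cases a; cases b; simp at h; simp [h]⟩ : Finset (Fin n × Fin n)) := by
    ext ⟨a, b⟩
    simp only [Set.mem_ofPred_eq, Finset.coe_map, Set.mem_image, Finset.mem_coe, Finset.mem_sigma,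
      List.mem_toFinset, Finset.mem_univ, true_and]
    constructor
    · intro h; exact ⟨⟨a, b⟩, (R.mem_out _ _).2 h, rfl⟩
    · rintro ⟨⟨x, y⟩, h1, h2⟩
      cases h2; exact (R.mem_out _ _).1 h1
  rw [this, Set.ncard_coe_finset, Finset.card_map, Finset.card_sigma]
  refine Finset.sum_congr rfl fun v _ => ?_
  rw [List.toFinset_card_of_nodup (R.out_nodup v), od_eq]

theorem numEdges_eq_idg : numEdges G = ∑ v ∈ Finset.range n, idg R v := by
  have h := numEdges_eq_od (flipArrays R)
  rw [show (∑ v ∈ Finset.range n, idg R v) = ∑ v ∈ Finset.range n, od (flipArrays R) v from rfl,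
    ← h, numEdges, numEdges]
  refine Set.ncard_congr (fun p _ => (p.2, p.1)) (fun p hp => hp) (fun p q _ _ h => ?_)
    (fun p hp => ⟨(p.2, p.1), hp, rfl⟩)
  simp only [Prod.mk.injEq] at h
  exact Prod.ext h.2 h.1

theorem od_le (v : ℕ) : od R v ≤ n := value_le R _ _ _
theorem idg_le (v : ℕ) : idg R v ≤ n := value_le R _ _ _
theorem value_outdeg (v i : ℕ) : Access.outdeg.value R v i = od R v := rfl
theorem value_indeg (v i : ℕ) : Access.indeg.value R v i = idg R v := rfl
theorem value_outhead (v i : ℕ) : Access.outhead.value R v i = oh R v i := rfl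
theorem value_outmate (v i : ℕ) : Access.outmate.value R v i = om R v i := rfl
theorem value_inhead (v i : ℕ) : Access.inhead.value R v i = ih R v i := rfl
theorem value_inmate (v i : ℕ) : Access.inmate.value R v i = im R v i := rfl

end Graph

/-! ### Bit planes -/

section Planes

variable (n : ℕ) (l : ℕ → ℕ)

/-- Number of `u < v` with a bit in plane `t`. -/
def cnt (t v : ℕ) : ℕ := ∑ u ∈ Finset.range v, if t ≤ l u then 1 else 0

/-- Start of plane `t`. -/
def off (t : ℕ) : ℕ := ∑ s ∈ Finset.range t, cnt l s n

/-- Position of the bit of `v` in plane `t`. Vertex `v` has a bit in the planes `0, …, l v`. -/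
def pos (t v : ℕ) : ℕ := off n l t + cnt l t v

theorem cnt_succ (t v : ℕ) : cnt l t (v + 1) = cnt l t v + if t ≤ l v then 1 else 0 :=
  Finset.sum_range_succ _ _

theorem cnt_zero_left (v : ℕ) : cnt l 0 v = v := by simp [cnt]

theorem off_succ (t : ℕ) : off n l (t + 1) = off n l t + cnt l t n := Finset.sum_range_succ _ _

theorem pos_zero (v : ℕ) : pos n l 0 v = v := by simp [pos, off, cnt_zero_left]

theorem cnt_mono (t : ℕ) : Monotone (cnt l t) :=
  monotone_nat_of_le_succ fun v => by rw [cnt_succ]; omega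

theorem off_mono : Monotone (off n l) :=
  monotone_nat_of_le_succ fun t => by rw [off_succ]; omega

variable {n l}

theorem pos_lt_off {t v : ℕ} (hv : v < n) (ht : t ≤ l v) : pos n l t v < off n l (t + 1) := by
  have h1 : cnt l t (v + 1) ≤ cnt l t n := cnt_mono l t hv
  rw [cnt_succ, if_pos ht] at h1
  rw [pos, off_succ]; omega

theorem pos_inj {t v t' v' : ℕ} (hv : v < n) (ht : t ≤ l v) (hv' : v' < n) (ht' : t' ≤ l v')
    (h : pos n l t v = pos n l t' v') : t = t' ∧ v = v' := by
  have key : ∀ {t v t' v' : ℕ}, v < n → t ≤ l v → t < t' → pos n l t v < pos n l t' v' := by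
    intro t v t' v' hv ht htt
    have h1 := pos_lt_off hv ht
    have h2 : off n l (t + 1) ≤ off n l t' := off_mono n l htt
    rw [pos.eq_def n l t' v']; omega
  have key2 : ∀ {t v v' : ℕ}, t ≤ l v → v < v' → pos n l t v < pos n l t v' := by
    intro t v v' ht hvv
    have h1 : cnt l t (v + 1) ≤ cnt l t v' := cnt_mono l t hvv
    rw [cnt_succ, if_pos ht] at h1
    simp only [pos]; omega
  have htt : t = t' := by
    rcases lt_trichotomy t t' with h1 | h1 | h1
    · have := key hv ht h1 (v' := v'); omega
    · exact h1
    · have := key hv' ht' h1 (v' := v); omega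
  subst htt
  refine ⟨rfl, ?_⟩
  rcases lt_trichotomy v v' with h1 | h1 | h1
  · have := key2 ht h1; omega
  · exact h1
  · have := key2 ht' h1; omega

theorem off_le (t : ℕ) : off n l t ≤ n + ∑ v ∈ Finset.range n, l v := by
  simp only [off, cnt]
  rw [Finset.sum_comm, show n + ∑ v ∈ Finset.range n, l v = ∑ v ∈ Finset.range n, (l v + 1) by
    simp [Finset.sum_add_distrib, add_comm]]
  refine Finset.sum_le_sum fun v _ => ?_
  rw [← Finset.card_filter]
  calc _ ≤ (Finset.range (l v + 1)).card := Finset.card_le_card fun s hs => by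
        simp only [Finset.mem_filter, Finset.mem_range] at hs ⊢; omega
    _ = _ := by simp

theorem off_eq {t : ℕ} (ht : ∀ v < n, l v < t) : off n l t = n + ∑ v ∈ Finset.range n, l v := by
  simp only [off, cnt]
  rw [Finset.sum_comm, show n + ∑ v ∈ Finset.range n, l v = ∑ v ∈ Finset.range n, (l v + 1) by
    simp [Finset.sum_add_distrib, add_comm]]
  refine Finset.sum_congr rfl fun v hv => ?_
  rw [← Finset.card_filter]
  have : Finset.filter (fun s => s ≤ l v) (Finset.range t) = Finset.range (l v + 1) := by
    have := ht v (Finset.mem_range.1 hv)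
    ext s; simp only [Finset.mem_filter, Finset.mem_range]; omega
  rw [this]; simp

theorem pos_lt {t v : ℕ} (hv : v < n) (ht : t ≤ l v) :
    pos n l t v < n + ∑ v ∈ Finset.range n, l v :=
  (pos_lt_off hv ht).trans_le (off_le _)

/-- If the bits say which vertices have a bit in the next plane, the position there is found by
counting the ones. -/
theorem pos_next {B : ℕ → ℕ}
    (hB : ∀ v < n, ∀ t ≤ l v, B (pos n l t v) = if t < l v then 1 else 0) {t v : ℕ} (hv : v ≤ n) :
    n + ∑ i ∈ Finset.range (pos n l t v), B i = pos n l (t + 1) v := by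
  induction t generalizing v with
  | zero =>
    induction v with
    | zero => simp [pos, off, cnt]
    | succ v ih =>
      have h1 := ih (by omega)
      have h2 := hB v hv 0 (Nat.zero_le _)
      simp only [pos_zero] at *
      rw [Finset.sum_range_succ, ← add_assoc, h1, h2]
      simp only [pos, cnt_succ, add_assoc, Nat.lt_iff_add_one_le, Nat.zero_add]
  | succ t iht =>
    induction v with
    | zero =>
      have h1 := iht (v := n) le_rfl
      have h2 : pos n l t n = pos n l (t + 1) 0 := by
        simp [pos, off_succ, cnt]
      rw [← h2, h1]
      simp only [pos]
      rw [off_succ n l (t + 1)]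
      simp [cnt]
    | succ v ih =>
      have h1 := ih (by omega)
      by_cases ht : t + 1 ≤ l v
      · have h2 := hB v hv (t + 1) ht
        have h3 : pos n l (t + 1) (v + 1) = pos n l (t + 1) v + 1 := by
          simp [pos, cnt_succ, ht, add_assoc]
        rw [h3, Finset.sum_range_succ, ← add_assoc, h1, h2]
        simp only [pos, cnt_succ, add_assoc, Nat.lt_iff_add_one_le]
      · have h3 : pos n l (t + 1) (v + 1) = pos n l (t + 1) v := by
          simp [pos, cnt_succ, ht]
        rw [h3, h1]
        simp only [pos, cnt_succ]
        rw [if_neg (by omega), add_zero]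

end Planes

/-! ### Bits in words -/

/-- Number of ones in the binary representation. -/
def popc (x : ℕ) : ℕ := if x = 0 then 0 else x % 2 + popc (x / 2)
decreasing_by omega

theorem popc_zero : popc 0 = 0 := by rw [popc]; simp

theorem popc_eq (x : ℕ) : popc x = x % 2 + popc (x / 2) := by
  by_cases h : x = 0
  · subst h; simp [popc_zero]
  · rw [popc]; simp [h]

theorem popc_mod (k y : ℕ) : popc (y % 2 ^ k) = ∑ i ∈ Finset.range k, y / 2 ^ i % 2 := by
  induction k generalizing y with
  | zero => simp [Nat.mod_one, popc_zero]
  | succ k ih =>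
    rw [popc_eq, Finset.sum_range_succ']
    have h1 : y % 2 ^ (k + 1) % 2 = y % 2 := Nat.mod_mod_of_dvd _ (dvd_pow_self 2 (by omega))
    have h2 : y % 2 ^ (k + 1) / 2 = y / 2 % 2 ^ k := by
      rw [pow_succ', Nat.mod_mul_right_div_self]
    rw [h1, h2, ih]
    simp only [pow_zero, Nat.div_one, Nat.div_div_eq_div_mul, ← pow_succ']
    ring

/-- Bit `p` of a bit array in which the words from `A` on hold `W` bits each. -/
def bit (A W : ℕ) (m : ℕ → ℕ) (p : ℕ) : ℕ := m (A + p / W) / 2 ^ (p % W) % 2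

theorem bit_lt (A W : ℕ) (m : ℕ → ℕ) (p : ℕ) : bit A W m p < 2 := Nat.mod_lt _ (by norm_num)

theorem bit_congr {A W : ℕ} {m m' : ℕ → ℕ} {p : ℕ} (h : m' (A + p / W) = m (A + p / W)) :
    bit A W m' p = bit A W m p := by simp [bit, h]

/-- The word that results from setting bit `p` to `x`. -/
def bitWord (A W : ℕ) (m : ℕ → ℕ) (p x : ℕ) : ℕ :=
  m (A + p / W) ^^^ ((bit A W m p ^^^ x) * 2 ^ (p % W))

/-- Reading the bits of the array after one of them has been set. -/
theorem bit_put {A W : ℕ} (σ : St) {p x : ℕ} (hx : x < 2) (p' : ℕ) :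
    bit A W (σ.put (A + p / W) (bitWord A W σ.mem p x)).mem p' =
      if p' = p then x else bit A W σ.mem p' := by
  by_cases ha : p' / W = p / W
  · have e : ∀ b : ℕ, b < 2 → ∀ i, (b * 2 ^ (p % W)).testBit i = (decide (i = p % W) && b.testBit 0) := by
      intro b hb i
      rw [Nat.testBit_mul_two_pow]
      rcases lt_trichotomy i (p % W) with h | h | h
      · simp [h.ne]; omega
      · simp [h]
      · have : b.testBit (i - p % W) = false := Nat.testBit_lt_two_pow
          (hb.trans_le (by
            calc 2 = 2 ^ 1 := rfl
              _ ≤ _ := Nat.pow_le_pow_right (by norm_num) (by omega)))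
        simp [this, h.ne']
    have hb := bit_lt A W σ.mem p
    have hxb : bit A W σ.mem p ^^^ x < 2 := Nat.xor_lt_two_pow (n := 1) hb hx
    simp only [bit, St.put_mem, ha, if_true]
    rw [← Nat.toNat_testBit, ← Nat.toNat_testBit, bitWord, Nat.testBit_xor, e _ hxb]
    by_cases hp : p' % W = p % W
    · have hpp : p' = p := by rw [← Nat.div_add_mod p' W, ← Nat.div_add_mod p W, ha, hp]
      rw [if_pos hpp, hp, Nat.testBit_xor]
      have : (bit A W σ.mem p).testBit 0 = (σ.mem (A + p / W)).testBit (p % W) := by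
        rw [bit, ← Nat.toNat_testBit]
        cases (σ.mem (A + p / W)).testBit (p % W) <;> rfl
      rw [this]
      interval_cases x <;> cases (σ.mem (A + p / W)).testBit (p % W) <;> simp
    · rw [if_neg (fun h => hp (by rw [h]))]
      simp [hp]
  · rw [if_neg (fun h => ha (by rw [h]))]
    exact bit_congr (by rw [St.put_mem, if_neg (by omega)])

/-- A chunk of a word: the bits from the last multiple of `b` up to `p`. -/
theorem bit_chunk {A W b r : ℕ} (hb : 0 < b) (hr : 0 < r) (hW : W = r * b) (m : ℕ → ℕ) (p : ℕ) :
    ∑ i ∈ Finset.range p, bit A W m i = ∑ i ∈ Finset.range (p / b * b), bit A W m i +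
      popc (m (A + p / W) / 2 ^ (p % W - p % b) % 2 ^ (p % b)) := by
  have hp : p = p / b * b + p % b := (Nat.div_add_mod' p b).symm
  rw [popc_mod]
  conv_lhs => rw [hp, Finset.sum_range_add]
  congr 1
  refine Finset.sum_congr rfl fun j hj => ?_
  rw [Finset.mem_range] at hj
  have hmod : p % W % b = p % b := Nat.mod_mod_of_dvd _ ⟨r, by rw [hW, mul_comm]⟩
  have hle : p % b ≤ p % W := hmod ▸ Nat.mod_le _ _
  have hWp : 0 < W := by rw [hW]; positivity
  have hlt : p % W < W := Nat.mod_lt _ hWp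
  have he : p / b * b + j = W * (p / W) + (p % W - p % b + j) := by
    have := Nat.div_add_mod p W
    omega
  have h1 : (p / b * b + j) / W = p / W := by
    rw [he, Nat.mul_add_div hWp, Nat.div_eq_of_lt (show p % W - p % b + j < W by omega),
      add_zero]
  have h2 : (p / b * b + j) % W = p % W - p % b + j := by
    rw [he, Nat.mul_add_mod, Nat.mod_eq_of_lt (by omega)]
  rw [bit, h1, h2, Nat.div_div_eq_div_mul, ← pow_add]

/-! ### The memory layout and access to bits -/

/-- The layout of the memory. The words below `DB` hold a table of popcounts (followed by pointers
needed to build the planes), the words from `DB` on the rank directory, the words from `BB` on an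
array of `NB` bits, of which each word holds `W`. The first `N` bits say which vertices have a bit
in the next plane, the next `N` bits are the planes themselves, the others form a stack. Rank is
computed from chunks of `b` bits, `g` of which share two words of the directory: one for the number
of ones before the first chunk, and one holding, in fields of `q` bits, the numbers of ones between
the first chunk and the others. Such `g` chunks form a superblock. -/
structure Lay (w M : ℕ) where
  n : ℕ
  l : ℕ → ℕ
  W : ℕ
  b : ℕ
  r : ℕ
  g : ℕ
  q : ℕ
  N : ℕ
  DB : ℕ
  BB : ℕ
  NB : ℕ
  W_eq : W = r * b
  b_pos : 0 < b
  r_pos : 0 < r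
  g_pos : 0 < g
  W_le : W ≤ w
  b_lt : b < w
  q_lt : q < w
  gq_le : g * q ≤ w
  tab_le : 2 ^ b ≤ DB
  dir_le : DB + 2 * (N / b / g) + 2 ≤ BB
  bits_le : BB + NB / W + 1 ≤ M
  M_lt : M < 2 ^ w
  NB_lt : NB < 2 ^ w
  N_eq : N = n + ∑ v ∈ Finset.range n, l v
  N_le : 2 * N ≤ NB
  l_lt : ∀ v < n, 2 ^ (l v + 1) < 2 ^ w

/-- The number of vertices. -/
abbrev xn : Ex := .var 0
/-- The number of bits used per word. -/
abbrev xW : Ex := .var 1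
/-- The number of bits of a chunk. -/
abbrev xb : Ex := .var 2
/-- The number of chunks of a superblock. -/
abbrev xg : Ex := .var 3
/-- The number of bits of a field of the directory. -/
abbrev xq : Ex := .var 4
/-- The start of the directory. -/
abbrev xDB : Ex := .var 5
/-- The start of the bit array. -/
abbrev xBB : Ex := .var 6
/-- The number of bits of the planes. -/
abbrev xN : Ex := .var 7

/-- Bit `e` of the bit array. -/
def getE (e : Ex) : Ex := .bin .shr (.ld (xBB + e / xW)) (e % xW) % 2

/-- Set bit `e` of the bit array to `x`. -/
def setS (e x : Ex) : Sm :=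
  .st (xBB + e / xW) (.bin .xor (.ld (xBB + e / xW)) (.bin .shl (.bin .xor (getE e) x) (e % xW)))

/-- The position of a vertex in the next plane, its position being in variable `x`. -/
def nextE (x : ℕ) : Ex :=
  xn + (.ld (xDB + 2 * (.var x / xb / xg)) +
    .bin .shr (.ld (xDB + 2 * (.var x / xb / xg) + 1)) (.var x / xb % xg * xq) % .bin .shl 1 xq +
    .ld (.bin .shr (.ld (xBB + .var x / xW)) (.var x % xW - .var x % xb) %
      .bin .shl 1 (.var x % xb)))

section Rules

variable {w M n : ℕ} {G : Digraph (Fin n)} {R : AdjArrays G} {σ : St} {t : ℕ}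
  {Q : St → ℕ → Prop}

theorem wp_asg {x a : ℕ} {e : Ex} (he : e.safe R w M σ) (hv : e.eval R w σ = a)
    (h : Q (σ.set x a) (t + (e.cost + 1))) : (Sm.asg x e).wp R w M σ t Q := by
  subst hv; exact ⟨he, h⟩

theorem wp_asg_seq {x a : ℕ} {e : Ex} {q : Sm} (he : e.safe R w M σ) (hv : e.eval R w σ = a)
    (h : q.wp R w M (σ.set x a) (t + (e.cost + 1)) Q) : (Sm.asg x e ;; q).wp R w M σ t Q := by
  subst hv; exact ⟨he, h⟩

theorem wp_st_seq {y a : ℕ} {d e : Ex} {q : Sm} (hd : d.safe R w M σ) (he : e.safe R w M σ)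
    (hdv : d.eval R w σ = y) (hv : e.eval R w σ = a) (hM : y < M)
    (h : q.wp R w M (σ.put y a) (t + (d.cost + e.cost + 1)) Q) :
    (Sm.st d e ;; q).wp R w M σ t Q := by
  subst hv hdv; exact ⟨hd, he, hM, h⟩

theorem wp_ite {c : Cmp} {d e : Ex} {p q : Sm} {x y : ℕ} (hd : d.safe R w M σ)
    (he : e.safe R w M σ) (hx : d.eval R w σ = x) (hy : e.eval R w σ = y)
    (h1 : c.holds x y → p.wp R w M σ (t + (d.cost + e.cost + 1)) Q)
    (h2 : ¬ c.holds x y → q.wp R w M σ (t + (d.cost + e.cost + 1)) Q) :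
    (Sm.ite c d e p q).wp R w M σ t Q := by
  subst hx hy; exact ⟨hd, he, h1, h2⟩

theorem wp_seq {p q : Sm} (h : p.wp R w M σ t (fun σ' t' => q.wp R w M σ' t' Q)) :
    (p ;; q).wp R w M σ t Q := h

end Rules

namespace Lay

variable {w M : ℕ} (Λ : Lay w M)

theorem W_pos : 0 < Λ.W := by
  have h1 := Λ.b_pos
  have h2 := Λ.r_pos
  rw [Λ.W_eq]; positivity

theorem w_pos (Λ : Lay w M) : 0 < w := Λ.W_pos.trans_le Λ.W_le

theorem n_le : Λ.n ≤ Λ.N := by rw [Λ.N_eq]; omega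

theorem two_lt (Λ : Lay w M) : 2 < 2 ^ w := by
  have h1 := Λ.b_pos
  have h2 := Λ.b_lt
  calc 2 < 2 ^ 2 := by norm_num
    _ ≤ 2 ^ w := Nat.pow_le_pow_right (by norm_num) (by omega)

theorem BB_lt : Λ.BB < M := by
  have h1 := Λ.bits_le
  generalize Λ.NB / Λ.W = a at h1
  omega

theorem dir_lt {p : ℕ} (hp : p ≤ Λ.N) : Λ.DB + 2 * (p / Λ.b / Λ.g) + 1 < Λ.BB := by
  have h1 := Λ.dir_le
  have h2 : p / Λ.b / Λ.g ≤ Λ.N / Λ.b / Λ.g := Nat.div_le_div_right (Nat.div_le_div_right hp)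
  generalize Λ.N / Λ.b / Λ.g = a at *
  generalize p / Λ.b / Λ.g = a at *
  omega

theorem DB_lt : Λ.DB < Λ.BB := by
  have := Λ.dir_lt (Nat.zero_le _)
  generalize 0 / Λ.b / Λ.g = a at *
  omega

theorem addr_lt {p : ℕ} (hp : p < Λ.NB) : Λ.BB + p / Λ.W < M := by
  have h1 := Λ.bits_le
  have h2 := Nat.div_le_div_right (c := Λ.W) hp.le
  omega

/-- The variables that describe the layout. -/
structure Vars (σ : St) : Prop where
  h0 : σ.v 0 = Λ.n
  h1 : σ.v 1 = Λ.W
  h2 : σ.v 2 = Λ.b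
  h3 : σ.v 3 = Λ.g
  h4 : σ.v 4 = Λ.q
  h5 : σ.v 5 = Λ.DB
  h6 : σ.v 6 = Λ.BB
  h7 : σ.v 7 = Λ.N

/-- The value of a bit. -/
abbrev bt (m : ℕ → ℕ) (p : ℕ) : ℕ := bit Λ.BB Λ.W m p

/-- The state after setting a bit. -/
def setBit (σ : St) (p x : ℕ) : St := σ.put (Λ.BB + p / Λ.W) (bitWord Λ.BB Λ.W σ.mem p x)

variable {Λ}

theorem Vars.congr {σ σ' : St} (h : Λ.Vars σ) (hv : ∀ x < 8, σ'.v x = σ.v x) : Λ.Vars σ' :=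
  ⟨(hv 0 (by omega)).trans h.h0, (hv 1 (by omega)).trans h.h1, (hv 2 (by omega)).trans h.h2,
    (hv 3 (by omega)).trans h.h3, (hv 4 (by omega)).trans h.h4, (hv 5 (by omega)).trans h.h5,
    (hv 6 (by omega)).trans h.h6, (hv 7 (by omega)).trans h.h7⟩

theorem Vars.set {σ : St} (h : Λ.Vars σ) {x a : ℕ} (hx : 8 ≤ x) : Λ.Vars (σ.set x a) :=
  h.congr fun y hy => by rw [St.set_v, if_neg (by omega)]

@[simp] theorem setBit_v (σ : St) (p x : ℕ) : (Λ.setBit σ p x).v = σ.v := rfl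
@[simp] theorem setBit_out (σ : St) (p x : ℕ) : (Λ.setBit σ p x).out = σ.out := rfl

theorem Vars.setBit {σ : St} (h : Λ.Vars σ) (p x : ℕ) : Λ.Vars (Λ.setBit σ p x) :=
  h.congr fun _ _ => rfl

theorem bt_setBit (σ : St) {p x : ℕ} (hx : x < 2) (p' : ℕ) :
    Λ.bt (Λ.setBit σ p x).mem p' = if p' = p then x else Λ.bt σ.mem p' :=
  bit_put σ hx p'

theorem mem_setBit (σ : St) (p x : ℕ) {a : ℕ} (ha : a < Λ.BB) :
    (Λ.setBit σ p x).mem a = σ.mem a := by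
  rw [setBit, St.put_mem, if_neg (Nat.ne_of_lt (ha.trans_le (Nat.le_add_right _ _)))]

variable {n : ℕ} {G : Digraph (Fin n)} {R : AdjArrays G}

theorem eval_getE {σ : St} (h : Λ.Vars σ) (e : Ex) :
    (getE e).eval R w σ = Λ.bt σ.mem (e.eval R w σ) := by
  simp [getE, bit, h.h6, h.h1]

theorem safe_getE {σ : St} (h : Λ.Vars σ) {e : Ex} (he : e.safe R w M σ)
    (hp : e.eval R w σ < Λ.NB) : (getE e).safe R w M σ := by
  have h1 := Λ.addr_lt hp
  have h2 := Λ.M_lt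
  have h3 := Λ.two_lt
  simp [getE, h.h6, h.h1, he, h1, h1.trans h2, h3]

theorem cost_getE (e : Ex) : (getE e).cost = 2 * e.cost + 10 := by
  simp [getE]; ring

theorem wp_setS {σ : St} {t : ℕ} {Q : St → ℕ → Prop} (h : Λ.Vars σ) {e x : Ex}
    (he : e.safe R w M σ) (hx : x.safe R w M σ) {p y : ℕ} (hp : e.eval R w σ = p)
    (hy : x.eval R w σ = y) (hpN : p < Λ.NB) (hy2 : y < 2)
    (hQ : Q (Λ.setBit σ p y) (t + (5 * e.cost + x.cost + 25))) :
    (setS e x).wp R w M σ t Q := by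
  subst hp hy
  have h1 := Λ.addr_lt hpN
  have h2 := Λ.M_lt
  have hs := safe_getE (R := R) h he hpN
  have hb : Λ.bt σ.mem (e.eval R w σ) < 2 := bit_lt _ _ _ _
  have h3 : (Λ.bt σ.mem (e.eval R w σ) ^^^ x.eval R w σ) * 2 ^ (e.eval R w σ % Λ.W) < 2 ^ w := by
    have h4 : Λ.bt σ.mem (e.eval R w σ) ^^^ x.eval R w σ < 2 :=
      Nat.xor_lt_two_pow (n := 1) hb hy2
    calc _ ≤ 1 * 2 ^ (e.eval R w σ % Λ.W) := Nat.mul_le_mul_right _ (by omega)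
      _ < 2 ^ w := by
        rw [one_mul]
        exact Nat.pow_lt_pow_right (by norm_num) ((Nat.mod_lt _ Λ.W_pos).trans_le Λ.W_le)
  simp only [setS, Sm.wp, safe_add, safe_xor, safe_ld, safe_shl, safe_div, safe_mod, eval_add,
    eval_div, eval_mod, eval_xor, eval_getE h, eval_var, h.h6, h.h1, safe_var, he, hx, hs, h1,
    h1.trans h2, h3, true_and]
  convert hQ using 2
  · simp [setBit, bitWord, h.h6, h.h1, eval_getE h]
  · simp [cost_getE]; ring

/-- The parts of the memory that do not change once they have been built. `B` is the bit array
that says which vertices have a bit in the next plane. -/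
structure Stat (Λ : Lay w M) (B : ℕ → ℕ) (σ : St) : Prop extends Λ.Vars σ where
  tab : ∀ x < 2 ^ Λ.b, σ.mem x = popc x
  dir : ∀ c, c * Λ.b < Λ.N → σ.mem (Λ.DB + 2 * (c / Λ.g)) +
    σ.mem (Λ.DB + 2 * (c / Λ.g) + 1) / 2 ^ (c % Λ.g * Λ.q) % 2 ^ Λ.q =
      ∑ i ∈ Finset.range (c * Λ.b), B i
  bits : ∀ p < Λ.N, Λ.bt σ.mem p = B p
  planes : ∀ v < Λ.n, ∀ t ≤ Λ.l v, B (pos Λ.n Λ.l t v) = if t < Λ.l v then 1 else 0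

variable {B : ℕ → ℕ}

theorem Stat.congr {σ σ' : St} (h : Λ.Stat B σ) (hv : ∀ x < 8, σ'.v x = σ.v x)
    (hm : σ'.mem = σ.mem) : Λ.Stat B σ' :=
  ⟨h.toVars.congr hv, by rw [hm]; exact h.tab, by rw [hm]; exact h.dir, by rw [hm]; exact h.bits,
    h.planes⟩

theorem Stat.set {σ : St} (h : Λ.Stat B σ) {x a : ℕ} (hx : 8 ≤ x) : Λ.Stat B (σ.set x a) :=
  h.congr (fun y hy => by rw [St.set_v, if_neg (by omega)]) rfl

theorem Stat.emit {σ : St} (h : Λ.Stat B σ) (o : Option ℕ) : Λ.Stat B (σ.emit o) :=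
  h.congr (fun _ _ => rfl) rfl

theorem Stat.setBit {σ : St} (h : Λ.Stat B σ) {p x : ℕ} (hp : Λ.N ≤ p) (hx : x < 2) :
    Λ.Stat B (Λ.setBit σ p x) where
  toVars := h.toVars.setBit p x
  tab y hy := by
    have h1 := Λ.tab_le
    have h2 := Λ.DB_lt
    rw [mem_setBit _ _ _ (by omega), h.tab y hy]
  dir c hc := by
    have h2 : Λ.DB + 2 * (c / Λ.g) + 1 < Λ.BB := by
      have := Λ.dir_lt hc.le
      rwa [Nat.mul_div_cancel _ Λ.b_pos] at this
    rw [mem_setBit _ _ _ (by omega), mem_setBit _ _ _ (by omega), h.dir c hc]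
  bits y hy := by rw [bt_setBit _ hx, if_neg (by omega), h.bits y hy]
  planes := h.planes

theorem pos_lt_N {t v : ℕ} (hv : v < Λ.n) (ht : t ≤ Λ.l v) : pos Λ.n Λ.l t v < Λ.N := by
  rw [Λ.N_eq]; exact pos_lt hv ht

theorem Stat.bt_pos {σ : St} (h : Λ.Stat B σ) {t v : ℕ} (hv : v < Λ.n) (ht : t ≤ Λ.l v) :
    Λ.bt σ.mem (pos Λ.n Λ.l t v) = if t < Λ.l v then 1 else 0 := by
  rw [h.bits _ (pos_lt_N hv ht), h.planes v hv t ht]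

/-- The number of ones before a position, as the sum of an entry of the directory for the superblock,
one for the chunk, and one of the table of popcounts for a part of the chunk. -/
theorem Stat.rank {σ : St} (h : Λ.Stat B σ) {p : ℕ} (hp : p < Λ.N) :
    σ.mem (Λ.DB + 2 * (p / Λ.b / Λ.g)) +
      σ.mem (Λ.DB + 2 * (p / Λ.b / Λ.g) + 1) / 2 ^ (p / Λ.b % Λ.g * Λ.q) % 2 ^ Λ.q +
      σ.mem (σ.mem (Λ.BB + p / Λ.W) / 2 ^ (p % Λ.W - p % Λ.b) % 2 ^ (p % Λ.b)) =
    ∑ i ∈ Finset.range p, B i := by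
  have h1 : p / Λ.b * Λ.b ≤ p := Nat.div_mul_le_self _ _
  have h2 : p % Λ.b < Λ.b := Nat.mod_lt _ Λ.b_pos
  have h3 : ∀ k ≤ p, ∑ i ∈ Finset.range k, bit Λ.BB Λ.W σ.mem i = ∑ i ∈ Finset.range k, B i :=
    fun k hk => Finset.sum_congr rfl fun i hi => h.bits i (by
      rw [Finset.mem_range] at hi; omega)
  rw [h.dir _ (by omega), h.tab, ← h3 p le_rfl, bit_chunk Λ.b_pos Λ.r_pos Λ.W_eq σ.mem p, h3 _ h1]
  exact (Nat.mod_lt _ (by positivity)).trans_le (Nat.pow_le_pow_right (by norm_num) h2.le)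

theorem Stat.rank_le {σ : St} (h : Λ.Stat B σ) {p : ℕ} (hp : p < Λ.N) :
    ∑ i ∈ Finset.range p, B i ≤ p := by
  calc _ ≤ ∑ i ∈ Finset.range p, 1 := Finset.sum_le_sum fun i hi => by
        rw [Finset.mem_range] at hi
        rw [← h.bits i (by omega)]
        have := bit_lt Λ.BB Λ.W σ.mem i
        simp only [Lay.bt]; omega
    _ = p := by simp

/-- By `pos_next` and `Stat.rank`, the expression `nextE` gives the position in the next plane. -/
theorem Stat.eval_next {σ : St} (h : Λ.Stat B σ) {x t v : ℕ} (hv : v < Λ.n) (ht : t ≤ Λ.l v)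
    (hx : σ.v x = pos Λ.n Λ.l t v) :
    (nextE x).eval R w σ = pos Λ.n Λ.l (t + 1) v := by
  have h1 := h.rank (pos_lt_N hv ht)
  rw [← pos_next h.planes hv.le, ← h1]
  simp [nextE, h.h0, h.h1, h.h2, h.h3, h.h4, h.h5, h.h6, hx]

theorem Stat.safe_next {σ : St} (h : Λ.Stat B σ) {x p : ℕ} (hp : p < Λ.N) (hx : σ.v x = p) :
    (nextE x).safe R w M σ := by
  have h1 := h.rank hp
  have h2 := h.rank_le hp
  have h3 := Λ.N_le
  have h4 := Λ.NB_lt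
  have h5 := Λ.n_le
  have h6 := Λ.dir_lt hp.le
  have h7 := Λ.BB_lt
  have h8 := Λ.M_lt
  have h10 : Λ.BB + p / Λ.W < M := Λ.addr_lt (by omega)
  have h11 : p / Λ.b % Λ.g * Λ.q < 2 ^ w := by
    calc _ ≤ Λ.g * Λ.q := Nat.mul_le_mul_right _ (Nat.mod_lt _ Λ.g_pos).le
      _ ≤ w := Λ.gq_le
      _ < 2 ^ w := Nat.lt_two_pow_self
  have h12 : 2 ^ Λ.q < 2 ^ w := Nat.pow_lt_pow_right (by norm_num) Λ.q_lt
  have h13 : p % Λ.b < Λ.b := Nat.mod_lt _ Λ.b_pos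
  have h14 : 2 ^ (p % Λ.b) < 2 ^ w :=
    Nat.pow_lt_pow_right (by norm_num) (h13.trans Λ.b_lt)
  have h15 : p % Λ.b ≤ p % Λ.W := by
    have : p % Λ.W % Λ.b = p % Λ.b := Nat.mod_mod_of_dvd _ ⟨Λ.r, by rw [Λ.W_eq, mul_comm]⟩
    exact this ▸ Nat.mod_le _ _
  have h16 : σ.mem (Λ.BB + p / Λ.W) / 2 ^ (p % Λ.W - p % Λ.b) % 2 ^ (p % Λ.b) < M := by
    have h17 : 2 ^ (p % Λ.b) ≤ 2 ^ Λ.b := Nat.pow_le_pow_right (by norm_num) h13.le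
    have h18 := Λ.tab_le
    have h19 := Λ.DB_lt
    have := Nat.mod_lt (σ.mem (Λ.BB + p / Λ.W) / 2 ^ (p % Λ.W - p % Λ.b))
      (show 0 < 2 ^ (p % Λ.b) by positivity)
    omega
  have h19 := Λ.two_lt
  simp only [nextE, safe_add, safe_var, safe_ld, safe_mul, safe_num, safe_div, safe_shr, safe_mod,
    safe_shl, safe_sub, eval_add, eval_mul, eval_num, eval_div, eval_var, eval_mod, eval_shr,
    eval_shl, eval_sub, eval_ld, h.h0, h.h1, h.h2, h.h3, h.h4, h.h5, h.h6, hx, true_and, and_true,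
    h11, h15, h16, one_mul, h12, h14, h1]
  clear h11 h12 h13 h14 h15 h16
  generalize p / Λ.b / Λ.g = a at *
  generalize p / Λ.W = a' at *
  generalize σ.mem (Λ.DB + 2 * a + 1) / 2 ^ (p / Λ.b % Λ.g * Λ.q) % 2 ^ Λ.q = a'' at *
  omega

theorem cost_next (x : ℕ) : (nextE x).cost = 59 := rfl

end Lay

/-! ### Reading, writing and comparing fields -/

/-- Variable 14 becomes the field of the vertex in variable 8. -/
def readS : Sm :=
  .asg 12 (.var 8) ;; .asg 14 0 ;; .asg 15 1 ;;
  .wh .eq (getE (.var 12)) 1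
    (.asg 12 (nextE 12) ;; .asg 14 (.var 14 + getE (xN + .var 12) * .var 15) ;;
      .asg 15 (.var 15 + .var 15))

/-- The field of the vertex in variable 10 becomes the value of variable 11. -/
def writeS : Sm :=
  .asg 12 (.var 10) ;; .asg 13 (.var 11) ;;
  .wh .eq (getE (.var 12)) 1
    (.asg 12 (nextE 12) ;; setS (xN + .var 12) (.var 13 % 2) ;; .asg 13 (.var 13 / 2))

/-- Variable 16 becomes 1 if the field of the vertex in variable 10 equals variable 11,
and 0 otherwise. The comparison starts with the least significant bit and stops at the first
difference. -/
def matchS : Sm :=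
  .asg 12 (.var 10) ;; .asg 13 (.var 11) ;; .asg 16 1 ;; .asg 17 (getE (.var 12)) ;;
  .wh .eq (.var 17) 1
    (.asg 12 (nextE 12) ;;
      .ite .eq (getE (xN + .var 12)) (.var 13 % 2)
        (.asg 13 (.var 13 / 2) ;; .asg 17 (getE (.var 12)))
        (.asg 16 0 ;; .asg 17 0))

/-- The number of bits inspected when two numbers of `l` bits are compared from the least
significant bit on. -/
def agree : ℕ → ℕ → ℕ → ℕ
  | 0, _, _ => 0
  | l + 1, x, y => if x % 2 = y % 2 then 1 + agree l (x / 2) (y / 2) else 1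

/-- On average over all numbers of `l` bits, comparison with `y` inspects at most two bits. -/
theorem sum_agree (l y : ℕ) : ∑ x ∈ Finset.range (2 ^ l), agree l x y ≤ 2 * 2 ^ l := by
  induction l generalizing y with
  | zero => simp [agree]
  | succ l ih =>
    have h : ∀ (m : ℕ) (f : ℕ → ℕ), ∑ x ∈ Finset.range (2 * m), f x =
        ∑ x ∈ Finset.range m, (f (2 * x) + f (2 * x + 1)) := by
      intro m f
      induction m with
      | zero => simp
      | succ m ih =>
        rw [Nat.mul_succ, Finset.sum_range_succ, Finset.sum_range_succ, ih, Finset.sum_range_succ]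
        ring
    rw [pow_succ', h]
    -- of `2 x` and `2 x + 1`, one differs from `y` in the lowest bit
    calc _ ≤ ∑ x ∈ Finset.range (2 ^ l), (2 + agree l x (y / 2)) := by
          refine Finset.sum_le_sum fun x _ => ?_
          have e1 : (2 * x + 1) / 2 = x := by omega
          have e2 : 2 * x / 2 = x := by omega
          simp only [agree, e1, e2]
          rcases Nat.mod_two_eq_zero_or_one y with hy | hy <;> simp [hy]
          omega
      _ ≤ 2 * (2 * 2 ^ l) := by
          rw [Finset.sum_add_distrib]
          have := ih (y / 2)
          simp; omega

/-- Variables other than 12, …, 17 are equal. -/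
def Fr (σ σ' : St) : Prop := ∀ i, i < 12 ∨ 17 < i → σ'.v i = σ.v i

theorem Fr.refl (σ : St) : Fr σ σ := fun _ _ => rfl
theorem Fr.set {σ σ' : St} (h : Fr σ σ') {x a : ℕ} (h1 : 12 ≤ x) (h2 : x ≤ 17) :
    Fr σ (σ'.set x a) := fun i hi => by rw [St.set_v, if_neg (by omega), h i hi]

namespace Lay

variable {w M : ℕ} {Λ : Lay w M} {n : ℕ} {G : Digraph (Fin n)} {R : AdjArrays G} {B : ℕ → ℕ}

theorem Stat.fr {σ σ' : St} (h : Λ.Stat B σ) (hf : Fr σ σ') (hm : σ'.mem = σ.mem) :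
    Λ.Stat B σ' := h.congr (fun x hx => hf x (by omega)) hm

/-- The field of vertex `v` holds `x`. -/
def Field (Λ : Lay w M) (m : ℕ → ℕ) (v x : ℕ) : Prop :=
  ∀ t < Λ.l v, Λ.bt m (Λ.N + pos Λ.n Λ.l (t + 1) v) = x / 2 ^ t % 2

theorem field_lt {v t : ℕ} (hv : v < Λ.n) (ht : t ≤ Λ.l v) :
    Λ.N + pos Λ.n Λ.l t v < 2 * Λ.N := by
  have := pos_lt_N hv ht
  omega

theorem l_lt' {v t : ℕ} (hv : v < Λ.n) (ht : t ≤ Λ.l v) : 2 ^ (t + 1) < 2 ^ w :=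
  (Nat.pow_le_pow_right (by norm_num) (by omega)).trans_lt (Λ.l_lt v hv)

/-- Reading takes time proportional to the length of the field. -/
theorem readS_spec {σ : St} {t u x : ℕ} (h : Λ.Stat B σ) (hu : σ.v 8 = u) (hun : u < Λ.n)
    (hF : Λ.Field σ.mem u x) (hx : x < 2 ^ Λ.l u) :
    WP R w M readS σ t fun σ' t' => σ'.v 14 = x ∧ σ'.mem = σ.mem ∧ σ'.out = σ.out ∧ Fr σ σ' ∧
      t' ≤ t + 150 * (Λ.l u + 1) := by
  have hw0 : w ≠ 0 := Λ.w_pos.ne'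
  have hNB := Λ.NB_lt
  have hNN := Λ.N_le
  have h0 := pos_lt_N hun (Nat.zero_le _)
  let Inv : ℕ → St → ℕ → Prop := fun i σ' t' => ∃ s, i + s = Λ.l u ∧
    σ'.v 12 = pos Λ.n Λ.l s u ∧ σ'.v 14 = x % 2 ^ s ∧ σ'.v 15 = 2 ^ s ∧ σ'.mem = σ.mem ∧
    σ'.out = σ.out ∧ Fr σ σ' ∧ t' ≤ t + 10 + 130 * s
  apply WP.of_wp
  refine wp_asg_seq trivial hu (wp_asg_seq ?_ rfl (wp_asg_seq ?_ rfl ?_))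
  · simp
  · simp [hw0]
  refine WP.wh_count Inv ?_ ?_ ?_ (Λ.l u) _ _ ?_
  · rintro i σ' t' ⟨s, hs, h12, h14, h15, hm, ho, hf, ht⟩
    have hst := h.fr hf hm
    have hp := pos_lt_N hun (show s ≤ Λ.l u by omega)
    refine ⟨safe_getE hst.toVars trivial ?_, ?_, ?_⟩
    · rw [eval_var, h12]; omega
    · simp [hw0]
    · rw [eval_getE hst.toVars, eval_var, h12, hst.bt_pos hun (by omega)]
      simp only [Cmp.holds, eval_num]
      split <;> simp <;> omega
  · rintro i σ' t' ⟨s, hs, h12, h14, h15, hm, ho, hf, ht⟩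
    have hst := h.fr hf hm
    have hp := pos_lt_N hun (show s ≤ Λ.l u by omega)
    have hp' := pos_lt_N hun (show s + 1 ≤ Λ.l u by omega)
    have hv := (hst.set (x := 12) (a := pos Λ.n Λ.l (s + 1) u) (by norm_num)).toVars
    have hbit : Λ.bt σ.mem (Λ.N + pos Λ.n Λ.l (s + 1) u) = x / 2 ^ s % 2 := hF s (by omega)
    have hlt := l_lt' hun (show s + 1 ≤ Λ.l u by omega)
    have hx1 : x % 2 ^ s + x / 2 ^ s % 2 * 2 ^ s = x % 2 ^ (s + 1) := by
      rw [Nat.mod_pow_succ]; ring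
    have hx2 : x % 2 ^ (s + 1) < 2 ^ (s + 1) := Nat.mod_lt _ (by positivity)
    have e1 : (2 : ℕ) ^ (s + 1) = 2 ^ s + 2 ^ s := by ring
    have e2 : (2 : ℕ) ^ (s + 1 + 1) = 2 * 2 ^ (s + 1) := by ring
    have h7 : σ'.v 7 = Λ.N := hst.h7
    have hN1 : Λ.N + pos Λ.n Λ.l (s + 1) u < 2 ^ w := by omega
    have hN2 : Λ.N + pos Λ.n Λ.l (s + 1) u < Λ.NB := by omega
    have hN3 : x / 2 ^ s % 2 * 2 ^ s < 2 ^ w := by omega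
    have hN4 : x % 2 ^ (s + 1) < 2 ^ w := by omega
    have hN5 : 2 ^ s + 2 ^ s < 2 ^ w := by omega
    apply WP.of_wp
    refine wp_asg_seq (hst.safe_next hp h12) (hst.eval_next hun (by omega) h12)
      (wp_asg_seq (a := x % 2 ^ (s + 1)) ?_ ?_ (wp_asg (a := 2 ^ (s + 1)) ?_ ?_ ?_))
    · simp [safe_getE hv, eval_getE hv, h7, hm, hbit, h14, h15, hx1, hN1, hN2, hN3, hN4]
    · simp [eval_getE hv, h7, hm, hbit, h14, h15, hx1]
    · simp [h15, hN5]
    · simp [h15, e1]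
    · refine ⟨s + 1, by omega, by simp, by simp, by simp, hm, ho, ?_, ?_⟩
      · exact ((hf.set (by norm_num) (by norm_num)).set (by norm_num) (by norm_num)).set
          (by norm_num) (by norm_num)
      · simp [cost_next, cost_getE]; omega
  · rintro σ' t' ⟨s, hs, h12, h14, h15, hm, ho, hf, ht⟩
    have hs' : s = Λ.l u := by omega
    subst hs'
    refine ⟨by rw [h14, Nat.mod_eq_of_lt hx], hm, ho, hf, ?_⟩
    simp [cost_getE]; omega
  · refine ⟨0, by simp, by simp [pos_zero], by simp [Nat.mod_one], by simp, rfl, rfl, ?_, ?_⟩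
    · exact ((Fr.refl σ).set (by norm_num) (by norm_num)).set (by norm_num) (by norm_num) |>.set
        (by norm_num) (by norm_num)
    · simp

/-- Writing takes time proportional to the length of the field and changes no other bit. -/
theorem writeS_spec {σ : St} {t v x : ℕ} (h : Λ.Stat B σ) (hv : σ.v 10 = v) (hx : σ.v 11 = x)
    (hvn : v < Λ.n) :
    WP R w M writeS σ t fun σ' t' => Λ.Stat B σ' ∧ Λ.Field σ'.mem v x ∧
      (∀ p, (∀ s < Λ.l v, p ≠ Λ.N + pos Λ.n Λ.l (s + 1) v) → Λ.bt σ'.mem p = Λ.bt σ.mem p) ∧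
      σ'.out = σ.out ∧ Fr σ σ' ∧ t' ≤ t + 150 * (Λ.l v + 1) := by
  have hw0 : w ≠ 0 := Λ.w_pos.ne'
  have hw2 := Λ.two_lt
  have hNB := Λ.NB_lt
  have hNN := Λ.N_le
  have h0 := pos_lt_N hvn (Nat.zero_le _)
  let Inv : ℕ → St → ℕ → Prop := fun i σ' t' => ∃ s, i + s = Λ.l v ∧
    σ'.v 12 = pos Λ.n Λ.l s v ∧ σ'.v 13 = x / 2 ^ s ∧ Λ.Stat B σ' ∧
    (∀ k < s, Λ.bt σ'.mem (Λ.N + pos Λ.n Λ.l (k + 1) v) = x / 2 ^ k % 2) ∧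
    (∀ p, (∀ k < Λ.l v, p ≠ Λ.N + pos Λ.n Λ.l (k + 1) v) → Λ.bt σ'.mem p = Λ.bt σ.mem p) ∧
    σ'.out = σ.out ∧ Fr σ σ' ∧ t' ≤ t + 10 + 140 * s
  apply WP.of_wp
  refine wp_asg_seq trivial hv (wp_asg_seq trivial rfl ?_)
  refine WP.wh_count Inv ?_ ?_ ?_ (Λ.l v) _ _ ?_
  · rintro i σ' t' ⟨s, hs, h12, h13, hst, hk, hp, ho, hf, ht⟩
    have hp := pos_lt_N hvn (show s ≤ Λ.l v by omega)
    refine ⟨safe_getE hst.toVars trivial ?_, ?_, ?_⟩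
    · rw [eval_var, h12]; omega
    · simp [hw0]
    · rw [eval_getE hst.toVars, eval_var, h12, hst.bt_pos hvn (by omega)]
      simp only [Cmp.holds, eval_num]
      split <;> simp <;> omega
  · rintro i σ' t' ⟨s, hs, h12, h13, hst, hk, hpp, ho, hf, ht⟩
    have hp := pos_lt_N hvn (show s ≤ Λ.l v by omega)
    have hp' := pos_lt_N hvn (show s + 1 ≤ Λ.l v by omega)
    have hst' := hst.set (x := 12) (a := pos Λ.n Λ.l (s + 1) v) (by norm_num)
    have h7 : σ'.v 7 = Λ.N := hst.h7
    have hb2 : x / 2 ^ s % 2 < 2 := Nat.mod_lt _ (by norm_num)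
    apply WP.of_wp
    refine wp_asg_seq (hst.safe_next hp h12) (hst.eval_next hvn (by omega) h12) (wp_seq
      (wp_setS hst'.toVars (p := Λ.N + pos Λ.n Λ.l (s + 1) v) (y := x / 2 ^ s % 2) ?_ ?_ ?_ ?_ ?_
        hb2 (wp_asg (a := x / 2 ^ (s + 1)) ?_ ?_ ?_)))
    · simp [h7]; omega
    · simp [hw2]
    · simp [h7]
    · simp [h13]
    · omega
    · simp [hw2]
    · simp [h13, Nat.div_div_eq_div_mul, pow_succ]
    · refine ⟨s + 1, by omega, by simp, by simp,
        (hst'.setBit (Nat.le_add_right _ _) hb2).set (by norm_num), fun k hk' => ?_, fun p hp => ?_,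
        ho, ?_, ?_⟩
      · rw [St.set_mem, bt_setBit _ hb2]
        split
        · rename_i he
          have := (pos_inj hvn (show k + 1 ≤ Λ.l v by omega) hvn
            (show s + 1 ≤ Λ.l v by omega) (by omega)).1
          obtain rfl : k = s := by omega
          rfl
        · rename_i he
          refine hk k (lt_of_le_of_ne (by omega) ?_)
          rintro rfl
          exact he rfl
      · rw [St.set_mem, bt_setBit _ hb2, if_neg (hp s (by omega))]
        exact hpp p hp
      · refine Fr.set ?_ (by norm_num) (by norm_num)
        exact hf.set (by norm_num) (by norm_num)
      · simp [cost_next, cost_getE]; omega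
  · rintro σ' t' ⟨s, hs, h12, h13, hst, hk, hpp, ho, hf, ht⟩
    obtain rfl : s = Λ.l v := by omega
    refine ⟨hst, hk, hpp, ho, hf, ?_⟩
    simp [cost_getE]; omega
  · refine ⟨0, by simp, by simp [pos_zero], by simp [hx], (h.set (by norm_num)).set (by norm_num),
      by simp, fun _ _ => rfl, rfl, ?_, ?_⟩
    · exact ((Fr.refl σ).set (by norm_num) (by norm_num)).set (by norm_num) (by norm_num)
    · simp

/-- Comparison takes time proportional to the number of bits inspected. -/
theorem matchS_spec {σ : St} {t v x y : ℕ} (h : Λ.Stat B σ) (hv : σ.v 10 = v) (hx : σ.v 11 = x)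
    (hvn : v < Λ.n) (hF : Λ.Field σ.mem v y) (hxl : x < 2 ^ Λ.l v) (hyl : y < 2 ^ Λ.l v) :
    WP R w M matchS σ t fun σ' t' => σ'.v 16 = (if x = y then 1 else 0) ∧ σ'.mem = σ.mem ∧
      σ'.out = σ.out ∧ Fr σ σ' ∧ t' ≤ t + 130 * (agree (Λ.l v) x y + 1) := by
  have hw0 : w ≠ 0 := Λ.w_pos.ne'
  have hw2 := Λ.two_lt
  have hNB := Λ.NB_lt
  have hNN := Λ.N_le
  have h0 := pos_lt_N hvn (Nat.zero_le _)
  have hloop : ∀ (i s : ℕ) (σ' : St) (t₁ X : ℕ), i + s = Λ.l v → X < 2 ^ i → y / 2 ^ s < 2 ^ i →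
      σ'.v 12 = pos Λ.n Λ.l s v → σ'.v 13 = X → σ'.v 16 = 1 → σ'.mem = σ.mem →
      σ'.v 17 = Λ.bt σ.mem (pos Λ.n Λ.l s v) → σ'.out = σ.out → Fr σ σ' →
      WP R w M (.wh .eq (.var 17) 1 (.asg 12 (nextE 12) ;;
        .ite .eq (getE (xN + .var 12)) (.var 13 % 2)
        (.asg 13 (.var 13 / 2) ;; .asg 17 (getE (.var 12)))
        (.asg 16 0 ;; .asg 17 0))) σ' t₁ fun σ' t' => σ'.v 16 = (if X = y / 2 ^ s then 1 else 0) ∧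
          σ'.mem = σ.mem ∧ σ'.out = σ.out ∧ Fr σ σ' ∧
          t' ≤ t₁ + 5 + 120 * agree i X (y / 2 ^ s) := by
    intro i
    induction i with
    | zero =>
      intro s σ' t₁ X hs hX hy h12 h13 h16 hm h17 ho hf
      rw [h.bt_pos hvn (by omega), if_neg (by omega)] at h17
      refine WP.wh_false trivial (by simp [hw0]) ?_ ⟨?_, hm, ho, hf, ?_⟩
      · simp [h17]
      · rw [pow_zero, Nat.lt_one_iff] at hX hy
        rw [h16, hX, hy, if_pos rfl]
      · simp [agree]
    | succ i ih =>
      intro s σ' t₁ X hs hX hy h12 h13 h16 hm h17 ho hf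
      have hst := h.fr hf hm
      have hp := pos_lt_N hvn (show s ≤ Λ.l v by omega)
      have hp' := pos_lt_N hvn (show s + 1 ≤ Λ.l v by omega)
      have hst' := hst.set (x := 12) (a := pos Λ.n Λ.l (s + 1) v) (by norm_num)
      have hst'' := hst'.set (x := 13) (a := X / 2) (by norm_num)
      have h7 : σ'.v 7 = Λ.N := hst.h7
      have hN1 : Λ.N + pos Λ.n Λ.l (s + 1) v < 2 ^ w := by omega
      have hN2 : Λ.N + pos Λ.n Λ.l (s + 1) v < Λ.NB := by omega
      have hN3 : pos Λ.n Λ.l (s + 1) v < Λ.NB := by omega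
      have hdd : y / 2 ^ s / 2 = y / 2 ^ (s + 1) := by
        rw [Nat.div_div_eq_div_mul, pow_succ]
      rw [h.bt_pos hvn (by omega), if_pos (by omega)] at h17
      refine WP.wh_true trivial (by simp [hw0]) (by simp [h17]) (WP.of_wp ?_)
      refine wp_asg_seq (hst.safe_next hp h12) (hst.eval_next hvn (by omega) h12)
        (wp_ite (x := y / 2 ^ s % 2) (y := X % 2) ?_ ?_ ?_ ?_ (fun hc => ?_) (fun hc => ?_))
      · simp [safe_getE hst'.toVars, h7, hN1, hN2]
      · simp [hw2]
      · simp [eval_getE hst'.toVars, h7, hm, hF s (by omega)]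
      · simp [h13]
      · simp only [Cmp.holds] at hc
        refine wp_asg_seq (a := X / 2) ?_ ?_ (wp_asg (a := Λ.bt σ.mem (pos Λ.n Λ.l (s + 1) v))
          ?_ ?_ ?_)
        · simp [hw2]
        · simp [h13]
        · simp [safe_getE hst''.toVars, hN3]
        · simp [eval_getE hst''.toVars, hm]
        · have hi := Nat.pow_succ 2 i
          refine WP.mono (ih (s + 1) _ _ (X / 2) (by omega) (by omega) (by rw [← hdd]; omega)
            ?_ ?_ ?_ ?_ ?_ ?_ ?_) ?_
          · simp
          · simp
          · simp [h16]
          · exact hm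
          · simp
          · exact ho
          · exact ((hf.set (by norm_num) (by norm_num)).set (by norm_num) (by norm_num)).set
              (by norm_num) (by norm_num)
          · rintro σ₂ t₂ ⟨a1, a2, a3, a4, a5⟩
            refine ⟨?_, a2, a3, a4, ?_⟩
            · rw [a1, ← hdd]; congr 1; rw [eq_iff_iff]; omega
            · rw [agree, if_pos hc.symm, hdd]
              refine a5.trans ?_
              simp [cost_next, cost_getE]; omega
      · simp only [Cmp.holds] at hc
        refine wp_asg_seq (a := 0) ?_ ?_ (wp_asg (a := 0) ?_ ?_ ?_)
        · simp
        · simp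
        · simp
        · simp
        · refine WP.wh_false trivial (by simp [hw0]) (by simp) ⟨?_, hm, ho, ?_, ?_⟩
          · simp only [St.set_v]; simp; intro he; exact hc (by rw [he])
          · exact ((hf.set (by norm_num) (by norm_num)).set (by norm_num) (by norm_num)).set
              (by norm_num) (by norm_num)
          · rw [agree, if_neg (Ne.symm hc)]
            simp [cost_next, cost_getE]
  apply WP.of_wp
  have hst1 : Λ.Stat B (((σ.set 12 v).set 13 x).set 16 1) :=
    ((h.set (by norm_num)).set (by norm_num)).set (by norm_num)
  refine wp_asg_seq trivial hv (wp_asg_seq (a := x) trivial ?_ (wp_asg_seq (a := 1) ?_ ?_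
    (wp_asg_seq (a := Λ.bt σ.mem v) ?_ ?_ ?_)))
  · simp [hx]
  · simp [hw0]
  · simp
  · rw [pos_zero] at h0
    exact safe_getE hst1.toVars trivial (by simp; omega)
  · simp [eval_getE hst1.toVars]
  · refine WP.mono (hloop (Λ.l v) 0 _ _ x (by simp) hxl (by simpa using hyl)
      ?_ ?_ ?_ ?_ ?_ ?_ ?_) ?_
    · simp [pos_zero]
    · simp
    · simp
    · rfl
    · simp [pos_zero]
    · rfl
    · exact ((((Fr.refl σ).set (by norm_num) (by norm_num)).set (by norm_num) (by norm_num)).set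
        (by norm_num) (by norm_num)).set (by norm_num) (by norm_num)
    · rintro σ₂ t₂ ⟨a1, a2, a3, a4, a5⟩
      refine ⟨by simpa using a1, a2, a3, a4, a5.trans ?_⟩
      simp [cost_getE]; omega

end Lay

/-! ### The search graph -/

section SearchGraph

variable {n : ℕ} {G : Digraph (Fin n)} (R : AdjArrays G)

/-- The neighbors in the graph extended by a vertex `n` from which there is an edge to every
vertex. -/
def nb (u j : ℕ) : ℕ := if u = n then j else oh R u j

/-- The degrees in the extended graph. -/
def dg (u : ℕ) : ℕ := if u = n then n else od R u

/-- The number stored in the field of a vertex whose tree edge is the `j`th edge of `u`: zero for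
a root, otherwise one more than the position of the tree edge in the array of inneighbors. -/
def code (u j : ℕ) : ℕ := if u = n then 0 else om R u j + 1

theorem nb_lt {u j : ℕ} (hu : u ≤ n) (hj : j < dg R u) : nb R u j < n := by
  unfold nb dg at *
  split at hj
  · rename_i h; simpa [h] using hj
  · rename_i h; simpa [h] using (out_spec R (by omega) hj).1

theorem code_le {u j : ℕ} (hu : u ≤ n) (hj : j < dg R u) :
    code R u j ≤ idg R (nb R u j) := by
  unfold nb dg code at *
  split at hj
  · rename_i h; simp [h]
  · rename_i h
    simpa [h, Nat.add_one_le_iff] using (out_spec R (by omega) hj).2.1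

/-- The code of an edge fits into the field of its head. -/
theorem code_lt {u j : ℕ} (hu : u ≤ n) (hj : j < dg R u) :
    code R u j < 2 ^ Nat.size (idg R (nb R u j)) :=
  (code_le R hu hj).trans_lt (Nat.lt_size_self _)

theorem code_eq_zero {u j : ℕ} (h : code R u j = 0) : u = n ∧ nb R u j = j := by
  unfold code at h
  split at h
  · rename_i h'; exact ⟨h', by simp [nb, h']⟩
  · omega

/-- The code of an edge and its head determine the edge, by the cross links. -/
theorem code_spec {u j : ℕ} (hu : u ≤ n) (hj : j < dg R u) (h : code R u j ≠ 0) :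
    ih R (nb R u j) (code R u j - 1) = u ∧ im R (nb R u j) (code R u j - 1) = j := by
  by_cases hn : u = n
  · exact absurd (if_pos hn) h
  · rw [dg, if_neg hn] at hj
    simpa [nb, code, hn] using (out_spec R (by omega) hj).2.2

/-- Edges with the same head have different codes. -/
theorem code_inj {u j u' j' : ℕ} (hu : u ≤ n) (hj : j < dg R u) (hu' : u' ≤ n)
    (hj' : j' < dg R u') (h : nb R u j = nb R u' j') (hc : code R u j = code R u' j') :
    u = u' ∧ j = j' := by
  by_cases h0 : code R u j = 0
  · obtain ⟨a, b⟩ := code_eq_zero R h0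
    obtain ⟨a', b'⟩ := code_eq_zero R (hc ▸ h0)
    omega
  · obtain ⟨a, b⟩ := code_spec R hu hj h0
    obtain ⟨a', b'⟩ := code_spec R hu' hj' (hc ▸ h0)
    rw [h, hc] at a b
    exact ⟨a.symm.trans a', b.symm.trans b'⟩

theorem nb_closed : ∀ a ∈ Finset.range (n + 1), ∀ k < dg R a, nb R a k ∈ Finset.range (n + 1) := by
  intro a ha k hk
  rw [Finset.mem_range] at *
  have := nb_lt R (by omega) hk
  omega

end SearchGraph

/-- Variables 10 and 11 become the head of the edge with number `j` (variable 9) of `u`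
(variable 8) and its code. -/
def edgeS : Sm :=
  .ite .eq (.var 8) xn (.asg 10 (.var 9) ;; .asg 11 0)
    (.asg 10 (.acc .outhead (.var 8) (.var 9)) ;; .asg 11 (.acc .outmate (.var 8) (.var 9) + 1))

/-- Variables 8 and 9 become the tree edge of the vertex in variable 8. -/
def parentS : Sm :=
  .blk readS ;;
  .ite .eq (.var 14) 0 (.asg 9 (.var 8) ;; .asg 8 xn)
    (.asg 9 (.acc .inmate (.var 8) (.var 14 - 1)) ;; .asg 8 (.acc .inhead (.var 8) (.var 14 - 1)))

/-- One step of the depth-first search. -/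
def forwardBody : Sm :=
  .ite .eq (.var 8) xn (.asg 19 xn) (.asg 19 (.acc .outdeg (.var 8) 0)) ;;
  .ite .lt (.var 9) (.var 19)
    (edgeS ;;
      .ite .eq (getE (xN + .var 10)) 1 (.asg 9 (.var 9 + 1))
        (setS (xN + .var 10) 1 ;; .blk writeS ;; .asg 8 (.var 10) ;; .asg 9 0))
    (.ite .eq (.var 8) xn (.asg 26 0) (.blk parentS ;; .asg 9 (.var 9 + 1)))

/-- The depth-first search. -/
def forwardLoop : Sm := .wh .eq (.var 26) 1 forwardBody

/-- The number of bits for an outgoing edge of `v` on the stack of the reverse search. If `v` has an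
ingoing edge, then the position of an outgoing edge is at most `d - 2`, where `d` is the total
degree. -/
def width {n : ℕ} {G : Digraph (Fin n)} (R : AdjArrays G) (v : ℕ) : ℕ :=
  Nat.size (idg R v + od R v - 2)

namespace Lay

variable {w M : ℕ} {Λ : Lay w M} {n : ℕ} {G : Digraph (Fin n)} {R : AdjArrays G} {B : ℕ → ℕ}

/-- The layout is one for the given graph. -/
structure For (Λ : Lay w M) (R : AdjArrays G) : Prop where
  n_eq : Λ.n = n
  n_pos : 0 < n
  l_eq : ∀ v < n, Λ.l v = Nat.size (idg R v)
  space : 2 * Λ.N + ∑ v ∈ Finset.range n, width R v ≤ Λ.NB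

theorem For.n_le (h : Λ.For R) : n ≤ Λ.N := h.n_eq ▸ Λ.n_le

theorem For.two_n_lt (h : Λ.For R) : 2 * n < 2 ^ w := by
  have h1 := h.n_le
  have h2 := Λ.N_le
  have h3 := Λ.NB_lt
  omega

/-- Variables other than 8, 9 and 12, …, 17 are equal. -/
def Fr' (σ σ' : St) : Prop := ∀ i, i < 8 ∨ 9 < i ∧ i < 12 ∨ 17 < i → σ'.v i = σ.v i

theorem Stat.fr' {σ σ' : St} (h : Λ.Stat B σ) (hf : Fr' σ σ') (hm : σ'.mem = σ.mem) :
    Λ.Stat B σ' := h.congr (fun x hx => hf x (by omega)) hm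

theorem wp_edge (hΛ : Λ.For R) {σ : St} {t u j : ℕ} {Q : St → ℕ → Prop} (h : Λ.Vars σ)
    (hu : σ.v 8 = u) (hj : σ.v 9 = j)
    (hQ : ∀ t', t' ≤ t + 20 → Q ((σ.set 10 (nb R u j)).set 11 (code R u j)) t') :
    edgeS.wp R w M σ t Q := by
  have hw0 : w ≠ 0 := Λ.w_pos.ne'
  have hlt := hΛ.two_n_lt
  have hpos := hΛ.n_pos
  have h0 : σ.v 0 = n := h.h0.trans hΛ.n_eq
  have hom : om R u j ≤ n := value_le R _ _ _
  refine wp_ite trivial trivial hu h0 (fun hc => ?_) (fun hc => ?_)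
  · simp only [Cmp.holds] at hc
    refine wp_asg_seq (a := nb R u j) trivial (by simp [hj, nb, hc]) (wp_asg (a := code R u j) ?_ ?_
      (hQ _ ?_))
    · simp
    · simp [code, hc]
    · simp
  · simp only [Cmp.holds] at hc
    refine wp_asg_seq (a := nb R u j) ?_ ?_ (wp_asg (a := code R u j) ?_ ?_ (hQ _ ?_))
    · simp
    · simp [nb, hc, hu, hj, value_outhead]
    · simp [hu, hj, value_outmate, hw0]; omega
    · simp [code, hc, hu, hj, value_outmate]
    · simp

/-- The tree edge of a vertex is recovered from the code in its field. -/
theorem parentS_spec (hΛ : Λ.For R) {σ : St} {t v u j : ℕ} (h : Λ.Stat B σ) (hv : σ.v 8 = v)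
    (hu : u ≤ n) (hj : j < dg R u) (hnb : nb R u j = v) (hF : Λ.Field σ.mem v (code R u j)) :
    WP R w M parentS σ t fun σ' t' => σ'.v 8 = u ∧ σ'.v 9 = j ∧ σ'.mem = σ.mem ∧
      σ'.out = σ.out ∧ Fr' σ σ' ∧ t' ≤ t + 180 * (Λ.l v + 1) := by
  have hw0 : w ≠ 0 := Λ.w_pos.ne'
  have hvn : v < n := hnb ▸ nb_lt R hu hj
  have hx : code R u j < 2 ^ Λ.l v := by
    rw [hΛ.l_eq v hvn, ← hnb]; exact code_lt R hu hj
  apply WP.of_wp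
  refine wp_seq ((readS_spec h hv (hΛ.n_eq ▸ hvn) hF hx).mono ?_)
  rintro σ' t' ⟨h14, hm, ho, hf, ht⟩
  have hst := h.fr hf hm
  have h8 : σ'.v 8 = v := (hf 8 (by omega)).trans hv
  have h0 : σ'.v 0 = n := hst.h0.trans hΛ.n_eq
  refine wp_ite trivial ?_ h14 rfl (fun hc => ?_) (fun hc => ?_)
  · simp
  · simp only [Cmp.holds, eval_num] at hc
    obtain ⟨a, b⟩ := code_eq_zero R hc
    refine wp_asg_seq (a := v) trivial h8 (wp_asg (a := n) trivial (by simpa using h0)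
      ⟨by simp [a], by simp; omega, hm, ho, ?_, ?_⟩)
    · intro i hi
      rw [St.set_v, if_neg (by omega), St.set_v, if_neg (by omega), hf i (by omega)]
    · simp; omega
  · simp only [Cmp.holds, eval_num] at hc
    obtain ⟨a, b⟩ := code_spec R hu hj hc
    rw [hnb] at a b
    refine wp_asg_seq (a := j) ?_ ?_ (wp_asg (a := u) ?_ ?_ ⟨by simp, by simp, hm, ho, ?_, ?_⟩)
    · simp [hw0, h14]; omega
    · simp [h8, h14, value_inmate, b]
    · simp [hw0, h14]; omega
    · simp [h8, h14, value_inhead, a]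
    · intro i hi
      rw [St.set_v, if_neg (by omega), St.set_v, if_neg (by omega), hf i (by omega)]
    · simp; omega

/-- The state of the depth-first search. Variable 8 is the current vertex, variable 9 the number of
the edge to be inspected, and variable 26 says whether the search goes on. Plane 0 marks the visited
vertices. -/
structure Fwd (Λ : Lay w M) (R : AdjArrays G) (B : ℕ → ℕ) (vis : Finset ℕ) (pe : ℕ → ℕ × ℕ)
    (u j : ℕ) (σ : St) : Prop extends Λ.Stat B σ where
  vu : σ.v 8 = u
  vj : σ.v 9 = j
  run : σ.v 26 = 1
  root : n ∈ vis
  u_le : u ≤ n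
  visited : ∀ x < n, Λ.bt σ.mem (Λ.N + x) = if x ∈ vis then 1 else 0
  field : ∀ x ∈ vis, x < n → Λ.Field σ.mem x (code R (pe x).1 (pe x).2)

/-- The time that the depth-first search spends on a vertex is a constant times this number. -/
def fcost (Λ : Lay w M) (R : AdjArrays G) (v : ℕ) : ℕ := dg R v + Λ.l v + 1

/-- One step of the search with an edge left to inspect, which leads to a vertex visited before or to
a new one. -/
theorem forward_step (hΛ : Λ.For R) {vis : Finset ℕ} {pe : ℕ → ℕ × ℕ} {u j : ℕ} {σ : St} {t : ℕ}
    {Q : St → ℕ → Prop} (h : Λ.Fwd R B vis pe u j σ) (hj : j < dg R u)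
    (hskip : nb R u j ∈ vis → ∀ σ' t', Λ.Fwd R B vis pe u (j + 1) σ' → σ'.out = σ.out →
      t' ≤ t + 300 → WP R w M forwardLoop σ' t' Q)
    (hvisit : nb R u j ∉ vis → ∀ σ' t', Λ.Fwd R B (insert (nb R u j) vis)
      (Function.update pe (nb R u j) (u, j)) (nb R u j) 0 σ' → σ'.out = σ.out →
      t' ≤ t + 300 * (Λ.l (nb R u j) + 1) → WP R w M forwardLoop σ' t' Q) :
    WP R w M forwardLoop σ t Q := by
  have hw0 : w ≠ 0 := Λ.w_pos.ne'
  have hlt := hΛ.two_n_lt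
  have hpos := hΛ.n_pos
  have hn := hΛ.n_eq
  have hnN := hΛ.n_le
  have hNN := Λ.N_le
  have hNB := Λ.NB_lt
  have h0 : σ.v 0 = n := h.h0.trans hΛ.n_eq
  have h7 : σ.v 7 = Λ.N := h.h7
  have hv := nb_lt R h.u_le hj
  have hc := code_lt R h.u_le hj
  have hdg : dg R u ≤ n := by
    unfold dg; split
    · exact le_rfl
    · exact od_le R u
  have key : ∀ t', t' ≤ t + 15 → (Sm.ite .lt (.var 9) (.var 19)
    (edgeS ;;
      .ite .eq (getE (xN + .var 10)) 1 (.asg 9 (.var 9 + 1))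
        (setS (xN + .var 10) 1 ;; .blk writeS ;; .asg 8 (.var 10) ;; .asg 9 0))
    (.ite .eq (.var 8) xn (.asg 26 0) (.blk parentS ;; .asg 9 (.var 9 + 1)))).wp R w M
      (σ.set 19 (dg R u)) t' (fun σ' t' => WP R w M forwardLoop σ' t' Q) := by
    intro t' ht'
    refine wp_ite (x := j) (y := dg R u) trivial trivial (by simp [h.vj]) (by simp) (fun _ => ?_)
      (fun hc => absurd hj hc)
    refine wp_seq (wp_edge hΛ (u := u) (j := j) (h.toVars.set (by norm_num)) (by simp [h.vu])
      (by simp [h.vj]) fun t₁ ht₁ => ?_)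
    have hst : Λ.Stat B (((σ.set 19 (dg R u)).set 10 (nb R u j)).set 11 (code R u j)) :=
      ((h.toStat.set (by norm_num)).set (by norm_num)).set (by norm_num)
    refine wp_ite (x := if nb R u j ∈ vis then 1 else 0) (y := 1) ?_ ?_ ?_ rfl
      (fun hc => ?_) (fun hc => ?_)
    · refine safe_getE hst.toVars ?_ ?_
      · simp [h7]; omega
      · simp [h7]; omega
    · simp [hw0]
    · rw [eval_getE hst.toVars, ← h.visited _ hv]; simp [h7]
    · have hmem : nb R u j ∈ vis := by
        by_contra hcon; simp [hcon] at hc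
      refine wp_asg (a := j + 1) ?_ ?_ (hskip hmem _ _ ?_ rfl ?_)
      · simp [h.vj, hw0]; omega
      · simp [h.vj]
      · exact ⟨hst.set (by norm_num), by simp [h.vu], by simp, by simp [h.run], h.root, h.u_le,
          h.visited, h.field⟩
      · simp [cost_getE] at ht₁ ⊢; omega
    · have hmem : nb R u j ∉ vis := by
        intro hcon; simp [hcon] at hc
      refine wp_seq (wp_setS hst.toVars (p := Λ.N + nb R u j) (y := 1) ?_ ?_ ?_ ?_ ?_ ?_ ?_)
      · simp [h7]; omega
      · simp [hw0]
      · simp [h7]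
      · simp
      · omega
      · omega
      · refine wp_seq ((writeS_spec (v := nb R u j) (x := code R u j)
          (hst.setBit (Nat.le_add_right _ _) one_lt_two) ?_ ?_ (by omega)).mono ?_)
        · simp
        · simp
        · rintro σ' t₂ ⟨b1, b2, b3, b4, b5, b6⟩
          have h10 : σ'.v 10 = nb R u j := by rw [b5 10 (by omega)]; simp
          have hpw : ∀ y < n, ∀ v < n, ∀ s < Λ.l v, Λ.N + y ≠ Λ.N + pos Λ.n Λ.l (s + 1) v := by
            intro y hy v hv s hs he
            have h1 := pos_inj (n := Λ.n) (l := Λ.l) (t := 0) (v := y) (t' := s + 1) (v' := v)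
              (by omega) (Nat.zero_le _) (by omega) hs (by rw [pos_zero]; omega)
            omega
          refine wp_asg_seq (a := nb R u j) trivial h10 (wp_asg (a := 0) ?_ ?_
            (hvisit hmem _ _ ?_ b4 ?_))
          · simp
          · simp
          · refine ⟨(b1.set (by norm_num)).set (by norm_num), by simp, by simp, ?_, ?_, hv.le,
              fun x hx => ?_, fun x hx hxn => ?_⟩
            · have := b5 26 (by omega)
              simp [this, h.run]
            · exact Finset.mem_insert_of_mem h.root
            · simp only [St.set_mem]
              rw [b3 _ (hpw x hx _ hv), bt_setBit _ one_lt_two]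
              simp only [St.set_mem, add_right_inj, Finset.mem_insert]
              by_cases hxv : x = nb R u j
              · simp [hxv]
              · simp [hxv, h.visited x hx]
            · simp only [St.set_mem]
              by_cases hxv : x = nb R u j
              · subst hxv; simpa using b2
              · rw [Function.update_of_ne hxv]
                intro s hs
                rw [b3, bt_setBit _ one_lt_two, if_neg]
                · exact h.field x ((Finset.mem_insert.1 hx).resolve_left hxv) hxn s hs
                · exact (hpw _ hv x hxn s hs).symm
                · intro s' hs' he
                  exact hxv (pos_inj (n := Λ.n) (l := Λ.l) (t := s + 1) (t' := s' + 1) (by omega) hs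
                    (by omega) hs' (by omega)).2
          · simp [cost_getE] at b6 ht₁ ⊢; omega
  refine WP.wh_true trivial (by simp [hw0]) (by simp [h.run]) (WP.of_wp ?_)
  refine wp_seq (wp_ite trivial trivial h.vu h0 (fun hc => ?_) (fun hc => ?_))
  · simp only [Cmp.holds] at hc
    refine wp_asg (a := dg R u) trivial (by simp [dg, hc, h0]) (key _ ?_)
    simp
  · simp only [Cmp.holds] at hc
    refine wp_asg (a := dg R u) ?_ ?_ (key _ ?_)
    · simp
    · simp [dg, hc, h.vu, value_outdeg]
    · simp

/-- The return from a vertex, all of whose edges have been inspected. -/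
theorem forward_back (hΛ : Λ.For R) {vis : Finset ℕ} {pe : ℕ → ℕ × ℕ} {v u j : ℕ} {σ : St} {t : ℕ}
    {Q : St → ℕ → Prop} (h : Λ.Fwd R B vis pe v (dg R v) σ) (hvis : v ∈ vis) (hvn : v < n)
    (hpe : pe v = (u, j)) (hu : u ≤ n) (hj : j < dg R u) (hnb : nb R u j = v)
    (hQ : ∀ σ' t', Λ.Fwd R B vis pe u (j + 1) σ' → σ'.out = σ.out →
      t' ≤ t + 300 * (Λ.l v + 1) → WP R w M forwardLoop σ' t' Q) :
    WP R w M forwardLoop σ t Q := by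
  have hw0 : w ≠ 0 := Λ.w_pos.ne'
  have h0 : σ.v 0 = n := h.h0.trans hΛ.n_eq
  have hlt := hΛ.two_n_lt
  have hpos := hΛ.n_pos
  have hF := h.field v hvis hvn
  have hdg : dg R u ≤ n := by
    unfold dg; split
    · exact le_rfl
    · exact od_le R u
  rw [hpe] at hF
  refine WP.wh_true trivial (by simp [hw0]) (by simp [h.run]) (WP.of_wp ?_)
  refine wp_seq (wp_ite trivial trivial h.vu h0 (fun hc => ?_) (fun hc => ?_))
  · simp only [Cmp.holds] at hc; omega
  · refine wp_asg (a := dg R v) ?_ ?_ ?_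
    · simp
    · simp [dg, hvn.ne, h.vu, value_outdeg]
    refine wp_ite (x := dg R v) (y := dg R v) trivial trivial (by simp [h.vj]) (by simp)
      (fun hc => absurd hc (lt_irrefl _)) (fun _ => ?_)
    refine wp_ite (x := v) (y := n) trivial trivial (by simp [h.vu]) (by simp [h0])
      (fun hc => absurd hc hvn.ne) (fun _ => ?_)
    refine wp_seq ((parentS_spec hΛ (h.toStat.set (by norm_num)) (by simp [h.vu]) hu hj hnb
      hF).mono ?_)
    rintro σ' t' ⟨b1, b2, b3, b4, b5, b6⟩
    refine wp_asg (a := j + 1) ?_ ?_ (hQ _ _ ?_ b4 ?_)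
    · simp [b2, hw0]; omega
    · simp [b2]
    · have hst := (h.toStat.set (x := 19) (a := dg R v) (by norm_num)).fr' b5 b3
      have h26 : σ'.v 26 = 1 := by rw [b5 26 (by omega)]; simp [h.run]
      refine ⟨hst.set (by norm_num), by simp [b1], by simp, by simp [h26], h.root, hu, ?_, ?_⟩
      · rw [St.set_mem, b3]; exact h.visited
      · rw [St.set_mem, b3]; exact h.field
    · simp at b6 ⊢; omega

/-- The depth-first search, by induction over its abstract counterpart. -/
theorem forward_spec (hΛ : Λ.For R) {vis vis' : Finset ℕ} {pe pe' : ℕ → ℕ × ℕ} {u j : ℕ}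
    (hd : Dfs (nb R) (dg R) vis pe u j vis' pe') {Q : St → ℕ → Prop} :
    ∀ {σ : St} {t : ℕ}, Λ.Fwd R B vis pe u j σ →
    (∀ σ' t', Λ.Fwd R B vis' pe' u (dg R u) σ' → σ'.out = σ.out →
      t' + 600 * ∑ x ∈ vis, Λ.fcost R x ≤
        t + 600 * ∑ x ∈ vis', Λ.fcost R x + 600 * (dg R u - j) → WP R w M forwardLoop σ' t' Q) →
    WP R w M forwardLoop σ t Q := by
  induction hd with
  | done vis pe u => exact fun h hQ => hQ _ _ h rfl (by omega)
  | @skip vis vis' pe pe' u j h1 h2 h3 ih =>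
    intro σ t h hQ
    refine forward_step hΛ h h1 (fun _ σ' t' h' ho ht => ih h' fun σ'' t'' h'' ho' ht' =>
      hQ _ _ h'' (ho'.trans ho) (by omega)) (fun hc => absurd h2 hc)
  | @visit vis vis₁ vis' pe pe₁ pe' u j h1 h2 h3 h4 ih1 ih2 =>
    intro σ t h hQ
    refine forward_step hΛ h h1 (fun hc => absurd hc h2) fun _ σ₁ t₁ b1 b2 b3 => ih1 b1 ?_
    intro σ₂ t₂ c1 c2 c3
    rw [Finset.sum_insert h2] at c3
    refine forward_back hΛ c1 (h3.subset (Finset.mem_insert_self _ _)) (nb_lt R h.u_le h1)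
      (u := u) (j := j) ?_ h.u_le h1 rfl fun σ₃ t₃ d1 d2 d3 => ih2 d1 ?_
    · rw [h3.pe_eq _ (Finset.mem_insert_self _ _), Function.update_self]
    · intro σ₄ t₄ e1 e2 e3
      refine hQ _ _ e1 (by rw [e2, d2, c2, b2]) ?_
      simp only [fcost] at *
      omega

end Lay

/-! ### The reverse search for a component -/

/-- The number `d - 2` of the vertex in variable `x`, of total degree `d`. The subtraction is safe
only if `d ≥ 2`, which holds for the vertices that are pushed. -/
def degE (x : ℕ) : Ex := .acc .indeg (.var x) 0 + .acc .outdeg (.var x) 0 - 2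

/-- Push the number in variable 23 onto the stack, with the width of the vertex in variable 22. -/
def pushS : Sm :=
  .asg 24 (degE 22) ;;
  .wh .lt 0 (.var 24)
    (setS (.var 18) (.var 23 % 2) ;; .asg 18 (.var 18 + 1) ;; .asg 23 (.var 23 / 2) ;;
      .asg 24 (.var 24 / 2))

/-- Pop a number, with the width of the vertex in variable 20, into variable 23. -/
def popS : Sm :=
  .asg 24 (degE 20) ;; .asg 23 0 ;;
  .wh .lt 0 (.var 24)
    (.asg 18 (.var 18 - 1) ;; .asg 23 (.var 23 + .var 23 + getE (.var 18)) ;;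
      .asg 24 (.var 24 / 2))

/-- One step of the reverse search. -/
def revBody : Sm :=
  .ite .lt (.var 21) (.acc .indeg (.var 20) 0)
    (.asg 22 (.acc .inhead (.var 20) (.var 21)) ;;
      .ite .eq (getE (xN + .var 22)) 1
        (.asg 23 (.acc .inmate (.var 20) (.var 21)) ;; .blk pushS ;; .asg 20 (.var 22) ;;
          .asg 21 0 ;; setS (xN + .var 20) 0 ;; .emit (.var 20))
        (.asg 21 (.var 21 + 1)))
    (.ite .eq (.var 20) (.var 19) (.asg 25 0)
      (.blk popS ;; .asg 22 (.acc .outhead (.var 20) (.var 23)) ;;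
        .asg 21 (.acc .outmate (.var 20) (.var 23) + 1) ;; .asg 20 (.var 22)))

/-- The reverse search. -/
def revLoop : Sm := .wh .eq (.var 25) 1 revBody

/-- Output of the component of the vertex in variable 10. -/
def revS : Sm :=
  .asg 19 (.var 10) ;; .asg 20 (.var 10) ;; .asg 21 0 ;; .asg 18 (xN + xN) ;; .asg 25 1 ;;
  setS (xN + .var 20) 0 ;; .emit (.var 20) ;; .blk revLoop ;; .sep

section Halve

/-- Repeated halving of `d` gives zero after exactly `Nat.size d` steps. -/
theorem half_pos {d s : ℕ} : 0 < d / 2 ^ s ↔ s < Nat.size d := by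
  rw [Nat.lt_size, Nat.div_pos_iff]; simp

end Halve

/-- Variables other than 18, 23 and 24 are equal. -/
def FrS (σ σ' : St) : Prop := ∀ i, i ≠ 18 → i ≠ 23 → i ≠ 24 → σ'.v i = σ.v i

namespace Lay

variable {w M : ℕ} {Λ : Lay w M} {n : ℕ} {G : Digraph (Fin n)} {R : AdjArrays G} {B : ℕ → ℕ}

/-- Plane 0 consists of the first `n` positions. -/
theorem pos_succ_ge (t v : ℕ) : Λ.n ≤ pos Λ.n Λ.l (t + 1) v := by
  have h1 : off Λ.n Λ.l 1 ≤ off Λ.n Λ.l (t + 1) := off_mono _ _ (by omega)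
  have h2 : off Λ.n Λ.l 1 = Λ.n := by simp [off, cnt_zero_left]
  rw [pos]; omega

/-- Fields do not depend on plane 0 nor on the stack. -/
theorem Field.congr {m m' : ℕ → ℕ} {v x : ℕ} (h : Λ.Field m v x) (hv : v < Λ.n)
    (hm : ∀ p < 2 * Λ.N, (∀ y < Λ.n, p ≠ Λ.N + y) → Λ.bt m' p = Λ.bt m p) : Λ.Field m' v x := by
  intro t ht
  rw [hm _ (field_lt hv (by omega)), h t ht]
  intro y hy he
  have := pos_succ_ge (Λ := Λ) t v
  omega

theorem degE_safe (hΛ : Λ.For R) {σ : St} {x v : ℕ} (hx : σ.v x = v)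
    (hd : 2 ≤ idg R v + od R v) : (degE x).safe R w M σ := by
  have h1 := hΛ.two_n_lt
  have h2 := Λ.two_lt
  have h3 := idg_le R v
  have h4 := od_le R v
  simp [degE, hx, value_indeg, value_outdeg, h2, hd]
  omega

theorem degE_eval {σ : St} {x v : ℕ} (hx : σ.v x = v) :
    (degE x).eval R w σ = idg R v + od R v - 2 := by
  simp [degE, hx, value_indeg, value_outdeg]

theorem pushS_spec (hΛ : Λ.For R) {σ : St} {t v k sp : ℕ} (h : Λ.Stat B σ) (hv : σ.v 22 = v)
    (hd : 2 ≤ idg R v + od R v) (hk : σ.v 23 = k) (hsp : σ.v 18 = sp) (h2 : 2 * Λ.N ≤ sp)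
    (hspace : sp + width R v ≤ Λ.NB) :
    WP R w M pushS σ t fun σ' t' => Λ.Stat B σ' ∧ σ'.v 18 = sp + width R v ∧
      (∀ i < width R v, Λ.bt σ'.mem (sp + i) = k / 2 ^ i % 2) ∧
      (∀ p < sp, Λ.bt σ'.mem p = Λ.bt σ.mem p) ∧
      σ'.out = σ.out ∧ FrS σ σ' ∧ t' ≤ t + 100 * (width R v + 1) := by
  have hw0 : w ≠ 0 := Λ.w_pos.ne'
  have hw2 := Λ.two_lt
  have hNB := Λ.NB_lt
  let Inv : ℕ → St → ℕ → Prop := fun i σ' t' => ∃ s, i + s = width R v ∧ Λ.Stat B σ' ∧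
    σ'.v 18 = sp + s ∧ σ'.v 23 = k / 2 ^ s ∧ σ'.v 24 = (idg R v + od R v - 2) / 2 ^ s ∧
    (∀ i < s, Λ.bt σ'.mem (sp + i) = k / 2 ^ i % 2) ∧
    (∀ p < sp, Λ.bt σ'.mem p = Λ.bt σ.mem p) ∧
    σ'.out = σ.out ∧ FrS σ σ' ∧ t' ≤ t + 20 + 80 * s
  apply WP.of_wp
  refine wp_asg_seq (degE_safe hΛ hv hd) (degE_eval hv) (WP.wh_count Inv ?_ ?_ ?_ (width R v) _ _ ?_)
  · rintro i σ' t' ⟨s, hs, hst, h18, h23, h24, hb, hp, ho, hf, ht⟩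
    refine ⟨by simp, trivial, ?_⟩
    simp only [Cmp.holds, eval_num, eval_var, h24]
    rw [half_pos, ← width]
    omega
  · rintro i σ' t' ⟨s, hs, hst, h18, h23, h24, hb, hp, ho, hf, ht⟩
    have hb2 : k / 2 ^ s % 2 < 2 := Nat.mod_lt _ (by norm_num)
    apply WP.of_wp
    refine wp_seq (wp_setS hst.toVars (p := sp + s) (y := k / 2 ^ s % 2) trivial ?_ h18 ?_ ?_ hb2
      (wp_asg_seq (a := sp + (s + 1)) ?_ ?_ (wp_asg_seq (a := k / 2 ^ (s + 1)) ?_ ?_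
        (wp_asg (a := (idg R v + od R v - 2) / 2 ^ (s + 1)) ?_ ?_ ?_))))
    · simp [hw2]
    · simp [h23]
    · omega
    · simp [h18, hw0]; omega
    · simp [h18, add_assoc]
    · simp [hw2]
    · simp [h23, Nat.div_div_eq_div_mul, pow_succ]
    · simp [hw2]
    · simp [h24, Nat.div_div_eq_div_mul, pow_succ]
    · refine ⟨s + 1, by omega, ?_, by simp, by simp, by simp, fun i hi => ?_, fun p hp' => ?_, ho,
        ?_, ?_⟩
      · exact (((hst.setBit (by omega) hb2).set (by norm_num)).set (by norm_num)).set (by norm_num)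
      · simp only [St.set_mem]
        rw [bt_setBit _ hb2]
        split
        · congr 3; omega
        · exact hb i (by omega)
      · simp only [St.set_mem]
        rw [bt_setBit _ hb2, if_neg (by omega)]
        exact hp p hp'
      · intro i h1 h2 h3
        simp [h1, h2, h3, hf i h1 h2 h3]
      · simp; omega
  · rintro σ' t' ⟨s, hs, hst, h18, h23, h24, hb, hp, ho, hf, ht⟩
    obtain rfl : s = width R v := by omega
    refine ⟨hst, h18, hb, hp, ho, hf, ?_⟩
    simp; omega
  · refine ⟨0, by simp, h.set (by norm_num), by simp [hsp], by simp [hk], by simp, by simp,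
      fun _ _ => rfl, rfl, ?_, ?_⟩
    · intro i h1 h2 h3
      simp [h3]
    · simp [degE]

theorem popS_spec (hΛ : Λ.For R) {σ : St} {t v k sp : ℕ} (h : Λ.Stat B σ) (hv : σ.v 20 = v)
    (hd : 2 ≤ idg R v + od R v) (hsp : σ.v 18 = sp + width R v)
    (hk : k < 2 ^ width R v) (hkn : k ≤ n) (hspace : sp + width R v ≤ Λ.NB)
    (hb : ∀ i < width R v, Λ.bt σ.mem (sp + i) = k / 2 ^ i % 2) :
    WP R w M popS σ t fun σ' t' => σ'.v 23 = k ∧ σ'.v 18 = sp ∧ σ'.mem = σ.mem ∧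
      σ'.out = σ.out ∧ FrS σ σ' ∧ t' ≤ t + 100 * (width R v + 1) := by
  have hw0 : w ≠ 0 := Λ.w_pos.ne'
  have hw2 := Λ.two_lt
  have hNB := Λ.NB_lt
  have hlt := hΛ.two_n_lt
  let Inv : ℕ → St → ℕ → Prop := fun i σ' t' => ∃ s, i + s = width R v ∧
    σ'.v 18 = sp + i ∧ σ'.v 23 = k / 2 ^ i ∧ σ'.v 24 = (idg R v + od R v - 2) / 2 ^ s ∧
    σ'.mem = σ.mem ∧ σ'.out = σ.out ∧ FrS σ σ' ∧ t' ≤ t + 20 + 80 * s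
  apply WP.of_wp
  refine wp_asg_seq (degE_safe hΛ hv hd) (degE_eval hv) (wp_asg_seq (a := 0) ?_ ?_
    (WP.wh_count Inv ?_ ?_ ?_ (width R v) _ _ ?_))
  · simp
  · simp
  · rintro i σ' t' ⟨s, hs, h18, h23, h24, hm, ho, hf, ht⟩
    refine ⟨by simp, trivial, ?_⟩
    simp only [Cmp.holds, eval_num, eval_var, h24]
    rw [half_pos, ← width]
    omega
  · rintro i σ' t' ⟨s, hs, h18, h23, h24, hm, ho, hf, ht⟩
    have hst := h.congr (σ' := σ') (fun x hx => hf x (by omega) (by omega) (by omega)) hm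
    have hst' := hst.set (x := 18) (a := sp + i) (by norm_num)
    have hbi := hb i (by omega)
    have e1 : k / 2 ^ (i + 1) + k / 2 ^ (i + 1) + k / 2 ^ i % 2 = k / 2 ^ i := by
      rw [pow_succ, ← Nat.div_div_eq_div_mul]; omega
    have e2 : k / 2 ^ i ≤ k := Nat.div_le_self _ _
    apply WP.of_wp
    refine wp_asg_seq (a := sp + i) ?_ ?_ (wp_asg_seq (a := k / 2 ^ i) ?_ ?_
        (wp_asg (a := (idg R v + od R v - 2) / 2 ^ (s + 1)) ?_ ?_ ?_))
    · simp [h18, hw0]; omega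
    · simp [h18]
    · have hs1 : (getE (.var 18)).safe R w M (σ'.set 18 (sp + i)) :=
        safe_getE hst'.toVars trivial (by simp; omega)
      simp [h23, hs1, eval_getE hst'.toVars, hm, hbi, e1]
      omega
    · simp [h23, eval_getE hst'.toVars, hm, hbi, e1]
    · simp [hw2]
    · simp [h24, Nat.div_div_eq_div_mul, pow_succ]
    · refine ⟨s + 1, by omega, by simp, by simp, by simp, hm, ho, ?_, ?_⟩
      · intro i h1 h2 h3
        simp [h1, h2, h3, hf i h1 h2 h3]
      · simp [cost_getE]; omega
  · rintro σ' t' ⟨s, hs, h18, h23, h24, hm, ho, hf, ht⟩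
    refine ⟨by simpa using h23, h18, hm, ho, hf, ?_⟩
    simp; omega
  · refine ⟨0, by simp, by simp [hsp], ?_, by simp, rfl, rfl, ?_, ?_⟩
    · simp [Nat.div_eq_of_lt hk]
    · intro i h1 h2 h3
      simp [h2, h3]
    · simp [degE]

/-- The number of stack bits that may still be needed when the vertices in `vis` have been
visited. -/
def rem (R : AdjArrays G) (vis : Finset ℕ) : ℕ := ∑ y ∈ Finset.range n \ vis, width R y

theorem rem_insert {vis : Finset ℕ} {y : ℕ} (hy : y < n) (hv : y ∉ vis) :
    rem R (insert y vis) + width R y = rem R vis := by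
  rw [rem, rem, Finset.sdiff_insert]
  exact Finset.sum_erase_add _ _ (by simp [hy, hv])

/-- The state of the reverse search. Variables 20 and 21 are the current vertex and the number of the
edge to be inspected, 18 is the stack pointer, 19 the vertex where the search started, and 25 says
whether the search goes on. -/
structure Rev (Λ : Lay w M) (R : AdjArrays G) (B : ℕ → ℕ) (r : ℕ) (vis : Finset ℕ)
    (x i sp : ℕ) (σ : St) : Prop extends Λ.Stat B σ where
  vx : σ.v 20 = x
  vi : σ.v 21 = i
  vsp : σ.v 18 = sp
  vr : σ.v 19 = r
  run : σ.v 25 = 1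
  root : r ∈ vis
  x_lt : x < n
  unassigned : ∀ y < n, Λ.bt σ.mem (Λ.N + y) = if y ∈ vis then 0 else 1
  sp_ge : 2 * Λ.N ≤ sp
  space : sp + rem R vis ≤ Λ.NB

/-- What the reverse search leaves alone: the variables of the surrounding search and the bits
below the stack pointer other than those for the vertices. -/
structure RevFr (Λ : Lay w M) (sp : ℕ) (σ σ' : St) : Prop where
  var : ∀ i, i < 12 ∨ i = 26 → σ'.v i = σ.v i
  mem : ∀ p < sp, (∀ y < Λ.n, p ≠ Λ.N + y) → Λ.bt σ'.mem p = Λ.bt σ.mem p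

theorem RevFr.trans {sp sp' : ℕ} {σ σ' σ'' : St} (h : Λ.RevFr sp σ σ') (h' : Λ.RevFr sp' σ' σ'')
    (hs : sp ≤ sp') : Λ.RevFr sp σ σ'' :=
  ⟨fun i hi => (h'.var i hi).trans (h.var i hi),
    fun p hp hy => (h'.mem p (hp.trans_le hs) hy).trans (h.mem p hp hy)⟩

/-- The time that the reverse search spends on a vertex is a constant times this number. -/
def rcost (R : AdjArrays G) (v : ℕ) : ℕ := idg R v + width R v + 1

/-- One step of the reverse search with an ingoing edge left to inspect. A vertex newly visited has an
ingoing edge, so that its total degree is at least two, and the position of the edge in its array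
of outneighbors has at most `width` bits. -/
theorem rev_step (hΛ : Λ.For R) {r x i sp : ℕ} {vis : Finset ℕ} {σ : St} {t : ℕ}
    {Q : St → ℕ → Prop} (h : Λ.Rev R B r vis x i sp σ) (hi : i < idg R x)
    (hskip : ih R x i ∈ vis → ∀ σ' t', Λ.Rev R B r vis x (i + 1) sp σ' → σ'.out = σ.out →
      Λ.RevFr sp σ σ' → t' ≤ t + 300 → WP R w M revLoop σ' t' Q)
    (hpos : ih R x i ∉ vis → 0 < idg R (ih R x i))
    (hvisit : ih R x i ∉ vis → ∀ σ' t', Λ.Rev R B r (insert (ih R x i) vis) (ih R x i) 0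
        (sp + width R (ih R x i)) σ' →
      (∀ s < width R (ih R x i), Λ.bt σ'.mem (sp + s) = im R x i / 2 ^ s % 2) →
      σ'.out = σ.out ++ [some (ih R x i)] → Λ.RevFr sp σ σ' →
      t' ≤ t + 300 * (width R (ih R x i) + 1) → WP R w M revLoop σ' t' Q) :
    WP R w M revLoop σ t Q := by
  have hw0 : w ≠ 0 := Λ.w_pos.ne'
  have hw2 := Λ.two_lt
  have hlt := hΛ.two_n_lt
  have hn := hΛ.n_eq
  have hnN := hΛ.n_le
  have hNN := Λ.N_le
  have hNB := Λ.NB_lt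
  have h7 : σ.v 7 = Λ.N := h.h7
  have hdg : idg R x ≤ n := idg_le R x
  obtain ⟨hy, hk, -, -⟩ := in_spec R h.x_lt hi
  set y := ih R x i with hydef
  set k := im R x i with hkdef
  refine WP.wh_true trivial (by simp [hw0]) (by simp [h.run]) (WP.of_wp ?_)
  refine wp_ite (x := i) (y := idg R x) trivial (by simp) h.vi (by simp [h.vx, value_indeg])
    (fun _ => ?_) (fun hc => absurd hi hc)
  refine wp_asg_seq (a := y) ?_ ?_ (wp_ite (x := if y ∈ vis then 0 else 1) (y := 1) ?_ ?_ ?_ rfl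
    (fun hc => ?_) (fun hc => ?_))
  · simp
  · simp [h.vx, h.vi, value_inhead, hydef]
  · refine safe_getE (h.toVars.set (by norm_num)) ?_ ?_
    · simp [h7]; omega
    · simp [h7]; omega
  · simp [hw0]
  · rw [eval_getE (h.toVars.set (by norm_num)), ← h.unassigned _ hy]; simp [h7]
  · have hmem : y ∉ vis := by
      intro hcon; simp [hcon] at hc
    have hp := hpos hmem
    have hrem := rem_insert (R := R) hy hmem
    have hspc := h.space
    have hge := h.sp_ge
    refine wp_asg_seq (a := k) ?_ ?_ (wp_seq ((pushS_spec hΛ (v := y) (k := k) (sp := sp)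
      ((h.toStat.set (by norm_num)).set (by norm_num)) ?_ ?_ ?_ ?_ h.sp_ge ?_).mono ?_))
    · simp
    · simp [h.vx, h.vi, value_inmate, hkdef]
    · simp
    · omega
    · simp
    · simp [h.vsp]
    · omega
    · rintro σ' t₁ ⟨b1, b2, b3, b4, b5, b6, b7⟩
      have h7' : σ'.v 7 = Λ.N := b1.h7
      have h22 : σ'.v 22 = y := by rw [b6 22 (by omega) (by omega) (by omega)]; simp
      have hst2 : Λ.Stat B ((σ'.set 20 y).set 21 0) := (b1.set (by norm_num)).set (by norm_num)
      refine wp_asg_seq (a := y) trivial h22 (wp_asg_seq (a := 0) ?_ rfl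
        (wp_seq (wp_setS hst2.toVars (p := Λ.N + y) (y := 0) ?_ ?_ ?_ ?_ ?_ ?_
          ⟨trivial, ?_⟩)))
      · simp
      · simp [h7']; omega
      · simp
      · simp [h7']
      · simp
      · omega
      · omega
      · refine hvisit hmem _ _ ?_ ?_ ?_ ⟨?_, ?_⟩ ?_
        · refine ⟨(hst2.setBit (Nat.le_add_right _ _) (by norm_num)).emit _, by simp, by simp,
            by simp [b2], ?_, ?_, ?_, hy, ?_, ?_, ?_⟩
          · simp [b6 19, h.vr]
          · simp [b6 25, h.run]
          · exact Finset.mem_insert_of_mem h.root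
          · intro z hz
            simp only [St.emit_mem]
            rw [bt_setBit _ (by norm_num)]
            simp only [St.set_mem, add_right_inj, Finset.mem_insert]
            by_cases hzy : z = y
            · simp [hzy]
            · rw [b4 _ (by omega)]; simp [hzy, h.unassigned z hz]
          · omega
          · omega
        · intro s hs
          simp only [St.emit_mem]
          rw [bt_setBit _ (by norm_num), if_neg (by omega)]
          exact b3 s hs
        · simp [b5]
        · intro i hi'
          have e := b6 i (by omega) (by omega) (by omega)
          simp [e, show i ≠ 20 by omega, show i ≠ 21 by omega, show i ≠ 22 by omega,
            show i ≠ 23 by omega]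
        · intro p hp hpy
          simp only [St.emit_mem]
          rw [bt_setBit _ (by norm_num), if_neg (hpy y (by omega))]
          exact b4 p hp
        · simp [cost_getE] at b7 ⊢; omega
  · have hmem : y ∈ vis := by
      by_contra hcon; simp [hcon] at hc
    refine wp_asg (a := i + 1) ?_ ?_ (hskip hmem _ _ ?_ rfl ⟨?_, fun _ _ _ => rfl⟩ ?_)
    · simp [h.vi, hw0]; omega
    · simp [h.vi]
    · exact ⟨(h.toStat.set (by norm_num)).set (by norm_num), by simp [h.vx], by simp,
        by simp [h.vsp], by simp [h.vr], by simp [h.run], h.root, h.x_lt, h.unassigned, h.sp_ge,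
        h.space⟩
    · intro i hi'
      simp [show i ≠ 21 by omega, show i ≠ 22 by omega]
    · simp [cost_getE]

/-- The return in the reverse search to the vertex `x` from which the current one was discovered; the
position popped from the stack leads to `x` and the edge inspected there. -/
theorem rev_back (hΛ : Λ.For R) {r x i sp : ℕ} {vis : Finset ℕ} {σ : St} {t : ℕ}
    {Q : St → ℕ → Prop} (hx : x < n) (hi : i < idg R x)
    (h : Λ.Rev R B r vis (ih R x i) (idg R (ih R x i)) (sp + width R (ih R x i)) σ)
    (hr : ih R x i ≠ r) (hpos : 0 < idg R (ih R x i)) (hsp : 2 * Λ.N ≤ sp)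
    (hst : ∀ s < width R (ih R x i), Λ.bt σ.mem (sp + s) = im R x i / 2 ^ s % 2)
    (hQ : ∀ σ' t', Λ.Rev R B r vis x (i + 1) sp σ' → σ'.out = σ.out → Λ.RevFr sp σ σ' →
      t' ≤ t + 300 * (width R (ih R x i) + 1) → WP R w M revLoop σ' t' Q) :
    WP R w M revLoop σ t Q := by
  have hw0 : w ≠ 0 := Λ.w_pos.ne'
  have hw2 := Λ.two_lt
  have hlt := hΛ.two_n_lt
  have hdg : idg R x ≤ n := idg_le R x
  obtain ⟨hy, hk, hoh, hom⟩ := in_spec R hx hi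
  have hod := od_le R (ih R x i)
  set y := ih R x i with hydef
  set k := im R x i with hkdef
  have hspc := h.space
  have hkw : k < 2 ^ width R y := by
    refine lt_of_le_of_lt ?_ (Nat.lt_size_self _)
    omega
  refine WP.wh_true trivial (by simp [hw0]) (by simp [h.run]) (WP.of_wp ?_)
  refine wp_ite (x := idg R y) (y := idg R y) trivial (by simp) h.vi (by simp [h.vx, value_indeg])
    (fun hc => absurd hc (lt_irrefl _)) (fun _ => ?_)
  refine wp_ite trivial trivial h.vx h.vr (fun hc => absurd hc hr) (fun _ => ?_)
  refine wp_seq ((popS_spec hΛ (v := y) (k := k) (sp := sp) h.toStat h.vx (by omega) h.vsp hkw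
    (by omega) (by omega) hst).mono ?_)
  rintro σ' t₁ ⟨b1, b2, b3, b4, b5, b6⟩
  have h20 : σ'.v 20 = y := (b5 20 (by omega) (by omega) (by omega)).trans h.vx
  have hst' := h.toStat.congr (σ' := σ') (fun x hx => b5 x (by omega) (by omega) (by omega)) b3
  refine wp_asg_seq (a := x) ?_ ?_ (wp_asg_seq (a := i + 1) ?_ ?_ (wp_asg (a := x) ?_ ?_
    (hQ _ _ ?_ b4 ⟨?_, ?_⟩ ?_)))
  · simp
  · simp [h20, b1, value_outhead, hoh]
  · simp [h20, b1, value_outmate, hom, hw0]; omega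
  · simp [h20, b1, value_outmate, hom]
  · simp
  · simp
  · refine ⟨((hst'.set (by norm_num)).set (by norm_num)).set (by norm_num), by simp, by simp,
      by simp [b2], by simp [b5 19, h.vr], by simp [b5 25, h.run], h.root, hx, ?_, hsp, by omega⟩
    simp only [St.set_mem, b3]
    exact h.unassigned
  · intro i hi'
    have e := b5 i (by omega) (by omega) (by omega)
    simp [e, show i ≠ 20 by omega, show i ≠ 21 by omega, show i ≠ 22 by omega]
  · intro p hp hpy
    simp only [St.set_mem, b3]
  · simp at b6 ⊢; omega

/-- The reverse search, by induction over its abstract counterpart. -/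
theorem rev_spec (hΛ : Λ.For R) {r : ℕ} {vis vis' : Finset ℕ} {pe pe' : ℕ → ℕ × ℕ} {x i : ℕ}
    (hd : Dfs (ih R) (idg R) vis pe x i vis' pe') {Q : St → ℕ → Prop} :
    ∀ {σ : St} {t sp : ℕ}, (∀ y ∈ vis', y ∉ vis → 0 < idg R y) → Λ.Rev R B r vis x i sp σ →
    (∀ σ' t' (l : List ℕ), Λ.Rev R B r vis' x (idg R x) sp σ' → Λ.RevFr sp σ σ' →
      σ'.out = σ.out ++ l.map some → l.Nodup → (∀ y, y ∈ l ↔ y ∈ vis' ∧ y ∉ vis) →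
      t' + 600 * ∑ x ∈ vis, rcost R x ≤
        t + 600 * ∑ x ∈ vis', rcost R x + 600 * (idg R x - i) → WP R w M revLoop σ' t' Q) →
    WP R w M revLoop σ t Q := by
  induction hd with
  | done vis pe u =>
    exact fun _ h hQ => hQ _ _ [] h ⟨fun _ _ => rfl, fun _ _ _ => rfl⟩ (by simp) (by simp)
      (by simp) (by omega)
  | @skip vis vis' pe pe' u j h1 h2 h3 ihd =>
    intro σ t sp hp h hQ
    refine rev_step hΛ h h1 (fun _ σ' t' h' ho hf ht => ihd hp h' fun σ'' t'' l h'' hf' ho' hl hm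
      ht' => hQ _ _ l h'' (hf.trans hf' le_rfl) (by rw [ho', ho]) hl hm (by omega))
      (fun hc => absurd h2 hc) (fun hc => absurd h2 hc)
  | @visit vis vis₁ vis' pe pe₁ pe' u j h1 h2 h3 h4 ih1 ih2 =>
    intro σ t sp hp h hQ
    have hy1 := h3.subset (Finset.mem_insert_self _ _)
    have hpos : 0 < idg R (ih R u j) := hp _ (h4.subset hy1) h2
    have hsub : vis ⊆ vis₁ := (Finset.subset_insert _ _).trans h3.subset
    refine rev_step hΛ h h1 (fun hc => absurd hc h2) (fun _ => hpos)
      fun _ σ₁ t₁ b1 b2 b3 b4 b5 => ih1 (fun y hy hyv => hp y (h4.subset hy) fun hc => hyv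
        (Finset.mem_insert_of_mem hc)) b1 ?_
    intro σ₂ t₂ l₁ c1 c2 c3 c4 c5 c6
    rw [Finset.sum_insert h2] at c6
    have hNB := Λ.NB_lt
    have hn := hΛ.n_eq
    have hnN := hΛ.n_le
    have hge := h.sp_ge
    refine rev_back hΛ h.x_lt h1 c1 (fun e => h2 (e ▸ h.root)) hpos h.sp_ge (fun s hs => ?_)
      fun σ₃ t₃ d1 d2 d3 d4 => ih2 (fun y hy hyv => hp y hy fun hc => hyv (hsub hc)) d1 ?_
    · rw [← b2 s hs, c2.mem _ (by omega) (fun y hy => by omega)]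
    · intro σ₄ t₄ l₂ e1 e2 e3 e4 e5 e6
      refine hQ _ _ (ih R u j :: (l₁ ++ l₂)) e1
        ((b4.trans c2 (by omega)).trans (d3.trans e2 le_rfl) le_rfl)
        (by rw [e3, d2, c3, b3]; simp) ?_ (fun y => ?_) ?_
      · rw [List.nodup_cons, List.nodup_append]
        refine ⟨?_, c4, e4, ?_⟩
        · simp only [List.mem_append, c5, e5]; simp [hy1]
        · rintro a ha b hb rfl
          rw [c5] at ha
          rw [e5] at hb
          exact hb.2 ha.1
      · simp only [List.mem_cons, List.mem_append, c5, e5, Finset.mem_insert]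
        constructor
        · rintro (rfl | ⟨a, b⟩ | ⟨a, b⟩)
          · exact ⟨h4.subset hy1, h2⟩
          · exact ⟨h4.subset a, fun hc => b (.inr hc)⟩
          · exact ⟨a, fun hc => b (hsub hc)⟩
        · rintro ⟨a, b⟩
          by_cases hyy : y = ih R u j
          · exact .inl hyy
          · by_cases hy1 : y ∈ vis₁
            · exact .inr (.inl ⟨hy1, by simp [hyy, b]⟩)
            · exact .inr (.inr ⟨a, hy1⟩)
      · simp only [rcost] at *
        omega

/-- The reverse search from `r` outputs the vertices that it visits, which are marked as assigned. -/
theorem revS_spec (hΛ : Λ.For R) {r : ℕ} {Z Z' : Finset ℕ} {pe pe' : ℕ → ℕ × ℕ} {σ : St} {t : ℕ}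
    (h : Λ.Stat B σ) (hv : σ.v 10 = r) (hr : r < n) (hrZ : r ∉ Z)
    (hZ : ∀ y < n, Λ.bt σ.mem (Λ.N + y) = if y ∈ Z then 0 else 1)
    (hd : Dfs (ih R) (idg R) (insert r Z) pe r 0 Z' pe')
    (hp : ∀ y ∈ Z', y ∉ insert r Z → 0 < idg R y) :
    WP R w M revS σ t fun σ' t' => ∃ l : List ℕ, Λ.Stat B σ' ∧
      (∀ y < n, Λ.bt σ'.mem (Λ.N + y) = if y ∈ Z' then 0 else 1) ∧ Λ.RevFr (2 * Λ.N) σ σ' ∧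
      σ'.out = σ.out ++ (l.map some ++ [none]) ∧ l.Nodup ∧ (∀ y, y ∈ l ↔ y ∈ Z' ∧ y ∉ Z) ∧
      t' + 600 * ∑ x ∈ Z, rcost R x ≤ t + 600 * ∑ x ∈ Z', rcost R x := by
  have hw0 : w ≠ 0 := Λ.w_pos.ne'
  have hw2 := Λ.two_lt
  have hn := hΛ.n_eq
  have hnN := hΛ.n_le
  have hNN := Λ.N_le
  have hNB := Λ.NB_lt
  have h7 : σ.v 7 = Λ.N := h.h7
  have hrZ' : r ∈ Z' := hd.subset (Finset.mem_insert_self _ _)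
  apply WP.of_wp
  have hst : Λ.Stat B (((((σ.set 19 r).set 20 r).set 21 0).set 18 (2 * Λ.N)).set 25 1) :=
    ((((h.set (by norm_num)).set (by norm_num)).set (by norm_num)).set (by norm_num)).set
      (by norm_num)
  refine wp_asg_seq trivial hv (wp_asg_seq (a := r) trivial (by simp [hv]) (wp_asg_seq (a := 0) ?_
    rfl (wp_asg_seq (a := 2 * Λ.N) ?_ ?_ (wp_asg_seq (a := 1) ?_ rfl (wp_seq (wp_setS hst.toVars
      (p := Λ.N + r) (y := 0) ?_ ?_ ?_ ?_ ?_ ?_ ?_))))))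
  · simp
  · simp [h7]; omega
  · simp [h7]; omega
  · simp [hw0]
  · simp [h7]; omega
  · simp
  · simp [h7]
  · simp
  · omega
  · omega
  · refine ⟨trivial, wp_seq (rev_spec (B := B) (r := r) hΛ hd (sp := 2 * Λ.N) hp ⟨?_, ?_, ?_, ?_, ?_, ?_, ?_,
      hr, ?_, le_rfl, ?_⟩ ?_)⟩
    · exact (hst.setBit (Nat.le_add_right _ _) (by norm_num)).emit _
    · simp
    · simp
    · simp
    · simp
    · simp
    · simp
    · intro y hy
      simp only [St.emit_mem]
      rw [bt_setBit _ (by norm_num)]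
      by_cases hyr : y = r
      · simp [hyr]
      · simp [hyr, hZ y hy]
    · have h1 : rem R (insert r Z) ≤ ∑ v ∈ Finset.range n, width R v :=
        Finset.sum_le_sum_of_subset Finset.sdiff_subset
      have := hΛ.space
      omega
    · intro σ' t' l b1 b2 b3 b4 b5 b6
      rw [Finset.sum_insert hrZ] at b6
      have hdg : idg R r ≤ n := idg_le R r
      refine WP.wh_true trivial (by simp [hw0]) (by simp [b1.run]) (WP.of_wp ?_)
      refine wp_ite (x := idg R r) (y := idg R r) trivial (by simp) b1.vi
        (by simp [b1.vx, value_indeg]) (fun hc => absurd hc (lt_irrefl _)) (fun _ => ?_)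
      refine wp_ite trivial trivial b1.vx b1.vr (fun _ => ?_) (fun hc => absurd rfl hc)
      refine wp_asg (a := 0) ?_ rfl (WP.wh_false trivial ?_ ?_ ⟨r :: l, ?_, ?_, ⟨?_, ?_⟩, ?_, ?_, ?_,
        ?_⟩)
      · simp
      · simp [hw0]
      · simp
      · exact (b1.toStat.set (by norm_num)).emit _
      · exact b1.unassigned
      · intro i hi
        have := b2.var i hi
        simp [this, show i ≠ 20 by omega, show i ≠ 21 by omega, show i ≠ 18 by omega,
          show i ≠ 19 by omega, show i ≠ 25 by omega]
      · intro p hp hpy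
        refine (b2.mem p hp hpy).trans ?_
        simp only [St.emit_mem]
        rw [bt_setBit _ (by norm_num), if_neg (hpy r (by omega))]
        rfl
      · simp [b3]
      · refine List.nodup_cons.2 ⟨?_, b4⟩
        rw [b5]; simp
      · intro y
        rw [List.mem_cons, b5, Finset.mem_insert]
        by_cases hyr : y = r
        · simp [hyr, hrZ, hrZ']
        · simp [hyr]
      · simp [rcost] at b6 ⊢; omega

end Lay

/-! ### The search run backwards -/

/-- One step of the depth-first search, backwards. When the search comes to a vertex that has not
been assigned to a component, its component is output. -/
def backBody : Sm :=
  .ite .eq (.var 9) 0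
    (.ite .eq (.var 8) xn (.asg 26 0) (.blk parentS))
    (.asg 9 (.var 9 - 1) ;; edgeS ;; .blk matchS ;;
      .ite .eq (.var 16) 1
        (.asg 8 (.var 10) ;; .asg 9 (.acc .outdeg (.var 10) 0) ;;
          .ite .eq (getE (xN + .var 10)) 1 (.blk revS) .skip)
        .skip)

/-- The depth-first search run backwards. -/
def backLoop : Sm := .wh .eq (.var 26) 1 backBody

section Graph

variable {n : ℕ} {G : Digraph (Fin n)} (R : AdjArrays G)

theorem edge_lt {a b : ℕ} (ha : a ≤ n) (h : Edge (nb R) (dg R) a b) : b < n := by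
  obtain ⟨k, hk, rfl⟩ := h
  exact nb_lt R ha hk

theorem reach_lt {a b : ℕ} (ha : a < n) (h : Reach (nb R) (dg R) a b) : b < n := by
  induction h with
  | refl => exact ha
  | tail _ h2 ih => exact edge_lt R ih.le h2

/-- Edges of the reversed graph. -/
theorem edge_rev {a b : ℕ} (ha : a < n) (h : Edge (nb R) (dg R) a b) : Edge (ih R) (idg R) b a := by
  obtain ⟨k, hk, rfl⟩ := h
  rw [dg, if_neg ha.ne] at hk
  rw [nb, if_neg ha.ne]
  obtain ⟨-, h2, h3, -⟩ := out_spec R ha hk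
  exact ⟨_, h2, h3⟩

theorem edge_of_rev {a b : ℕ} (hb : b < n) (h : Edge (ih R) (idg R) b a) :
    a < n ∧ Edge (nb R) (dg R) a b := by
  obtain ⟨k, hk, rfl⟩ := h
  obtain ⟨h1, h2, h3, -⟩ := in_spec R hb hk
  refine ⟨h1, im R b k, ?_, ?_⟩
  · rwa [dg, if_neg h1.ne]
  · rwa [nb, if_neg h1.ne]

theorem reach_of_rev {a b : ℕ} (hb : b < n) (h : Reach (ih R) (idg R) b a) :
    a < n ∧ Reach (nb R) (dg R) a b := by
  induction h with
  | refl => exact ⟨hb, .refl⟩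
  | tail _ h2 ih =>
    obtain ⟨h3, h4⟩ := edge_of_rev R ih.1 h2
    exact ⟨h3, .head h4 ih.2⟩

/-- A vertex visited by a reverse search has an ingoing edge unless the search started there. -/
theorem idg_pos_of_reach {a b : ℕ} (ha : a < n) (h : Reach (nb R) (dg R) a b) (hab : a ≠ b) :
    0 < idg R b := by
  rcases Relation.ReflTransGen.cases_tail h with h | ⟨c, hc, hcb⟩
  · exact absurd h.symm hab
  · obtain ⟨k, hk, -⟩ := edge_rev R (reach_lt R ha hc) hcb
    omega

theorem SC.lt {a b : ℕ} (h : SC (nb R) (dg R) a b) (ha : a < n) : b < n := reach_lt R ha h.1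

/-- The set `Z` consists of the vertices that are in components of vertices in `P`. -/
def IsAssigned (P : ℕ → Prop) (Z : Finset ℕ) : Prop :=
  ∀ y, y ∈ Z ↔ y < n ∧ ∃ a, P a ∧ SC (nb R) (dg R) y a

/-- The output consists of components, each followed by a separator, and contains exactly the
vertices in `Z`, each of them once. -/
def OutOK (Z : Finset ℕ) (out : List (Option ℕ)) : Prop :=
  ∃ comps : List (List ℕ), out = comps.flatMap (fun C => C.map some ++ [none]) ∧
    (∀ C ∈ comps, ∃ v < n, ∀ y, y ∈ C ↔ SC (nb R) (dg R) v y) ∧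
    comps.flatten.Nodup ∧ ∀ y, y ∈ comps.flatten ↔ y ∈ Z

/-- The reverse search from a vertex `v` finds its component if every vertex from which `v` can be
reached is in that component or assigned. -/
theorem reverse_search {P : ℕ → Prop} {Z Z' : Finset ℕ} {pe pe' : ℕ → ℕ × ℕ} {v : ℕ} (hv : v < n)
    (hZ : IsAssigned R P Z) (hvZ : v ∉ Z)
    (hkey : ∀ y, Reach (nb R) (dg R) y v → SC (nb R) (dg R) y v ∨ ∃ a, P a ∧ SC (nb R) (dg R) y a)
    (hd : Dfs (ih R) (idg R) (insert v Z) pe v 0 Z' pe') :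
    (∀ y, y ∈ Z' ∧ y ∉ Z ↔ SC (nb R) (dg R) v y) ∧ IsAssigned R (fun a => P a ∨ a = v) Z' := by
  have h1 : ∀ y, SC (nb R) (dg R) v y → y ∉ Z := by
    intro y hy hyZ
    obtain ⟨a, ha, hya⟩ := ((hZ y).1 hyZ).2
    exact hvZ ((hZ v).2 ⟨hv, a, ha, hy.trans hya⟩)
  have h2 : ∀ y, y ∈ Z' ∧ y ∉ Z ↔ SC (nb R) (dg R) v y := by
    intro y
    constructor
    · rintro ⟨hy, hyZ⟩
      by_cases hyv : y = v
      · exact hyv ▸ SC.refl _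
      · obtain ⟨hyn, hr⟩ := reach_of_rev R hv (hd.reach y hy (by simp [hyv, hyZ]))
        rcases hkey y hr with h | ⟨a, ha, h⟩
        · exact h.symm
        · exact absurd ((hZ y).2 ⟨hyn, a, ha, h⟩) hyZ
    · intro hy
      refine ⟨?_, h1 y hy⟩
      -- the vertices on a path from `y` to `v` are in the component, hence not avoided
      have key : ∀ b, Reach (nb R) (dg R) b v → Reach (nb R) (dg R) y b → b ∈ Z' := by
        intro b hb
        induction hb using Relation.ReflTransGen.head_induction_on with
        | refl => exact fun _ => hd.subset (Finset.mem_insert_self _ _)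
        | @head b c hbc hcv ih =>
          intro hyb
          have hb := reach_lt R (SC.lt R hy hv) hyb
          have hyc : Reach (nb R) (dg R) y c := hyb.tail hbc
          have hcZ := h1 c ⟨hy.1.trans hyc, hcv⟩
          obtain ⟨k, hk, rfl⟩ := edge_rev R hb hbc
          by_cases hc : c = v
          · subst hc; exact hd.closed.1 k (Nat.zero_le _) hk
          · exact hd.closed.2 c (ih hyc) (by simp [hc, hcZ]) k hk
      exact key y hy.2 .refl
  refine ⟨h2, fun y => ⟨fun hy => ?_, ?_⟩⟩
  · by_cases hyZ : y ∈ Z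
    · obtain ⟨a, b, c, d⟩ := (hZ y).1 hyZ
      exact ⟨a, b, .inl c, d⟩
    · have := (h2 y).1 ⟨hy, hyZ⟩
      exact ⟨SC.lt R this hv, v, .inr rfl, this.symm⟩
  · rintro ⟨hy, a, ha | rfl, hya⟩
    · exact hd.subset (Finset.mem_insert_of_mem ((hZ y).2 ⟨hy, a, ha, hya⟩))
    · exact ((h2 y).2 hya.symm).1

/-- The function gives for every vertex an edge into it, possibly from the additional vertex. -/
def IsTree (pe : ℕ → ℕ × ℕ) : Prop :=
  ∀ x < n, (pe x).1 ≤ n ∧ (pe x).2 < dg R (pe x).1 ∧ nb R (pe x).1 (pe x).2 = x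

theorem IsTree.code_lt {pe : ℕ → ℕ × ℕ} (h : IsTree R pe) {x : ℕ} (hx : x < n) :
    code R (pe x).1 (pe x).2 < 2 ^ Nat.size (idg R x) := by
  obtain ⟨a, b, c⟩ := h x hx
  have := SpaceSCC.code_lt R a b
  rwa [c] at this

/-- The number of bits inspected to decide whether the `j`th edge of `u` is a tree edge. -/
def bitCmp (pe : ℕ → ℕ × ℕ) (u j : ℕ) : ℕ :=
  agree (Nat.size (idg R (nb R u j))) (code R u j)
    (code R (pe (nb R u j)).1 (pe (nb R u j)).2)

/-- The time that the backward search spends on a vertex is a constant times this number. -/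
def bcost (pe : ℕ → ℕ × ℕ) (v : ℕ) : ℕ :=
  ∑ k ∈ Finset.Ico 0 (dg R v), (1 + bitCmp R pe v k) + Nat.size (idg R v) + 1

end Graph

namespace Lay

variable {w M : ℕ} {Λ : Lay w M} {n : ℕ} {G : Digraph (Fin n)} {R : AdjArrays G} {B : ℕ → ℕ}

/-- The state of the backward search. The variables 8, 9 and 26 have the same meaning as in the
depth-first search, but plane 0 now marks the vertices that have not been assigned. -/
structure Bwd (Λ : Lay w M) (R : AdjArrays G) (B : ℕ → ℕ) (pe : ℕ → ℕ × ℕ) (P : ℕ → Prop)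
    (u j : ℕ) (Z : Finset ℕ) (σ : St) : Prop extends Λ.Stat B σ where
  vu : σ.v 8 = u
  vj : σ.v 9 = j
  run : σ.v 26 = 1
  u_le : u ≤ n
  field : ∀ x < n, Λ.Field σ.mem x (code R (pe x).1 (pe x).2)
  unassigned : ∀ y < n, Λ.bt σ.mem (Λ.N + y) = if y ∈ Z then 0 else 1
  assigned : IsAssigned R P Z
  outok : OutOK R Z σ.out

variable {pe : ℕ → ℕ × ℕ} {P : ℕ → Prop} {Z : Finset ℕ} {u j : ℕ} {σ : St}

theorem Bwd.congr {P' : ℕ → Prop} (h : Λ.Bwd R B pe P u j Z σ) (hP : ∀ a, P' a ↔ P a) :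
    Λ.Bwd R B pe P' u j Z σ := by
  rwa [show P' = P from funext fun a => propext (hP a)]

/-- The common part of the steps along edges. -/
theorem back_edge (hΛ : Λ.For R) {t : ℕ} {Q : St → ℕ → Prop} (hT : IsTree R pe)
    (h : Λ.Bwd R B pe P u (j + 1) Z σ) (hj : j < dg R u)
    (hQ : ∀ σ' t', Λ.Bwd R B pe P u j Z σ' → σ'.v 10 = nb R u j →
      σ'.v 16 = (if code R u j = code R (pe (nb R u j)).1 (pe (nb R u j)).2 then 1 else 0) →
      t' ≤ t + 200 + 130 * bitCmp R pe u j →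
      (Sm.ite .eq (.var 16) 1
        (.asg 8 (.var 10) ;; .asg 9 (.acc .outdeg (.var 10) 0) ;;
          .ite .eq (getE (xN + .var 10)) 1 (.blk revS) .skip)
        .skip).wp R w M σ' t' (fun σ' t' => WP R w M backLoop σ' t' Q)) :
    WP R w M backLoop σ t Q := by
  have hw0 : w ≠ 0 := Λ.w_pos.ne'
  have hn := hΛ.n_eq
  have hv := nb_lt R h.u_le hj
  refine WP.wh_true trivial (by simp [hw0]) (by simp [h.run]) (WP.of_wp ?_)
  refine wp_ite (x := j + 1) (y := 0) trivial (by simp) h.vj rfl (fun hc => ?_) (fun _ => ?_)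
  · simp only [Cmp.holds] at hc; omega
  refine wp_asg_seq (a := j) ?_ ?_ (wp_seq (wp_edge hΛ (u := u) (j := j)
    (h.toVars.set (by norm_num)) ?_ ?_ fun t₁ ht₁ => ?_))
  · simp [h.vj, hw0]
  · simp [h.vj]
  · simp [h.vu]
  · simp
  have hst : Λ.Stat B (((σ.set 9 j).set 10 (nb R u j)).set 11 (code R u j)) :=
    ((h.toStat.set (by norm_num)).set (by norm_num)).set (by norm_num)
  refine wp_seq ((matchS_spec hst (v := nb R u j) (x := code R u j) (by simp) (by simp)
    (by omega) (h.field _ hv) ?_ ?_).mono ?_)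
  · rw [hΛ.l_eq _ hv]; exact code_lt R h.u_le hj
  · rw [hΛ.l_eq _ hv]; exact hT.code_lt R hv
  · rintro σ' t' ⟨b1, b2, b3, b4, b5⟩
    refine hQ σ' t' ⟨hst.fr b4 b2, ?_, ?_, ?_, h.u_le, ?_, ?_, h.assigned, ?_⟩ ?_ b1 ?_
    · rw [b4 8 (by omega)]; simp [h.vu]
    · rw [b4 9 (by omega)]; simp
    · rw [b4 26 (by omega)]; simp [h.run]
    · rw [b2]; exact h.field
    · rw [b2]; exact h.unassigned
    · rw [b3]; exact h.outok
    · rw [b4 10 (by omega)]; simp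
    · rw [hΛ.l_eq _ hv, ← bitCmp] at b5
      simp at ht₁; omega

/-- Passing an edge that is not a tree edge, backwards. -/
theorem back_skip (hΛ : Λ.For R) {t : ℕ} {Q : St → ℕ → Prop} (hT : IsTree R pe)
    (h : Λ.Bwd R B pe P u (j + 1) Z σ) (hj : j < dg R u) (hne : pe (nb R u j) ≠ (u, j))
    (hQ : ∀ σ' t', Λ.Bwd R B pe P u j Z σ' → t' ≤ t + 300 * (1 + bitCmp R pe u j) →
      WP R w M backLoop σ' t' Q) :
    WP R w M backLoop σ t Q := by
  have hw0 : w ≠ 0 := Λ.w_pos.ne'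
  have hv := nb_lt R h.u_le hj
  have hc : code R u j ≠ code R (pe (nb R u j)).1 (pe (nb R u j)).2 := by
    intro hc
    obtain ⟨a, b, c⟩ := hT _ hv
    obtain ⟨d, e⟩ := code_inj R h.u_le hj a b c.symm hc
    exact hne (Prod.ext d.symm e.symm)
  refine back_edge hΛ hT h hj fun σ' t' b1 b2 b3 b4 => ?_
  rw [if_neg hc] at b3
  refine wp_ite trivial (by simp [hw0]) b3 rfl (fun hc => absurd hc (by simp [Cmp.holds]))
    (fun _ => hQ _ _ b1 ?_)
  simp; omega

/-- Entering `v` backwards along its tree edge. Its component is output if it has not been assigned. -/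
theorem back_visit (hΛ : Λ.For R) {t v : ℕ} {Q : St → ℕ → Prop} (hT : IsTree R pe)
    (h : Λ.Bwd R B pe P u (j + 1) Z σ) (hj : j < dg R u) (hnb : nb R u j = v)
    (hpe : pe v = (u, j))
    (hkey : ∀ y, Reach (nb R) (dg R) y v →
      SC (nb R) (dg R) y v ∨ ∃ a, P a ∧ SC (nb R) (dg R) y a)
    (hQ : ∀ σ' t' Z', Λ.Bwd R B pe (fun a => P a ∨ a = v) v (dg R v) Z' σ' →
      t' + 600 * ∑ y ∈ Z, rcost R y ≤
        t + 300 * (1 + bitCmp R pe u j) + 600 * ∑ y ∈ Z', rcost R y → WP R w M backLoop σ' t' Q) :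
    WP R w M backLoop σ t Q := by
  have hw0 : w ≠ 0 := Λ.w_pos.ne'
  have hn := hΛ.n_eq
  have hnN := hΛ.n_le
  have hNN := Λ.N_le
  have hNB := Λ.NB_lt
  have hvn : v < n := hnb ▸ nb_lt R h.u_le hj
  refine back_edge hΛ hT h hj fun σ₁ t₁ b1 b2 b3 b4 => ?_
  rw [hnb, hpe, if_pos rfl] at b3
  rw [hnb] at b2
  have h7 : σ₁.v 7 = Λ.N := b1.h7
  have hst : Λ.Stat B ((σ₁.set 8 v).set 9 (dg R v)) := (b1.toStat.set (by norm_num)).set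
    (by norm_num)
  refine wp_ite trivial (by simp [hw0]) b3 rfl (fun _ => ?_) (fun hc => absurd rfl hc)
  refine wp_asg_seq (a := v) trivial b2 (wp_asg_seq (a := dg R v) ?_ ?_
    (wp_ite (x := if v ∈ Z then 0 else 1) (y := 1) ?_ ?_ ?_ rfl (fun hc => ?_) (fun hc => ?_)))
  · simp
  · simp [b2, dg, hvn.ne, value_outdeg]
  · refine safe_getE hst.toVars ?_ ?_
    · simp [h7, b2]; omega
    · simp [h7, b2]; omega
  · simp [hw0]
  · rw [eval_getE hst.toVars, ← b1.unassigned _ hvn]; simp [h7, b2]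
  · have hvZ : v ∉ Z := by
      intro hcon; simp [hcon] at hc
    have hZn : insert v Z ⊆ Finset.range n := by
      intro y hy
      rw [Finset.mem_range]
      rcases Finset.mem_insert.1 hy with rfl | hy
      · exact hvn
      · exact ((h.assigned y).1 hy).1
    obtain ⟨Z', pe', hd⟩ := Dfs.exists (nb := ih R) (dg := idg R) (F := Finset.range n)
      (fun a ha k hk => Finset.mem_range.2 (in_spec R (Finset.mem_range.1 ha) hk).1)
      (insert v Z) (fun _ => (0, 0)) v 0 hZn (Finset.mem_range.2 hvn) (Nat.zero_le _)
    obtain ⟨c1, c2⟩ := reverse_search R hvn h.assigned hvZ hkey hd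
    have hZZ : Z ⊆ Z' := (Finset.subset_insert _ _).trans hd.subset
    refine (revS_spec hΛ hst (r := v) (by simp [b2]) hvn hvZ b1.unassigned hd
      fun y hy hyZ => ?_).mono ?_
    · rw [Finset.mem_insert, not_or] at hyZ
      exact idg_pos_of_reach R hvn ((c1 y).1 ⟨hy, hyZ.2⟩).1 (Ne.symm hyZ.1)
    · rintro σ' t' ⟨l, d1, d2, d3, d4, d5, d6, d7⟩
      refine hQ σ' t' Z' ⟨d1, ?_, ?_, ?_, hvn.le, fun x hx => ?_, d2, c2, ?_⟩ ?_
      · rw [d3.var 8 (by omega)]; simp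
      · rw [d3.var 9 (by omega)]; simp
      · rw [d3.var 26 (by omega)]; simp [b1.run]
      · exact (b1.field x hx).congr (by omega) d3.mem
      · obtain ⟨comps, e1, e2, e3, e4⟩ := b1.outok
        refine ⟨comps ++ [l], ?_, ?_, ?_, ?_⟩
        · rw [d4]; simp [e1]
        · intro C hC
          rcases List.mem_append.1 hC with hC | hC
          · exact e2 C hC
          · rw [List.mem_singleton] at hC
            exact ⟨v, hvn, fun y => by rw [hC, d6, c1]⟩
        · rw [List.flatten_append, List.nodup_append]
          refine ⟨e3, by simpa using d5, ?_⟩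
          rintro a ha b hb rfl
          rw [e4] at ha
          simp only [List.flatten_cons, List.flatten_nil, List.append_nil, d6] at hb
          exact hb.2 ha
        · intro y
          simp only [List.flatten_append, List.mem_append, e4, List.flatten_cons,
            List.flatten_nil, List.append_nil, d6]
          constructor
          · rintro (a | a)
            · exact hZZ a
            · exact a.1
          · intro a
            by_cases hy : y ∈ Z
            · exact .inl hy
            · exact .inr ⟨a, hy⟩
      · simp [cost_getE] at d7; omega
  · have hvZ : v ∈ Z := by
      by_contra hcon; simp [hcon] at hc
    refine hQ _ _ Z ⟨hst, by simp, by simp, by simp [b1.run], hvn.le, b1.field, b1.unassigned,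
      fun y => ?_, b1.outok⟩ ?_
    · rw [h.assigned y]
      obtain ⟨-, a, ha, hva⟩ := (h.assigned v).1 hvZ
      constructor
      · rintro ⟨c, d, e, f⟩
        exact ⟨c, d, .inl e, f⟩
      · rintro ⟨c, d, e | rfl, f⟩
        · exact ⟨c, d, e, f⟩
        · exact ⟨c, a, ha, f.trans hva⟩
    · simp [cost_getE]; omega

/-- Leaving `v` backwards, along its tree edge. -/
theorem back_parent (hΛ : Λ.For R) {t v : ℕ} {Q : St → ℕ → Prop}
    (h : Λ.Bwd R B pe P v 0 Z σ) (hvn : v < n) (hu : u ≤ n) (hj : j < dg R u) (hnb : nb R u j = v)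
    (hpe : pe v = (u, j))
    (hQ : ∀ σ' t', Λ.Bwd R B pe P u j Z σ' → t' ≤ t + 300 * (Nat.size (idg R v) + 1) →
      WP R w M backLoop σ' t' Q) :
    WP R w M backLoop σ t Q := by
  have hw0 : w ≠ 0 := Λ.w_pos.ne'
  have h0 : σ.v 0 = n := h.h0.trans hΛ.n_eq
  have hF := h.field v hvn
  rw [hpe] at hF
  refine WP.wh_true trivial (by simp [hw0]) (by simp [h.run]) (WP.of_wp ?_)
  refine wp_ite trivial (by simp) h.vj rfl (fun _ => ?_) (fun hc => absurd rfl hc)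
  refine wp_ite trivial trivial h.vu h0 (fun hc => absurd hc hvn.ne) (fun _ => ?_)
  refine (parentS_spec hΛ h.toStat h.vu hu hj hnb hF).mono ?_
  rintro σ' t' ⟨b1, b2, b3, b4, b5, b6⟩
  refine hQ _ _ ⟨h.toStat.fr' b5 b3, b1, b2, (b5 26 (by omega)).trans h.run, hu, ?_, ?_,
    h.assigned, ?_⟩ ?_
  · rw [b3]; exact h.field
  · rw [b3]; exact h.unassigned
  · rw [b4]; exact h.outok
  · rw [hΛ.l_eq v hvn] at b6
    simp at b6; omega

/-- The backward search, by induction over the abstract counterpart of the depth-first search. The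
vertices whose components have been output are those visited later and those not yet left. -/
theorem back_spec (hΛ : Λ.For R) (hT : IsTree R pe) {vis vis' : Finset ℕ} {p p' : ℕ → ℕ × ℕ}
    (hd : Dfs (nb R) (dg R) vis p u j vis' p') {Q : St → ℕ → Prop} :
    ∀ {gray : Finset ℕ} {σ : St} {t : ℕ} {Z : Finset ℕ}, Inv (nb R) (dg R) n vis p gray u j →
    vis' ⊆ Finset.range (n + 1) → (∀ x ∈ vis', x < n → pe x = p' x) →
    Λ.Bwd R B pe (fun a => a ∉ vis' ∨ a ∈ gray) u (dg R u) Z σ →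
    (∀ σ' t' Z', Λ.Bwd R B pe (fun a => a ∉ vis ∨ a ∈ gray) u j Z' σ' →
      t' + 600 * ∑ x ∈ vis, bcost R pe x + 600 * ∑ y ∈ Z, rcost R y ≤
        t + 600 * ∑ x ∈ vis', bcost R pe x + 600 * ∑ y ∈ Z', rcost R y +
          600 * ∑ k ∈ Finset.Ico j (dg R u), (1 + bitCmp R pe u k) → WP R w M backLoop σ' t' Q) →
    WP R w M backLoop σ t Q := by
  induction hd with
  | done vis p u => exact fun _ _ _ h hQ => hQ _ _ _ h (by omega)
  | @skip vis vis' p p' u j h1 h2 h3 ih =>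
    intro gray σ t Z hI hF hpe h hQ
    refine ih (hI.skip h2) hF hpe h fun σ₁ t₁ Z₁ b1 b2 => ?_
    have hun : u ≤ n := h.u_le
    have hv := nb_lt R hun h1
    have hpv : pe (nb R u j) = p (nb R u j) := by
      rw [hpe _ (h3.subset h2) hv, h3.pe_eq _ h2]
    -- the tree edges of vertices visited before are not edges of `u` with number at least `j`
    refine back_skip hΛ hT b1 h1 (fun hc => ?_) fun σ₂ t₂ c1 c2 => hQ _ _ _ c1 ?_
    · obtain ⟨-, -, -, h5⟩ := hI.tree _ h2 hv.ne
      rw [hpv] at hc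
      rw [hc] at h5
      exact lt_irrefl _ (h5 rfl)
    · rw [Finset.sum_eq_sum_Ico_succ_bot h1]
      omega
  | @visit vis vis₁ vis' p p₁ p' u j h1 h2 h3 h4 ih1 ih2 =>
    intro gray σ t Z hI hF hpe h hQ
    have hun : u ≤ n := h.u_le
    have hv := nb_lt R hun h1
    have hI1 := h3.inv (hI.visit h1 h2)
    have hF1 : vis₁ ⊆ Finset.range (n + 1) := h4.subset.trans hF
    have hpe1 : ∀ x ∈ vis₁, x < n → pe x = p₁ x := fun x hx hxn => by
      rw [hpe x (h4.subset hx) hxn, h4.pe_eq x hx]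
    have hv1 : nb R u j ∈ vis₁ := h3.subset (Finset.mem_insert_self _ _)
    have hpv : pe (nb R u j) = (u, j) := by
      rw [hpe1 _ hv1 hv, h3.pe_eq _ (Finset.mem_insert_self _ _), Function.update_self]
    refine ih2 (hI.leave h1 h2 h3 hI1) hF hpe h fun σ₁ t₁ Z₁ b1 b2 => ?_
    refine back_visit hΛ hT b1 h1 rfl hpv (fun y hy => ?_) fun σ₂ t₂ Z₂ c1 c2 => ?_
    · refine (hI1.later hy).imp_right ?_
      rintro ⟨a, ha, hav, hag⟩
      exact ⟨a, hag.imp_right fun hag => (Finset.mem_insert.1 hag).resolve_left hav, ha⟩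
    · refine ih1 (hI.visit h1 h2) hF1 hpe1 (c1.congr fun a => ?_) fun σ₃ t₃ Z₃ d1 d2 => ?_
      · rw [Finset.mem_insert]; tauto
      · refine back_parent hΛ (d1.congr (P' := fun a => a ∉ vis ∨ a ∈ gray) fun a => ?_) hv hun h1
          rfl hpv fun σ₄ t₄ e1 e2 => hQ _ _ _ e1 ?_
        · rw [Finset.mem_insert, Finset.mem_insert]
          by_cases ha : a = nb R u j
          · simp [ha, h2]
          · simp [ha]
        · rw [Finset.sum_eq_sum_Ico_succ_bot h1]
          rw [Finset.sum_insert h2, bcost] at d2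
          omega

end Lay

/-! ### The two searches and their running time -/

/-- The search and its reversal. -/
def searchS : Sm :=
  .asg 8 xn ;; .asg 9 0 ;; .asg 26 1 ;; .blk forwardLoop ;;
  .asg 8 xn ;; .asg 9 xn ;; .asg 26 1 ;; .blk backLoop

section Sums

variable {n : ℕ} {G : Digraph (Fin n)} (R : AdjArrays G)

theorem size_le_self (d : ℕ) : Nat.size d ≤ d := Nat.size_le.2 Nat.lt_two_pow_self

theorem two_pow_size_le (d : ℕ) : 2 ^ Nat.size d ≤ 2 * d + 1 := by
  rcases Nat.eq_zero_or_pos d with rfl | hd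
  · simp
  · have h1 : 0 < Nat.size d := Nat.size_pos.2 hd
    have h2 : 2 ^ (Nat.size d - 1) ≤ d := Nat.lt_size.1 (by omega)
    obtain ⟨s, hs⟩ : ∃ s, Nat.size d = s + 1 := ⟨Nat.size d - 1, by omega⟩
    rw [hs] at h2 ⊢
    rw [pow_succ]
    simp at h2
    omega

/-- Summing over edges is the same as summing over the possible values of the fields. -/
theorem sum_edges_le (f : ℕ → ℕ → ℕ) :
    ∑ x ∈ Finset.range (n + 1), ∑ k ∈ Finset.range (dg R x), f (nb R x k) (code R x k) ≤
      ∑ v ∈ Finset.range n, ∑ c ∈ Finset.range (2 ^ Nat.size (idg R v)), f v c := by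
  rw [Finset.sum_sigma', Finset.sum_sigma']
  let φ : (_ : ℕ) × ℕ → (_ : ℕ) × ℕ := fun a => ⟨nb R a.1 a.2, code R a.1 a.2⟩
  have hinj : Set.InjOn φ ((Finset.range (n + 1)).sigma fun x => Finset.range (dg R x)) := by
    rintro ⟨u, j⟩ h ⟨u', j'⟩ h' he
    simp only [Finset.coe_sigma, Set.mem_sigma_iff, Finset.coe_range, Set.mem_Iio] at h h'
    simp only [φ, Sigma.mk.injEq, heq_eq_eq] at he
    obtain ⟨rfl, rfl⟩ := code_inj R (by omega) h.2 (by omega) h'.2 he.1 he.2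
    rfl
  rw [← Finset.sum_image (s := (Finset.range (n + 1)).sigma fun x => Finset.range (dg R x))
    (g := φ) (f := fun a : (_ : ℕ) × ℕ => f a.1 a.2) hinj]
  refine Finset.sum_le_sum_of_subset ?_
  intro a ha
  rw [Finset.mem_image] at ha
  obtain ⟨⟨u, j⟩, h, rfl⟩ := ha
  simp only [Finset.mem_sigma, Finset.mem_range] at h
  simp only [φ, Finset.mem_sigma, Finset.mem_range]
  exact ⟨nb_lt R (by omega) h.2, code_lt R (by omega) h.2⟩

theorem sum_dg : ∑ x ∈ Finset.range (n + 1), dg R x = n + numEdges G := by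
  rw [Finset.sum_range_succ, numEdges_eq_od R, dg, if_pos rfl, add_comm]
  congr 1
  refine Finset.sum_congr rfl fun x hx => ?_
  rw [dg, if_neg (Finset.mem_range.1 hx).ne]

theorem sum_size : ∑ x ∈ Finset.range n, Nat.size (idg R x) ≤ numEdges G := by
  rw [numEdges_eq_idg R]
  exact Finset.sum_le_sum fun x _ => size_le_self _

/-- The comparisons with the fields take linear time in total. -/
theorem sum_bcost_le (pe : ℕ → ℕ × ℕ) :
    ∑ x ∈ Finset.range (n + 1), bcost R pe x ≤ 6 * numEdges G + 5 * n + 1 := by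
  have h1 : ∑ x ∈ Finset.range (n + 1), ∑ k ∈ Finset.range (dg R x), bitCmp R pe x k ≤
      4 * numEdges G + 2 * n := by
    refine (sum_edges_le R fun v c => agree (Nat.size (idg R v)) c
      (code R (pe v).1 (pe v).2)).trans ?_
    calc _ ≤ ∑ v ∈ Finset.range n, (4 * idg R v + 2) := by
          refine Finset.sum_le_sum fun v _ => (sum_agree _ _).trans ?_
          have := two_pow_size_le (idg R v)
          omega
      _ = 4 * numEdges G + 2 * n := by
          rw [Finset.sum_add_distrib, ← Finset.mul_sum, ← numEdges_eq_idg R]; simp; ring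
  have h2 : ∑ x ∈ Finset.range (n + 1), Nat.size (idg R x) ≤ numEdges G := by
    have h3 : idg R n = 0 := by simp [idg, Access.value]
    rw [Finset.sum_range_succ, h3, Nat.size_zero, add_zero]
    exact sum_size R
  have h3 := sum_dg R
  simp only [bcost, Finset.sum_add_distrib, ← Finset.range_eq_Ico, Finset.sum_const,
    Finset.card_range, smul_eq_mul, mul_one]
  omega

/-- The reverse searches visit every vertex once and take linear time in total. -/
theorem sum_rcost_le : ∑ x ∈ Finset.range n, Lay.rcost R x ≤ 3 * numEdges G + n := by
  calc _ ≤ ∑ x ∈ Finset.range n, (2 * idg R x + od R x + 1) := by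
        refine Finset.sum_le_sum fun x _ => ?_
        have := size_le_self (idg R x + od R x - 2)
        rw [Lay.rcost, width]
        omega
    _ = 3 * numEdges G + n := by
        simp only [Finset.sum_add_distrib, ← Finset.mul_sum, ← numEdges_eq_idg R,
          ← numEdges_eq_od R]
        simp; ring

end Sums

namespace Lay

variable {w M : ℕ} {Λ : Lay w M} {n : ℕ} {G : Digraph (Fin n)} {R : AdjArrays G} {B : ℕ → ℕ}

theorem sum_fcost_le (hΛ : Λ.For R) : ∑ x ∈ Finset.range n, Λ.fcost R x ≤ 2 * numEdges G + n := by
  have h1 : ∑ x ∈ Finset.range n, Λ.fcost R x =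
      ∑ x ∈ Finset.range n, (od R x + Nat.size (idg R x) + 1) := by
    refine Finset.sum_congr rfl fun x hx => ?_
    rw [Finset.mem_range] at hx
    rw [fcost, hΛ.l_eq x hx, dg, if_neg hx.ne]
  have h2 := sum_size R
  have h3 := numEdges_eq_od R
  rw [h1]
  simp only [Finset.sum_add_distrib, Finset.sum_const, Finset.card_range, smul_eq_mul, mul_one]
  omega

/-- The two searches output the components in linear time, if all vertices are marked as not visited. -/
theorem searchS_spec (hΛ : Λ.For R) {σ : St} {t : ℕ} (h : Λ.Stat B σ)
    (h0 : ∀ y < n, Λ.bt σ.mem (Λ.N + y) = 0) (ho : σ.out = []) :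
    WP R w M searchS σ t fun σ' t' => OutOK R (Finset.range n) σ'.out ∧
      t' ≤ t + 10000 * (n + numEdges G) := by
  have hw0 : w ≠ 0 := Λ.w_pos.ne'
  have hn0 : σ.v 0 = n := h.h0.trans hΛ.n_eq
  have hdg : dg R n = n := if_pos rfl
  obtain ⟨vis, pe, hd⟩ := Dfs.exists (nb_closed R) {n} (fun _ => (0, 0)) n 0 (by simp) (by simp)
    (Nat.zero_le _)
  have hI : Inv (nb R) (dg R) n {n} (fun _ => (0, 0)) {n} n 0 := by
    refine ⟨subset_rfl, by simp, fun g hg => ?_, by simp, fun x hx hxn => ?_,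
      fun x hx hxn => absurd hx hxn, fun x hx hxn => absurd hx hxn⟩
    · rw [Finset.mem_singleton.1 hg]; exact .refl
    · exact absurd (Finset.mem_singleton.1 hx) hxn
  have hI' := hd.inv hI
  have hsub : vis ⊆ Finset.range (n + 1) := hd.subset_of (nb_closed R) (by simp) (by simp)
  have hvis : vis = Finset.range (n + 1) := by
    refine Finset.Subset.antisymm hsub fun x hx => ?_
    rw [Finset.mem_range] at hx
    by_cases hxn : x = n
    · subst hxn; exact hd.subset (by simp)
    · have := hd.closed.1 x (Nat.zero_le _) (by omega)
      rwa [nb, if_pos rfl] at this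
  have hT : IsTree R pe := by
    intro x hx
    obtain ⟨a, b, c, -⟩ := hI'.tree x (by rw [hvis, Finset.mem_range]; omega) hx.ne
    have := hsub c
    rw [Finset.mem_range] at this
    exact ⟨by omega, b, a⟩
  have hf := sum_fcost_le hΛ
  have hb := sum_bcost_le R pe
  have hr := sum_rcost_le R
  have hnpos := hΛ.n_pos
  apply WP.of_wp
  refine wp_asg_seq (a := n) trivial hn0 (wp_asg_seq (a := 0) ?_ rfl (wp_asg_seq (a := 1) ?_ rfl
    (wp_seq (forward_spec (B := B) hΛ hd ⟨?_, ?_, ?_, ?_, ?_, ?_, ?_, ?_⟩ ?_))))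
  · simp
  · simp [hw0]
  · exact ((h.set (by norm_num)).set (by norm_num)).set (by norm_num)
  · simp
  · simp
  · simp
  · simp
  · exact le_rfl
  · intro x hx
    simp only [St.set_mem]
    rw [h0 x hx, if_neg (by simp; omega)]
  · intro x hx hxn
    simp at hx; omega
  intro σ₁ t₁ b1 b2 b3
  rw [hdg] at b1
  have hn1 : σ₁.v 0 = n := b1.h0.trans hΛ.n_eq
  have hst1 : Λ.Stat B ((((σ₁.set 19 n).set 26 0).set 8 n).set 9 n |>.set 26 1) :=
    ((((b1.toStat.set (by norm_num)).set (by norm_num)).set (by norm_num)).set (by norm_num)).set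
      (by norm_num)
  refine WP.wh_true trivial (by simp [hw0]) (by simp [b1.run]) (WP.of_wp ?_)
  refine wp_seq (wp_ite trivial trivial b1.vu hn1 (fun _ => ?_) (fun hc => absurd rfl hc))
  refine wp_asg (a := n) trivial hn1 ?_
  refine wp_ite (x := n) (y := n) trivial trivial (by simp [b1.vj]) (by simp)
    (fun hc => absurd hc (lt_irrefl _)) (fun _ => ?_)
  refine wp_ite (x := n) (y := n) trivial trivial (by simp [b1.vu]) (by simp [hn1])
    (fun _ => ?_) (fun hc => absurd rfl hc)
  refine wp_asg (a := 0) ?_ rfl (WP.wh_false trivial ?_ ?_ ?_)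
  · simp
  · simp [hw0]
  · simp
  refine wp_asg_seq (a := n) trivial (by simp [hn1]) (wp_asg_seq (a := n) trivial (by simp [hn1])
    (wp_asg_seq (a := 1) ?_ rfl (back_spec (B := B) (Z := ∅) hΛ hT hd hI hsub (fun _ _ _ => rfl)
      ⟨hst1, ?_, ?_, ?_, ?_, ?_, ?_, ?_, ?_⟩ ?_)))
  · simp [hw0]
  · simp
  · simp [hdg]
  · simp
  · exact le_rfl
  · intro x hx
    exact b1.field x (by rw [hvis, Finset.mem_range]; omega) hx
  · intro x hx
    have := b1.visited x hx
    rw [hvis, if_pos (by rw [Finset.mem_range]; omega)] at this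
    simpa using this
  · intro y
    simp only [Finset.notMem_empty, false_iff, not_and, not_exists]
    intro hy a ha hs
    have := SC.lt R hs hy
    rw [hvis, Finset.mem_range, Finset.mem_singleton] at ha
    omega
  · refine ⟨[], ?_, by simp, by simp, by simp⟩
    simp [b2, ho]
  intro σ₂ t₂ Z c1 c2
  have hn2 : σ₂.v 0 = n := c1.h0.trans hΛ.n_eq
  have hZ : Z = Finset.range n := by
    ext y
    rw [c1.assigned y, Finset.mem_range]
    exact ⟨fun h => h.1, fun h => ⟨h, y, by tauto, SC.refl _⟩⟩
  refine WP.wh_true trivial (by simp [hw0]) (by simp [c1.run]) (WP.of_wp ?_)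
  refine wp_ite trivial (by simp) c1.vj rfl (fun _ => ?_) (fun hc => absurd rfl hc)
  refine wp_ite trivial trivial c1.vu hn2 (fun _ => ?_) (fun hc => absurd rfl hc)
  refine wp_asg (a := 0) ?_ rfl (WP.wh_false trivial ?_ ?_ ⟨?_, ?_⟩)
  · simp
  · simp [hw0]
  · simp
  · rw [← hZ]; exact c1.outok
  · have hbn : ∑ k ∈ Finset.Ico 0 (dg R n), (1 + bitCmp R pe n k) ≤ bcost R pe n := by
      rw [bcost]; omega
    rw [← Finset.range_eq_Ico] at hbn
    rw [hvis, Finset.sum_singleton, hZ, ← Finset.range_eq_Ico] at c2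
    rw [hvis, Finset.sum_singleton, Finset.sum_range_succ, hdg] at b3
    simp only [Ex.cost, Finset.sum_empty] at b3 c2 ⊢
    omega

end Lay

/-! ### Building the popcount table and counting the bits of each plane -/

/-- The popcount table. -/
def tableS : Sm :=
  .st 0 0 ;; .asg 8 1 ;;
  .wh .lt (.var 8) (.var 13)
    (.st (.var 8) (.ld (.var 8 / 2) + .var 8 % 2) ;; .asg 8 (.var 8 + 1))

/-- Clearing the counters, one for each plane. -/
def zeroS : Sm :=
  .asg 8 (.var 13) ;; .wh .lt (.var 8) xDB (.st (.var 8) 0 ;; .asg 8 (.var 8 + 1))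

/-- Counting the bits of the vertex in variable 8. -/
def countOneS : Sm :=
  .asg 14 (.acc .indeg (.var 8) 0) ;; .asg 15 (.var 13) ;; .st (.var 15) (.ld (.var 15) + 1) ;;
  .wh .lt 0 (.var 14)
    (.asg 14 (.var 14 / 2) ;; .asg 15 (.var 15 + 1) ;; .st (.var 15) (.ld (.var 15) + 1))

/-- Counting the bits in each plane. -/
def countS : Sm :=
  .asg 8 0 ;; .wh .lt (.var 8) xn (.blk countOneS ;; .asg 8 (.var 8 + 1))

/-- Replacing the counts by their prefix sums. -/
def prefixS : Sm :=
  .asg 7 0 ;; .asg 8 (.var 13) ;;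
  .wh .lt (.var 8) xDB
    (.asg 14 (.ld (.var 8)) ;; .st (.var 8) (.var 7) ;; .asg 7 (.var 7 + .var 14) ;;
      .asg 8 (.var 8 + 1))

/-- The variables 0, …, 5 and 13 are equal. -/
def FrB (σ σ' : St) : Prop := ∀ i, i < 6 ∨ i = 13 → σ'.v i = σ.v i

theorem popc_le (x : ℕ) : popc x ≤ x := by
  induction x using Nat.strong_induction_on with
  | _ x ih =>
    rcases Nat.eq_zero_or_pos x with rfl | hx
    · simp [popc_zero]
    · rw [popc_eq]
      have := ih (x / 2) (by omega)
      omega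

theorem cnt_le (l : ℕ → ℕ) (t v : ℕ) : cnt l t v ≤ v := by
  calc cnt l t v ≤ ∑ u ∈ Finset.range v, 1 := Finset.sum_le_sum fun u _ => by split <;> omega
    _ = v := by simp

section Build

variable {w M n : ℕ} {G : Digraph (Fin n)} {R : AdjArrays G}

theorem tableS_spec {σ : St} {t PB : ℕ} (hPB : σ.v 13 = PB) (h0 : 0 < PB) (hM : PB ≤ M)
    (hMw : M < 2 ^ w) (hw2 : 2 < 2 ^ w) :
    WP R w M tableS σ t fun σ' t' => (∀ x < PB, σ'.mem x = popc x) ∧ FrB σ σ' ∧ σ'.out = σ.out ∧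
      t' ≤ t + 20 * (PB + 1) := by
  have hw0 : w ≠ 0 := by rintro rfl; simp at hw2
  let Inv : ℕ → St → ℕ → Prop := fun i σ' t' => ∃ x, i + x = PB ∧ 0 < x ∧ σ'.v 8 = x ∧
    (∀ y < x, σ'.mem y = popc y) ∧ FrB σ σ' ∧ σ'.out = σ.out ∧ t' ≤ t + 10 + 20 * x
  apply WP.of_wp
  refine wp_st_seq (y := 0) (a := 0) (by simp) (by simp) rfl rfl (by omega)
    (wp_asg_seq (a := 1) (by simp [hw0]) rfl (WP.wh_count Inv ?_ ?_ ?_ (PB - 1) _ _ ?_))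
  · rintro i σ' t' ⟨x, hi, hx, h8, hm, hf, ho, ht⟩
    refine ⟨trivial, trivial, ?_⟩
    simp only [Cmp.holds, eval_var, h8, hf 13 (by omega), hPB]
    omega
  · rintro i σ' t' ⟨x, hi, hx, h8, hm, hf, ho, ht⟩
    have h1 := popc_eq x
    have h2 := popc_le x
    have h3 := hm (x / 2) (by omega)
    apply WP.of_wp
    refine wp_st_seq (y := x) (a := popc x) trivial ?_ h8 ?_ (by omega)
      (wp_asg (a := x + 1) ?_ ?_ ⟨x + 1, by omega, by omega, ?_, ?_, ?_, ho, ?_⟩)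
    · simp [h8, h3, hw2]; omega
    · simp [h8, h3]; omega
    · simp [h8, hw0]; omega
    · simp [h8]
    · simp
    · intro y hy
      by_cases hyx : y = x
      · simp [hyx]
      · simp [hyx, hm y (by omega)]
    · intro i hi
      simp [show i ≠ 8 by omega, hf i hi]
    · simp; omega
  · rintro σ' t' ⟨x, hi, hx, h8, hm, hf, ho, ht⟩
    refine ⟨fun y hy => hm y (by omega), hf, ho, ?_⟩
    simp; omega
  · refine ⟨1, by omega, by omega, by simp, ?_, ?_, rfl, ?_⟩
    · intro y hy
      obtain rfl : y = 0 := by omega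
      simp [popc_zero]
    · intro i hi
      simp [show i ≠ 8 by omega]
    · simp

theorem zeroS_spec {σ : St} {t PB DB : ℕ} (hPB : σ.v 13 = PB) (hDB : σ.v 5 = DB) (h : PB ≤ DB)
    (hM : DB ≤ M) (hMw : M < 2 ^ w) (hw2 : 2 < 2 ^ w) :
    WP R w M zeroS σ t fun σ' t' => (∀ x, PB ≤ x → x < DB → σ'.mem x = 0) ∧
      (∀ x < PB, σ'.mem x = σ.mem x) ∧ FrB σ σ' ∧ σ'.out = σ.out ∧
      t' ≤ t + 20 * (DB - PB + 1) := by
  have hw0 : w ≠ 0 := by rintro rfl; simp at hw2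
  let Inv : ℕ → St → ℕ → Prop := fun i σ' t' => ∃ x, i + x = DB ∧ PB ≤ x ∧ σ'.v 8 = x ∧
    (∀ y, PB ≤ y → y < x → σ'.mem y = 0) ∧ (∀ y < PB, σ'.mem y = σ.mem y) ∧ FrB σ σ' ∧
    σ'.out = σ.out ∧ t' ≤ t + 10 + 20 * (x - PB)
  apply WP.of_wp
  refine wp_asg_seq (a := PB) trivial hPB (WP.wh_count Inv ?_ ?_ ?_ (DB - PB) _ _ ?_)
  · rintro i σ' t' ⟨x, hi, hx, h8, hm, hm', hf, ho, ht⟩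
    refine ⟨trivial, trivial, ?_⟩
    simp only [Cmp.holds, eval_var, h8, hf 5 (by omega), hDB]
    omega
  · rintro i σ' t' ⟨x, hi, hx, h8, hm, hm', hf, ho, ht⟩
    apply WP.of_wp
    refine wp_st_seq (y := x) (a := 0) trivial ?_ h8 rfl (by omega)
      (wp_asg (a := x + 1) ?_ ?_ ⟨x + 1, by omega, by omega, ?_, ?_, ?_, ?_, ho, ?_⟩)
    · simp
    · simp [h8, hw0]; omega
    · simp [h8]
    · simp
    · intro y hy hy'
      by_cases hyx : y = x
      · simp [hyx]
      · simp [hyx, hm y hy (by omega)]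
    · intro y hy
      simp [show y ≠ x by omega, hm' y hy]
    · intro i hi
      simp [show i ≠ 8 by omega, hf i hi]
    · simp; omega
  · rintro σ' t' ⟨x, hi, hx, h8, hm, hm', hf, ho, ht⟩
    refine ⟨fun y hy hy' => hm y hy (by omega), hm', hf, ho, ?_⟩
    simp; omega
  · refine ⟨PB, by omega, by omega, by simp, ?_, fun _ _ => rfl, ?_, rfl, ?_⟩
    · intro y hy hy'; omega
    · intro i hi
      simp [show i ≠ 8 by omega]
    · simp

/-- A vertex `v` has a bit in the planes `0, …, Nat.size (idg R v)`. -/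
theorem countOneS_spec {σ : St} {t PB s v : ℕ} {c : ℕ → ℕ} (hPB : σ.v 13 = PB) (hv : σ.v 8 = v)
    (hs : Nat.size (idg R v) < s) (hM : PB + s ≤ M) (hMw : M < 2 ^ w) (hw2 : 2 < 2 ^ w)
    (hc : ∀ j < s, σ.mem (PB + j) = c j) (hcw : ∀ j, c j + 1 < 2 ^ w) :
    WP R w M countOneS σ t fun σ' t' =>
      (∀ j < s, σ'.mem (PB + j) = c j + if j ≤ Nat.size (idg R v) then 1 else 0) ∧
      (∀ x < PB, σ'.mem x = σ.mem x) ∧ FrB σ σ' ∧ σ'.v 8 = v ∧ σ'.out = σ.out ∧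
      t' ≤ t + 30 * (Nat.size (idg R v) + 1) := by
  have hw0 : w ≠ 0 := by rintro rfl; simp at hw2
  let Inv : ℕ → St → ℕ → Prop := fun i σ' t' => ∃ k, i + k = Nat.size (idg R v) ∧
    σ'.v 14 = idg R v / 2 ^ k ∧ σ'.v 15 = PB + k ∧
    (∀ j < s, σ'.mem (PB + j) = c j + if j ≤ k then 1 else 0) ∧
    (∀ x < PB, σ'.mem x = σ.mem x) ∧ FrB σ σ' ∧ σ'.v 8 = v ∧ σ'.out = σ.out ∧
    t' ≤ t + 20 + 30 * k
  apply WP.of_wp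
  refine wp_asg_seq (a := idg R v) ?_ ?_ (wp_asg_seq (a := PB) trivial ?_ (wp_st_seq (y := PB)
    (a := c 0 + 1) trivial ?_ ?_ ?_ (by omega)
    (WP.wh_count Inv ?_ ?_ ?_ (Nat.size (idg R v)) _ _ ?_)))
  · simp
  · simp [hv, value_indeg]
  · simp [hPB]
  · have := hc 0 (by omega)
    rw [add_zero] at this
    simp [hw0, this, hcw]; omega
  · simp
  · have := hc 0 (by omega)
    rw [add_zero] at this
    simp [this]
  · rintro i σ' t' ⟨k, hi, h14, h15, hm, hm', hf, h8, ho, ht⟩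
    refine ⟨by simp, trivial, ?_⟩
    simp only [Cmp.holds, eval_var, eval_num, h14]
    rw [half_pos]; omega
  · rintro i σ' t' ⟨k, hi, h14, h15, hm, hm', hf, h8, ho, ht⟩
    have hk := hm (k + 1) (by omega)
    rw [if_neg (by omega), add_zero] at hk
    apply WP.of_wp
    refine wp_asg_seq (a := idg R v / 2 ^ (k + 1)) ?_ ?_ (wp_asg_seq (a := PB + (k + 1)) ?_ ?_
      ⟨trivial, ?_, ?_, ⟨k + 1, by omega, ?_, ?_, ?_, ?_, ?_, ?_, ho, ?_⟩⟩)
    · simp [hw2]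
    · simp [h14, Nat.div_div_eq_div_mul, pow_succ]
    · simp [h15, hw0]; omega
    · simp [h15, add_assoc]
    · simp [hk, hw0, hcw]; omega
    · simp; omega
    · simp
    · simp
    · intro j hj
      by_cases hjk : j = k + 1
      · subst hjk; simp [hk]
      · have : (j ≤ k) ↔ (j ≤ k + 1) := by omega
        simp [hjk, hm j hj, this]
    · intro x hx
      simp [show x ≠ PB + (k + 1) by omega, hm' x hx]
    · intro i hi
      simp [show i ≠ 14 by omega, show i ≠ 15 by omega, hf i hi]
    · simp [h8]
    · simp; omega
  · rintro σ' t' ⟨k, hi, h14, h15, hm, hm', hf, h8, ho, ht⟩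
    obtain rfl : k = Nat.size (idg R v) := by omega
    refine ⟨hm, hm', hf, h8, ho, ?_⟩
    simp; omega
  · refine ⟨0, by simp, by simp, by simp, ?_, ?_, ?_, by simp [hv], rfl, ?_⟩
    · intro j hj
      by_cases hj0 : j = 0
      · simp [hj0]
      · simp [hj0, hc j hj]
    · intro x hx
      simp [show x ≠ PB by omega]
    · intro i hi
      simp [show i ≠ 14 by omega, show i ≠ 15 by omega]
    · simp

theorem countS_spec {σ : St} {t PB s : ℕ} (hPB : σ.v 13 = PB) (hn : σ.v 0 = n)
    (hs : ∀ v < n, Nat.size (idg R v) < s) (hM : PB + s ≤ M) (hMw : M < 2 ^ w) (hw2 : 2 < 2 ^ w)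
    (hnw : n + 1 < 2 ^ w) (hc : ∀ j < s, σ.mem (PB + j) = 0) :
    WP R w M countS σ t fun σ' t' =>
      (∀ j < s, σ'.mem (PB + j) = cnt (fun v => Nat.size (idg R v)) j n) ∧
      (∀ x < PB, σ'.mem x = σ.mem x) ∧ FrB σ σ' ∧ σ'.out = σ.out ∧
      t' ≤ t + 10 + 40 * ∑ v ∈ Finset.range n, (Nat.size (idg R v) + 1) := by
  have hw0 : w ≠ 0 := by rintro rfl; simp at hw2
  let Inv : ℕ → St → ℕ → Prop := fun i σ' t' => ∃ v, i + v = n ∧ σ'.v 8 = v ∧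
    (∀ j < s, σ'.mem (PB + j) = cnt (fun v => Nat.size (idg R v)) j v) ∧
    (∀ x < PB, σ'.mem x = σ.mem x) ∧ FrB σ σ' ∧ σ'.out = σ.out ∧
    t' ≤ t + 5 + 40 * ∑ v ∈ Finset.range v, (Nat.size (idg R v) + 1)
  apply WP.of_wp
  refine wp_asg_seq (a := 0) (by simp) rfl (WP.wh_count Inv ?_ ?_ ?_ n _ _ ?_)
  · rintro i σ' t' ⟨v, hi, h8, hm, hm', hf, ho, ht⟩
    refine ⟨trivial, trivial, ?_⟩
    simp only [Cmp.holds, eval_var, h8, hf 0 (by omega), hn]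
    omega
  · rintro i σ' t' ⟨v, hi, h8, hm, hm', hf, ho, ht⟩
    apply WP.of_wp
    refine wp_seq ((countOneS_spec (c := fun j => cnt (fun v => Nat.size (idg R v)) j v)
      ((hf 13 (by omega)).trans hPB) h8 (hs v (by omega)) hM hMw hw2 hm ?_).mono ?_)
    · intro j
      have := cnt_le (fun v => Nat.size (idg R v)) j v
      omega
    · rintro σ₁ t₁ ⟨b1, b2, b3, b4, b5, b6⟩
      refine wp_asg (a := v + 1) ?_ ?_ ⟨v + 1, by omega, by simp, fun j hj => ?_, fun x hx => ?_, ?_,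
        ?_, ?_⟩
      · simp [b4, hw0]; omega
      · simp [b4]
      · rw [cnt_succ]; exact b1 j hj
      · exact (b2 x hx).trans (hm' x hx)
      · intro i hi
        simp [show i ≠ 8 by omega, b3 i hi, hf i hi]
      · exact b5.trans ho
      · rw [Finset.sum_range_succ]
        simp at b6 ⊢; omega
  · rintro σ' t' ⟨v, hi, h8, hm, hm', hf, ho, ht⟩
    obtain rfl : v = n := by omega
    refine ⟨hm, hm', hf, ho, ?_⟩
    simp at ht ⊢; omega
  · refine ⟨0, by simp, by simp, ?_, fun _ _ => rfl, ?_, rfl, ?_⟩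
    · intro j hj
      simp [cnt, hc j hj]
    · intro i hi
      simp [show i ≠ 8 by omega]
    · simp

/-- The prefix sums are the starting positions of the planes, the last one being their total length. -/
theorem prefixS_spec {σ : St} {t PB s DB : ℕ} {l : ℕ → ℕ} (hPB : σ.v 13 = PB) (hDB : σ.v 5 = DB)
    (hs : PB + s = DB) (hM : DB ≤ M) (hMw : M < 2 ^ w) (hw2 : 2 < 2 ^ w)
    (hNw : n + ∑ v ∈ Finset.range n, l v < 2 ^ w)
    (hc : ∀ j < s, σ.mem (PB + j) = cnt l j n) :
    WP R w M prefixS σ t fun σ' t' =>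
      (∀ j < s, σ'.mem (PB + j) = off n l j) ∧ σ'.v 7 = off n l s ∧
      (∀ x < PB, σ'.mem x = σ.mem x) ∧ FrB σ σ' ∧ σ'.out = σ.out ∧ t' ≤ t + 10 + 30 * s := by
  have hw0 : w ≠ 0 := by rintro rfl; simp at hw2
  let Inv : ℕ → St → ℕ → Prop := fun i σ' t' => ∃ k, i + k = s ∧ σ'.v 8 = PB + k ∧
    σ'.v 7 = off n l k ∧ (∀ j < s, σ'.mem (PB + j) = if j < k then off n l j else cnt l j n) ∧
    (∀ x < PB, σ'.mem x = σ.mem x) ∧ FrB σ σ' ∧ σ'.out = σ.out ∧ t' ≤ t + 5 + 30 * k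
  apply WP.of_wp
  refine wp_asg_seq (a := 0) (by simp) rfl (wp_asg_seq (a := PB) trivial (by simp [hPB])
    (WP.wh_count Inv ?_ ?_ ?_ s _ _ ?_))
  · rintro i σ' t' ⟨k, hi, h8, h7, hm, hm', hf, ho, ht⟩
    refine ⟨trivial, trivial, ?_⟩
    simp only [Cmp.holds, eval_var, h8, hf 5 (by omega), hDB]
    omega
  · rintro i σ' t' ⟨k, hi, h8, h7, hm, hm', hf, ho, ht⟩
    have hk := hm k (by omega)
    rw [if_neg (lt_irrefl _)] at hk
    have h1 := off_succ n l k
    have h2 : off n l (k + 1) ≤ _ := off_le (k + 1)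
    apply WP.of_wp
    refine wp_asg_seq (a := cnt l k n) ?_ ?_ (wp_st_seq (y := PB + k) (a := off n l k) trivial
      trivial ?_ ?_ (by omega) (wp_asg_seq (a := off n l (k + 1)) ?_ ?_
      (wp_asg (a := PB + (k + 1)) ?_ ?_ ⟨k + 1, by omega, by simp, by simp, ?_, ?_, ?_, ho, ?_⟩)))
    · simp [h8]; omega
    · simp [h8, hk]
    · simp [h8]
    · simp [h7]
    · simp [h7]; omega
    · simp [h7, h1]
    · simp [h8, hw0]; omega
    · simp [h8, add_assoc]
    · intro j hj
      by_cases hjk : j = k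
      · simp [hjk]
      · have : j < k ↔ j < k + 1 := by omega
        simp [hjk, hm j hj, this]
    · intro x hx
      simp [show x ≠ PB + k by omega, hm' x hx]
    · intro i hi
      simp [show i ≠ 14 by omega, show i ≠ 7 by omega, show i ≠ 8 by omega, hf i hi]
    · simp; omega
  · rintro σ' t' ⟨k, hi, h8, h7, hm, hm', hf, ho, ht⟩
    obtain rfl : k = s := by omega
    refine ⟨fun j hj => ?_, h7, hm', hf, ho, ?_⟩
    · rw [hm j hj, if_pos hj]
    · simp; omega
  · refine ⟨0, by simp, by simp, ?_, ?_, fun _ _ => rfl, ?_, rfl, ?_⟩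
    · simp [off]
    · intro j hj
      simp [hc j hj]
    · intro i hi
      simp [show i ≠ 7 by omega, show i ≠ 8 by omega]
    · simp

end Build

/-! ### Building the planes and the rank directory -/

/-- Writing the bits of the vertex in variable 8 to the places given by the pointers. -/
def fillOneS : Sm :=
  .asg 14 (.acc .indeg (.var 8) 0) ;; .asg 15 (.var 13) ;;
  .wh .lt 0 (.var 14)
    (setS (.ld (.var 15)) 1 ;; .st (.var 15) (.ld (.var 15) + 1) ;;
      .asg 14 (.var 14 / 2) ;; .asg 15 (.var 15 + 1)) ;;
  setS (.ld (.var 15)) 0 ;; .st (.var 15) (.ld (.var 15) + 1)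

/-- Writing the bits that say which vertices have a bit in the next plane. -/
def fillS : Sm :=
  .asg 8 0 ;; .wh .lt (.var 8) xn (.blk fillOneS ;; .asg 8 (.var 8 + 1))

/-- The rank directory. Variable 9 counts the ones, and variable 10 is its value at the first chunk
of the superblock. -/
def dirS : Sm :=
  .asg 8 0 ;; .asg 9 0 ;; .asg 10 0 ;;
  .wh .lt (.var 8) xN
    (.ite .eq (.var 8 % xb) 0
      (.asg 11 (.var 8 / xb) ;; .asg 12 (xDB + 2 * (.var 11 / xg)) ;;
        .ite .eq (.var 11 % xg) 0
          (.asg 10 (.var 9) ;; .st (.var 12) (.var 9) ;; .st (.var 12 + 1) 0)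
          (.st (.var 12 + 1) (.ld (.var 12 + 1) +
            .bin .shl (.var 9 - .var 10) (.var 11 % xg * xq))))
      .skip ;;
      .asg 9 (.var 9 + getE (.var 8)) ;; .asg 8 (.var 8 + 1))

/-- Clearing the planes. -/
def clearS : Sm :=
  .asg 8 xN ;; .wh .lt (.var 8) (xN + xN) (setS (.var 8) 0 ;; .asg 8 (.var 8 + 1))

/-- The variables 0, …, 7 and 13 are equal. -/
def FrC (σ σ' : St) : Prop := ∀ i, i < 8 ∨ i = 13 → σ'.v i = σ.v i

namespace Lay

variable {w M : ℕ} {Λ : Lay w M} {n : ℕ} {G : Digraph (Fin n)} {R : AdjArrays G} {B : ℕ → ℕ}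

theorem Vars.frC {σ σ' : St} (h : Λ.Vars σ) (hf : FrC σ σ') : Λ.Vars σ' :=
  h.congr fun x hx => hf x (.inl hx)

/-- The pointers point to the positions of the bits of `v`, and afterwards to those of the next vertex. -/
theorem fillOneS_spec (hΛ : Λ.For R) {σ : St} {t PB s v : ℕ} (h : Λ.Vars σ) (hPB : σ.v 13 = PB)
    (hv : σ.v 8 = v) (hvn : v < n) (hs : Λ.l v < s) (hBB : PB + s ≤ Λ.BB)
    (hc : ∀ j < s, σ.mem (PB + j) = pos Λ.n Λ.l j v) :
    WP R w M fillOneS σ t fun σ' t' =>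
      (∀ j < s, σ'.mem (PB + j) = pos Λ.n Λ.l j (v + 1)) ∧
      (∀ x < PB, σ'.mem x = σ.mem x) ∧
      (∀ j ≤ Λ.l v, Λ.bt σ'.mem (pos Λ.n Λ.l j v) = if j < Λ.l v then 1 else 0) ∧
      (∀ p, (∀ j ≤ Λ.l v, p ≠ pos Λ.n Λ.l j v) → Λ.bt σ'.mem p = Λ.bt σ.mem p) ∧
      FrC σ σ' ∧ σ'.v 8 = v ∧ σ'.out = σ.out ∧ t' ≤ t + 100 * (Λ.l v + 1) := by
  have hw0 : w ≠ 0 := Λ.w_pos.ne'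
  have hw2 := Λ.two_lt
  have hn := hΛ.n_eq
  have hl := hΛ.l_eq v hvn
  have hBBM := Λ.BB_lt
  have hMw := Λ.M_lt
  have hNN := Λ.N_le
  have hNB := Λ.NB_lt
  have hn1 := hΛ.n_le
  have hn0 := hΛ.n_pos
  have hpos : ∀ k ≤ Λ.l v, pos Λ.n Λ.l k v < Λ.N := fun k hk => pos_lt_N (by omega) hk
  have hmem : ∀ (σ : St) (p x a : ℕ), a < PB + s → (Λ.setBit σ p x).mem a = σ.mem a :=
    fun σ p x a ha => mem_setBit σ p x (by omega)
  have hbt : ∀ (σ : St) (a x p : ℕ), a < PB + s → Λ.bt (σ.put a x).mem p = Λ.bt σ.mem p := by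
    intro σ a x p ha
    exact bit_congr (by rw [St.put_mem, if_neg]; generalize p / Λ.W = c; omega)
  let Inv : ℕ → St → ℕ → Prop := fun i σ' t' => ∃ k, i + k = Λ.l v ∧
    σ'.v 14 = idg R v / 2 ^ k ∧ σ'.v 15 = PB + k ∧
    (∀ j < s, σ'.mem (PB + j) = pos Λ.n Λ.l j v + if j < k then 1 else 0) ∧
    (∀ x < PB, σ'.mem x = σ.mem x) ∧ (∀ j < k, Λ.bt σ'.mem (pos Λ.n Λ.l j v) = 1) ∧
    (∀ p, (∀ j ≤ Λ.l v, p ≠ pos Λ.n Λ.l j v) → Λ.bt σ'.mem p = Λ.bt σ.mem p) ∧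
    FrC σ σ' ∧ σ'.v 8 = v ∧ σ'.out = σ.out ∧ t' ≤ t + 20 + 90 * k
  apply WP.of_wp
  refine wp_asg_seq (a := idg R v) ?_ ?_ (wp_asg_seq (a := PB) trivial ?_ (wp_seq
    (WP.wh_count Inv ?_ ?_ ?_ (Λ.l v) _ _ ?_)))
  · simp
  · simp [hv, value_indeg]
  · simp [hPB]
  · rintro i σ' t' ⟨k, hi, h14, h15, hm, hm', hb, hb', hf, h8, ho, ht⟩
    refine ⟨by simp, trivial, ?_⟩
    simp only [Cmp.holds, eval_var, eval_num, h14]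
    rw [half_pos, ← hl]; omega
  · rintro i σ' t' ⟨k, hi, h14, h15, hm, hm', hb, hb', hf, h8, ho, ht⟩
    have hk := hm k (by omega)
    rw [if_neg (lt_irrefl _), add_zero] at hk
    have hpk := hpos k (by omega)
    apply WP.of_wp
    refine wp_seq (wp_setS (h.frC hf) (p := pos Λ.n Λ.l k v) (y := 1) ?_ ?_ ?_ rfl (by omega)
      one_lt_two (wp_st_seq (y := PB + k) (a := pos Λ.n Λ.l k v + 1) trivial ?_ h15 ?_ (by omega)
      (wp_asg_seq (a := idg R v / 2 ^ (k + 1)) ?_ ?_ (wp_asg (a := PB + (k + 1)) ?_ ?_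
      ⟨k + 1, by omega, ?_, ?_, ?_, ?_, ?_, ?_, ?_, ?_, ho, ?_⟩))))
    · simp [h15]; omega
    · simp [hw0]
    · simp [h15, hk]
    · simp [h15, hmem _ _ _ (PB + k) (by omega), hk, hw0]; omega
    · simp [h15, hmem _ _ _ (PB + k) (by omega), hk]
    · simp [hw2]
    · simp [h14, Nat.div_div_eq_div_mul, pow_succ]
    · simp [h15, hw0]; omega
    · simp [h15, add_assoc]
    · simp
    · simp
    · intro j hj
      simp only [St.set_mem, St.put_mem, add_right_inj]
      by_cases hjk : j = k
      · simp [hjk]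
      · have : j < k ↔ j < k + 1 := by omega
        rw [if_neg hjk, hmem _ _ _ _ (by omega), hm j hj]
        simp only [this]
    · intro x hx
      simp only [St.set_mem, St.put_mem]
      rw [if_neg (by omega), hmem _ _ _ _ (by omega), hm' x hx]
    · intro j hj
      simp only [St.set_mem]
      rw [hbt _ _ _ _ (by omega), bt_setBit _ one_lt_two]
      split
      · rfl
      · rename_i hne
        refine hb j (lt_of_le_of_ne (by omega) ?_)
        rintro rfl
        exact hne rfl
    · intro p hp
      simp only [St.set_mem]
      rw [hbt _ _ _ _ (by omega), bt_setBit _ one_lt_two, if_neg (hp k (by omega))]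
      exact hb' p hp
    · intro i hi
      simp [show i ≠ 14 by omega, show i ≠ 15 by omega, hf i hi]
    · simp [h8]
    · simp; omega
  · rintro σ' t' ⟨k, hi, h14, h15, hm, hm', hb, hb', hf, h8, ho, ht⟩
    obtain rfl : k = Λ.l v := by omega
    have hk := hm (Λ.l v) (by omega)
    rw [if_neg (lt_irrefl _), add_zero] at hk
    have hpk := hpos (Λ.l v) le_rfl
    refine wp_seq (wp_setS (h.frC hf) (p := pos Λ.n Λ.l (Λ.l v) v) (y := 0) ?_ ?_ ?_ rfl (by omega)
      (by norm_num) ⟨trivial, ?_, ?_, ?_, ?_, ?_, ?_, ?_, h8, ho, ?_⟩)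
    · simp [h15]; omega
    · simp
    · simp [h15, hk]
    · simp [h15, hmem _ _ _ (PB + Λ.l v) (by omega), hk, hw0]; omega
    · simp [h15]; omega
    · intro j hj
      simp only [St.put_mem, eval_var, setBit_v, h15, add_right_inj, eval_add, eval_ld, eval_num]
      rw [hmem _ _ _ _ (by omega), hk, hmem _ _ _ _ (by omega), hm j hj]
      simp only [pos, cnt_succ]
      by_cases hjk : j = Λ.l v
      · simp [hjk]; omega
      · have : j < Λ.l v ↔ j ≤ Λ.l v := by omega
        simp only [hjk, if_false, this]
        omega
    · intro x hx
      simp only [St.put_mem, eval_var, setBit_v, h15]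
      rw [if_neg (by omega), hmem _ _ _ _ (by omega), hm' x hx]
    · intro j hj
      simp only [eval_var, setBit_v, h15]
      rw [hbt _ _ _ _ (by omega), bt_setBit _ (by norm_num)]
      by_cases hjk : j = Λ.l v
      · simp [hjk]
      · rw [if_neg, if_pos (by omega), hb j (by omega)]
        intro he
        exact hjk (pos_inj (by omega) hj (by omega) le_rfl he).1
    · intro p hp
      simp only [eval_var, setBit_v, h15]
      rw [hbt _ _ _ _ (by omega), bt_setBit _ (by norm_num), if_neg (hp _ le_rfl)]
      exact hb' p hp
    · exact hf
    · simp; omega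
  · refine ⟨0, by simp, by simp, by simp, ?_, ?_, ?_, ?_, ?_, by simp [hv], rfl, ?_⟩
    · intro j hj
      simp [hc j hj]
    · intro x hx; rfl
    · intro j hj; omega
    · intro p hp; rfl
    · intro i hi
      simp [show i ≠ 14 by omega, show i ≠ 15 by omega]
    · simp

/-- All vertices are treated in turn, the pointers moving through the planes simultaneously. -/
theorem fillS_spec (hΛ : Λ.For R) {σ : St} {t PB s : ℕ} (h : Λ.Vars σ) (hPB : σ.v 13 = PB)
    (hs : ∀ v < n, Λ.l v < s) (hBB : PB + s ≤ Λ.BB)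
    (hc : ∀ j < s, σ.mem (PB + j) = off Λ.n Λ.l j) :
    WP R w M fillS σ t fun σ' t' => (∀ x < PB, σ'.mem x = σ.mem x) ∧
      (∀ v < Λ.n, ∀ j ≤ Λ.l v, Λ.bt σ'.mem (pos Λ.n Λ.l j v) = if j < Λ.l v then 1 else 0) ∧
      FrC σ σ' ∧ σ'.out = σ.out ∧ t' ≤ t + 10 + 120 * Λ.N := by
  have hw0 : w ≠ 0 := Λ.w_pos.ne'
  have hn := hΛ.n_eq
  have hnw := hΛ.two_n_lt
  have hn0 : σ.v 0 = n := h.h0.trans hn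
  let Inv : ℕ → St → ℕ → Prop := fun i σ' t' => ∃ v, i + v = n ∧ σ'.v 8 = v ∧
    (∀ j < s, σ'.mem (PB + j) = pos Λ.n Λ.l j v) ∧ (∀ x < PB, σ'.mem x = σ.mem x) ∧
    (∀ v' < v, ∀ j ≤ Λ.l v', Λ.bt σ'.mem (pos Λ.n Λ.l j v') = if j < Λ.l v' then 1 else 0) ∧
    FrC σ σ' ∧ σ'.out = σ.out ∧ t' ≤ t + 5 + 120 * ∑ v ∈ Finset.range v, (Λ.l v + 1)
  apply WP.of_wp
  refine wp_asg_seq (a := 0) (by simp) rfl (WP.wh_count Inv ?_ ?_ ?_ n _ _ ?_)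
  · rintro i σ' t' ⟨v, hi, h8, hm, hm', hb, hf, ho, ht⟩
    refine ⟨trivial, trivial, ?_⟩
    simp only [Cmp.holds, eval_var, h8, hf 0 (by omega), hn0]
    omega
  · rintro i σ' t' ⟨v, hi, h8, hm, hm', hb, hf, ho, ht⟩
    apply WP.of_wp
    refine wp_seq ((fillOneS_spec hΛ (h.frC hf) ((hf 13 (by omega)).trans hPB) h8 (by omega)
      (hs v (by omega)) hBB hm).mono ?_)
    rintro σ₁ t₁ ⟨b1, b2, b3, b4, b5, b6, b7, b8⟩
    refine wp_asg (a := v + 1) ?_ ?_ ⟨v + 1, by omega, by simp, b1, fun x hx => ?_,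
      fun v' hv' j hj => ?_, ?_, ?_, ?_⟩
    · simp [b6, hw0]; omega
    · simp [b6]
    · exact (b2 x hx).trans (hm' x hx)
    · simp only [St.set_mem]
      by_cases hvv : v' = v
      · subst hvv; exact b3 j hj
      · rw [b4, hb v' (by omega) j hj]
        intro j' hj' he
        exact hvv (pos_inj (by omega) hj (by omega) hj' he).2
    · intro i hi
      simp [show i ≠ 8 by omega, b5 i hi, hf i hi]
    · exact b7.trans ho
    · rw [Finset.sum_range_succ]
      simp at b8 ⊢; omega
  · rintro σ' t' ⟨v, hi, h8, hm, hm', hb, hf, ho, ht⟩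
    obtain rfl : v = n := by omega
    refine ⟨hm', hn ▸ hb, hf, ho, ?_⟩
    have hN := Λ.N_eq
    rw [hn] at hN
    rw [Finset.sum_add_distrib] at ht
    simp at ht ⊢; omega
  · refine ⟨0, by simp, by simp, ?_, fun _ _ => rfl, ?_, ?_, rfl, ?_⟩
    · intro j hj
      simp [hc j hj, pos, cnt]
    · intro v hv; omega
    · intro i hi
      simp [show i ≠ 8 by omega]
    · simp

theorem clearS_spec {σ : St} {t : ℕ} (h : Λ.Stat B σ) :
    WP R w M clearS σ t fun σ' t' => Λ.Stat B σ' ∧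
      (∀ p, Λ.N ≤ p → p < 2 * Λ.N → Λ.bt σ'.mem p = 0) ∧ σ'.out = σ.out ∧
      t' ≤ t + 10 + 60 * Λ.N := by
  have hw0 : w ≠ 0 := Λ.w_pos.ne'
  have hNN := Λ.N_le
  have hNB := Λ.NB_lt
  have h7 : σ.v 7 = Λ.N := h.h7
  let Inv : ℕ → St → ℕ → Prop := fun i σ' t' => ∃ k, i + k = Λ.N ∧ σ'.v 8 = Λ.N + k ∧
    Λ.Stat B σ' ∧ (∀ p, Λ.N ≤ p → p < Λ.N + k → Λ.bt σ'.mem p = 0) ∧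
    σ'.out = σ.out ∧ t' ≤ t + 2 + 60 * k
  apply WP.of_wp
  refine wp_asg_seq (a := Λ.N) trivial h7 (WP.wh_count Inv ?_ ?_ ?_ Λ.N _ _ ?_)
  · rintro i σ' t' ⟨k, hi, h8, hst, hb, ho, ht⟩
    have h7 : σ'.v 7 = Λ.N := hst.h7
    refine ⟨trivial, by simp [h7]; omega, ?_⟩
    simp only [Cmp.holds, eval_var, eval_add, h8, h7]
    omega
  · rintro i σ' t' ⟨k, hi, h8, hst, hb, ho, ht⟩
    apply WP.of_wp
    refine wp_seq (wp_setS hst.toVars (p := Λ.N + k) (y := 0) trivial ?_ h8 rfl (by omega)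
      (by norm_num) (wp_asg (a := Λ.N + (k + 1)) ?_ ?_ ⟨k + 1, by omega, by simp,
      (hst.setBit (Nat.le_add_right _ _) (by norm_num)).set (by norm_num), ?_, ho, ?_⟩))
    · simp
    · simp [h8, hw0]; omega
    · simp [h8, add_assoc]
    · intro p hp hp'
      simp only [St.set_mem]
      rw [bt_setBit _ (by norm_num)]
      by_cases hpk : p = Λ.N + k
      · simp [hpk]
      · rw [if_neg hpk]; exact hb p hp (by omega)
    · simp; omega
  · rintro σ' t' ⟨k, hi, h8, hst, hb, ho, ht⟩
    refine ⟨hst, fun p hp hp' => hb p hp (by omega), ho, ?_⟩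
    simp; omega
  · refine ⟨0, by simp, by simp, h.set (by norm_num), ?_, rfl, ?_⟩
    · intro p hp hp'; omega
    · simp

/-- A field appended to a packed word. -/
theorem field_append {P δ a q : ℕ} (hP : P < 2 ^ (a * q)) (hδ : δ < 2 ^ q) :
    P + δ * 2 ^ (a * q) < 2 ^ ((a + 1) * q) ∧ (P + δ * 2 ^ (a * q)) / 2 ^ (a * q) % 2 ^ q = δ ∧
    ∀ a' < a, (P + δ * 2 ^ (a * q)) / 2 ^ (a' * q) % 2 ^ q = P / 2 ^ (a' * q) % 2 ^ q := by
  have hp : 0 < 2 ^ (a * q) := by positivity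
  refine ⟨?_, ?_, fun a' ha => ?_⟩
  · calc P + δ * 2 ^ (a * q) < 2 ^ (a * q) + δ * 2 ^ (a * q) := by omega
      _ = (δ + 1) * 2 ^ (a * q) := by ring
      _ ≤ 2 ^ q * 2 ^ (a * q) := Nat.mul_le_mul_right _ hδ
      _ = 2 ^ ((a + 1) * q) := by rw [← pow_add]; congr 1; ring
  · rw [Nat.add_mul_div_right _ _ hp, Nat.div_eq_of_lt hP, zero_add, Nat.mod_eq_of_lt hδ]
  · obtain ⟨d, rfl⟩ := Nat.exists_eq_add_of_lt ha
    have : δ * 2 ^ ((a' + d + 1) * q) = δ * 2 ^ (d * q) * 2 ^ q * 2 ^ (a' * q) := by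
      rw [mul_assoc, mul_assoc, ← pow_add, ← pow_add]; congr 2; ring
    rw [this, Nat.add_mul_div_right _ _ (by positivity), Nat.add_mul_mod_self_right]

/-- The directory after the bits before `p` have been counted. -/
structure DirInv (Λ : Lay w M) (S : ℕ → ℕ) (m : ℕ → ℕ) (p base : ℕ) : Prop where
  all : ∀ c, c * Λ.b < p → m (Λ.DB + 2 * (c / Λ.g)) +
    m (Λ.DB + 2 * (c / Λ.g) + 1) / 2 ^ (c % Λ.g * Λ.q) % 2 ^ Λ.q = S (c * Λ.b)
  last : 0 < p → ∀ c, c = (p - 1) / Λ.b → m (Λ.DB + 2 * (c / Λ.g)) = base ∧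
    base = S (c / Λ.g * Λ.g * Λ.b) ∧ m (Λ.DB + 2 * (c / Λ.g) + 1) < 2 ^ ((c % Λ.g + 1) * Λ.q)

variable {S m m' : ℕ → ℕ} {p c base : ℕ}

/-- A position inside a chunk. -/
theorem DirInv.inner (h : Λ.DirInv S m p base) (hp : p % Λ.b ≠ 0) :
    Λ.DirInv S m (p + 1) base where
  all c hc := by
    refine h.all c (lt_of_le_of_ne (by omega) ?_)
    rintro rfl
    exact hp (Nat.mul_mod_left _ _)
  last _ c hc := by
    have hp0 : 0 < p := by
      rcases Nat.eq_zero_or_pos p with rfl | h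
      · simp at hp
      · exact h
    refine h.last hp0 c ?_
    rw [hc]
    obtain ⟨p', rfl⟩ : ∃ p', p = p' + 1 := ⟨p - 1, by omega⟩
    simp only [Nat.add_sub_cancel]
    rw [Nat.succ_div, if_neg, add_zero]
    rwa [Nat.dvd_iff_mod_eq_zero]

/-- The beginning of the first chunk of a superblock. -/
theorem DirInv.first (h : Λ.DirInv S m p base) (hp : p = c * Λ.b) (hc : c % Λ.g = 0)
    (h1 : m' (Λ.DB + 2 * (c / Λ.g)) = S p) (h2 : m' (Λ.DB + 2 * (c / Λ.g) + 1) = 0)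
    (hm : ∀ a, a ≠ Λ.DB + 2 * (c / Λ.g) → a ≠ Λ.DB + 2 * (c / Λ.g) + 1 → m' a = m a) :
    Λ.DirInv S m' (p + 1) (S p) where
  all c' hc' := by
    by_cases hcc : c' = c
    · subst hcc
      rw [h1, h2, hp]; simp
    · have hlt : c' * Λ.b < p := lt_of_le_of_ne (by omega) fun he => hcc
        (Nat.eq_of_mul_eq_mul_right Λ.b_pos (he.trans hp))
      have hc1 : c' < c := by
        rw [hp] at hlt
        exact lt_of_mul_lt_mul_right hlt (Nat.zero_le _)
      have hgg : c' / Λ.g < c / Λ.g := by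
        rw [Nat.div_lt_iff_lt_mul Λ.g_pos, Nat.div_mul_cancel (Nat.dvd_of_mod_eq_zero hc)]
        exact hc1
      rw [hm _ (by omega) (by omega), hm _ (by omega) (by omega), h.all c' hlt]
  last _ c' hc' := by
    obtain rfl : c' = c := by
      rw [hc', hp, Nat.add_sub_cancel, Nat.mul_div_cancel _ Λ.b_pos]
    refine ⟨h1, ?_, ?_⟩
    · rw [Nat.div_mul_cancel (Nat.dvd_of_mod_eq_zero hc), hp]
    · rw [h2]; positivity

/-- The beginning of another chunk: the ones counted in the superblock so far are stored in the next
field of the second word. They are fewer than `2 ^ q`, and the `g` fields fit into a word. -/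
theorem DirInv.next (h : Λ.DirInv S m p base) (hp : p = c * Λ.b) (hc : c % Λ.g ≠ 0)
    (hS : Monotone S) (hS' : ∀ x y, S (x + y) ≤ S x + y) (hgb : Λ.g * Λ.b < 2 ^ Λ.q) :
    base ≤ S p ∧ m (Λ.DB + 2 * (c / Λ.g) + 1) + (S p - base) * 2 ^ (c % Λ.g * Λ.q) < 2 ^ w ∧
    ∀ m' : ℕ → ℕ, m' (Λ.DB + 2 * (c / Λ.g) + 1) =
      m (Λ.DB + 2 * (c / Λ.g) + 1) + (S p - base) * 2 ^ (c % Λ.g * Λ.q) →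
    (∀ a, a ≠ Λ.DB + 2 * (c / Λ.g) + 1 → m' a = m a) → Λ.DirInv S m' (p + 1) base := by
  have hg := Λ.g_pos
  have hb := Λ.b_pos
  obtain ⟨c₀, rfl⟩ : ∃ c₀, c = c₀ + 1 := ⟨c - 1, by
    have : c ≠ 0 := by rintro rfl; simp at hc
    omega⟩
  have hp0 : 0 < p := by rw [hp]; positivity
  have hdiv : (c₀ + 1) / Λ.g = c₀ / Λ.g := by
    rw [Nat.succ_div, if_neg, add_zero]
    rwa [Nat.dvd_iff_mod_eq_zero]
  have hmod : (c₀ + 1) % Λ.g = c₀ % Λ.g + 1 := by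
    have h1 := Nat.div_add_mod (c₀ + 1) Λ.g
    have h2 := Nat.div_add_mod c₀ Λ.g
    rw [hdiv] at h1
    omega
  have hc0 : c₀ = (p - 1) / Λ.b := by
    symm
    rw [hp, Nat.div_eq_iff hb]
    have : (c₀ + 1) * Λ.b = c₀ * Λ.b + Λ.b := by ring
    omega
  obtain ⟨l1, l2, l3⟩ := h.last hp0 c₀ hc0
  rw [← hmod, ← hdiv] at l3
  rw [← hdiv] at l1 l2
  have hpc : p = (c₀ + 1) / Λ.g * Λ.g * Λ.b + (c₀ + 1) % Λ.g * Λ.b := by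
    rw [← add_mul, Nat.div_add_mod', hp]
  have hle : base ≤ S p := by
    rw [l2]; exact hS (by omega)
  have hδ : S p - base < 2 ^ Λ.q := by
    have h1 := hS' ((c₀ + 1) / Λ.g * Λ.g * Λ.b) ((c₀ + 1) % Λ.g * Λ.b)
    rw [← hpc, ← l2] at h1
    have h2 : (c₀ + 1) % Λ.g * Λ.b ≤ Λ.g * Λ.b :=
      Nat.mul_le_mul_right _ (Nat.mod_lt _ hg).le
    omega
  obtain ⟨f1, f2, f3⟩ := field_append l3 hδ
  refine ⟨hle, f1.trans_le (Nat.pow_le_pow_right (by norm_num) ?_), fun m' h1 hm => ⟨?_, ?_⟩⟩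
  · calc ((c₀ + 1) % Λ.g + 1) * Λ.q ≤ Λ.g * Λ.q := Nat.mul_le_mul_right _ (Nat.mod_lt _ hg)
      _ ≤ w := Λ.gq_le
  · intro c' hc'
    by_cases hcc : c' = c₀ + 1
    · subst hcc
      rw [h1, f2, hm _ (by omega), l1, ← hp]; omega
    · have hlt : c' * Λ.b < p := lt_of_le_of_ne (by omega) fun he => hcc
        (Nat.eq_of_mul_eq_mul_right Λ.b_pos (he.trans hp))
      have hc1 : c' < c₀ + 1 := by
        rw [hp] at hlt
        exact lt_of_mul_lt_mul_right hlt (Nat.zero_le _)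
      rw [← h.all c' hlt]
      by_cases hgg : c' / Λ.g = (c₀ + 1) / Λ.g
      · have hcm : c' % Λ.g < (c₀ + 1) % Λ.g := by
          have h1 := Nat.div_add_mod c' Λ.g
          have h2 := Nat.div_add_mod (c₀ + 1) Λ.g
          rw [hgg] at h1
          omega
        rw [hgg, h1, f3 _ hcm, hm _ (by omega)]
      · rw [hm _ (by omega), hm _ (by omega)]
  · intro _ c' hc'
    obtain rfl : c' = c₀ + 1 := by
      rw [hc', hp, Nat.add_sub_cancel, Nat.mul_div_cancel _ Λ.b_pos]
    exact ⟨by rw [hm _ (by omega), l1], l2, by rw [h1]; exact f1⟩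

/-- The directory is built in one pass over the first array. -/
theorem dirS_spec {σ : St} {t : ℕ} (h : Λ.Vars σ) (hgb : Λ.g * Λ.b < 2 ^ Λ.q)
    (htab : ∀ x < 2 ^ Λ.b, σ.mem x = popc x)
    (hB : ∀ v < Λ.n, ∀ t ≤ Λ.l v,
      Λ.bt σ.mem (pos Λ.n Λ.l t v) = if t < Λ.l v then 1 else 0) :
    WP R w M dirS σ t fun σ' t' => Λ.Stat (Λ.bt σ.mem) σ' ∧ σ'.out = σ.out ∧
      t' ≤ t + 10 + 150 * Λ.N := by
  have hw0 : w ≠ 0 := Λ.w_pos.ne'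
  have hw2 := Λ.two_lt
  have hNN := Λ.N_le
  have hNB := Λ.NB_lt
  have hBBM := Λ.BB_lt
  have hMw := Λ.M_lt
  have htl := Λ.tab_le
  set S : ℕ → ℕ := fun p => ∑ i ∈ Finset.range p, Λ.bt σ.mem i with hSdef
  have hS : Monotone S := monotone_nat_of_le_succ fun p => by
    simp only [hSdef, Finset.sum_range_succ]; omega
  have hS1 : ∀ p, S (p + 1) = S p + Λ.bt σ.mem p := fun p => Finset.sum_range_succ _ _
  have hS' : ∀ x y, S (x + y) ≤ S x + y := by
    intro x y
    induction y with
    | zero => simp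
    | succ y ih =>
      rw [← add_assoc, hS1]
      have : Λ.bt σ.mem (x + y) < 2 := bit_lt _ _ _ _
      omega
  have hSle : ∀ p, S p ≤ p := fun p => by
    have := hS' 0 p
    simp only [zero_add] at this
    have h0 : S 0 = 0 := by simp [hSdef]
    omega
  let Inv : ℕ → St → ℕ → Prop := fun i σ' t' => ∃ p, i + p = Λ.N ∧ σ'.v 8 = p ∧ σ'.v 9 = S p ∧
    Λ.DirInv S σ'.mem p (σ'.v 10) ∧ (∀ a, a < Λ.DB ∨ Λ.BB ≤ a → σ'.mem a = σ.mem a) ∧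
    (∀ x < 8, σ'.v x = σ.v x) ∧ σ'.out = σ.out ∧ t' ≤ t + 6 + 150 * p
  have hbt : ∀ {m' : ℕ → ℕ}, (∀ a, a < Λ.DB ∨ Λ.BB ≤ a → m' a = σ.mem a) →
      ∀ p, Λ.bt m' p = Λ.bt σ.mem p := fun hm p => bit_congr (hm _ (.inr (Nat.le_add_right _ _)))
  have key : ∀ (p : ℕ) (σ₁ : St) (t₁ : ℕ), p < Λ.N → σ₁.v 8 = p → σ₁.v 9 = S p →
      Λ.DirInv S σ₁.mem (p + 1) (σ₁.v 10) →
      (∀ a, a < Λ.DB ∨ Λ.BB ≤ a → σ₁.mem a = σ.mem a) → (∀ x < 8, σ₁.v x = σ.v x) →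
      σ₁.out = σ.out → t₁ ≤ t + 90 + 150 * p →
      (Sm.asg 9 (.var 9 + getE (.var 8)) ;; .asg 8 (.var 8 + 1)).wp R w M σ₁ t₁
        (Inv (Λ.N - (p + 1))) := by
    intro p σ₁ t₁ hp h8 h9 hd hm hv ho ht
    have hV := h.congr hv
    have hsafe : (getE (.var 8)).safe R w M σ₁ := safe_getE hV trivial (by simp [h8]; omega)
    have hle := hSle (p + 1)
    rw [hS1] at hle
    refine wp_asg_seq (a := S (p + 1)) ?_ ?_ (wp_asg (a := p + 1) ?_ ?_ ⟨p + 1, by omega, by simp,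
      by simp, ?_, hm, ?_, ho, ?_⟩)
    · simp [h8, h9, hsafe, eval_getE hV, hbt hm]; omega
    · simp [h8, h9, eval_getE hV, hbt hm, hS1]
    · simp [h8, hw0]; omega
    · simp [h8]
    · simpa using hd
    · intro x hx
      simp [show x ≠ 8 by omega, show x ≠ 9 by omega, hv x hx]
    · simp [cost_getE]; omega
  apply WP.of_wp
  refine wp_asg_seq (a := 0) (by simp) rfl (wp_asg_seq (a := 0) (by simp) rfl
    (wp_asg_seq (a := 0) (by simp) rfl (WP.wh_count Inv ?_ ?_ ?_ Λ.N _ _ ?_)))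
  · rintro i σ' t' ⟨p, hi, h8, h9, hd, hm, hv, ho, ht⟩
    refine ⟨trivial, trivial, ?_⟩
    simp only [Cmp.holds, eval_var, h8, hv 7 (by omega), h.h7]
    omega
  · rintro i σ' t' ⟨p, hi, h8, h9, hd, hm, hv, ho, ht⟩
    have hV := h.congr hv
    have hpN : p < Λ.N := by omega
    obtain rfl : i = Λ.N - (p + 1) := by omega
    apply WP.of_wp
    refine wp_seq (wp_ite (x := p % Λ.b) (y := 0) (by simp) (by simp) (by simp [h8, hV.h2]) rfl
      (fun hc => ?_) (fun hc => ?_))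
    · simp only [Cmp.holds] at hc
      set c := p / Λ.b with hcdef
      have hpc : p = c * Λ.b := (Nat.div_mul_cancel (Nat.dvd_of_mod_eq_zero hc)).symm
      have hdl := Λ.dir_lt hpN.le
      rw [← hcdef] at hdl
      refine wp_asg_seq (a := c) (by simp) (by simp [h8, hV.h2, hcdef])
        (wp_asg_seq (a := Λ.DB + 2 * (c / Λ.g)) ?_ ?_
        (wp_ite (x := c % Λ.g) (y := 0) (by simp) (by simp) (by simp [hV.h3]) rfl (fun hg => ?_)
          (fun hg => ?_)))
      · simp [hV.h3, hV.h5, hw2]; omega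
      · simp [hV.h3, hV.h5]
      · simp only [Cmp.holds] at hg
        refine wp_asg_seq (a := S p) trivial (by simp [h9]) (wp_st_seq
          (y := Λ.DB + 2 * (c / Λ.g)) (a := S p) trivial trivial (by simp) (by simp [h9])
          (by omega) ⟨?_, ?_, ?_, key p _ _ hpN ?_ ?_ ?_ ?_ ?_ ho ?_⟩)
        · simp [hw0]; omega
        · simp
        · simp; omega
        · simp [h8]
        · simp [h9]
        · have := hd.first hpc hg (m' := fun a => if a = Λ.DB + 2 * (c / Λ.g) + 1 then 0 else
            if a = Λ.DB + 2 * (c / Λ.g) then S p else σ'.mem a) (by simp) (by simp)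
            (fun a h1 h2 => by simp [h1, h2])
          convert this using 1
          · funext a; simp
          · simp
        · intro a ha
          simp [show a ≠ Λ.DB + 2 * (c / Λ.g) + 1 by omega,
            show a ≠ Λ.DB + 2 * (c / Λ.g) by omega, hm a ha]
        · intro x hx
          simp [show x ≠ 10 by omega, show x ≠ 11 by omega, show x ≠ 12 by omega, hv x hx]
        · simp; omega
      · simp only [Cmp.holds] at hg
        obtain ⟨n1, n2, n3⟩ := hd.next hpc hg hS hS' hgb
        have hgq : c % Λ.g * Λ.q < 2 ^ w := by
          calc _ ≤ Λ.g * Λ.q := Nat.mul_le_mul_right _ (Nat.mod_lt _ Λ.g_pos).le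
            _ ≤ w := Λ.gq_le
            _ < 2 ^ w := Nat.lt_two_pow_self
        refine ⟨?_, ?_, ?_, key p _ _ hpN ?_ ?_ ?_ ?_ ?_ ho ?_⟩
        · simp [hw0]; omega
        · simp [hw0, hV.h3, hV.h4, h9, n1, hgq]; omega
        · simp; omega
        · simp [h8]
        · simp [h9]
        · have := n3 (fun a => if a = Λ.DB + 2 * (c / Λ.g) + 1 then
            σ'.mem (Λ.DB + 2 * (c / Λ.g) + 1) + (S p - σ'.v 10) * 2 ^ (c % Λ.g * Λ.q)
            else σ'.mem a) (by simp) (fun a ha => by simp [ha])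
          convert this using 1
          · funext a; simp [hV.h3, hV.h4, h9]
          · simp
        · intro a ha
          simp [show a ≠ Λ.DB + 2 * (c / Λ.g) + 1 by omega, hm a ha]
        · intro x hx
          simp [show x ≠ 11 by omega, show x ≠ 12 by omega, hv x hx]
        · simp; omega
    · exact key p _ _ hpN h8 h9 (hd.inner hc) hm hv ho (by simp; omega)
  · rintro σ' t' ⟨p, hi, h8, h9, hd, hm, hv, ho, ht⟩
    obtain rfl : p = Λ.N := by omega
    refine ⟨⟨h.congr hv, fun x hx => ?_, hd.all, fun p _ => hbt hm p, hB⟩, ho, ?_⟩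
    · rw [hm x (.inl (by omega)), htab x hx]
    · simp; omega
  · refine ⟨0, by simp, by simp, by simp [hSdef], ⟨fun c hc => by omega, fun hc => by omega⟩,
      fun _ _ => rfl, ?_, rfl, ?_⟩
    · intro x hx
      simp [show x ≠ 8 by omega, show x ≠ 9 by omega, show x ≠ 10 by omega]
    · simp

end Lay

/-! ### The parameters of the layout -/

/-- Variable `y` becomes the length of the binary representation of variable 8. -/
def sizeS (y : ℕ) : Sm :=
  .asg y 0 ;; .wh .lt 0 (.var 8) (.asg 8 (.var 8 / 2) ;; .asg y (.var y + 1))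

/-- Computing the parameters. -/
def paramS : Sm :=
  .asg 0 .nv ;; .asg 8 .nv ;; .blk (sizeS 9) ;; .asg 8 (.var 9) ;; .blk (sizeS 10) ;;
  .asg 11 (.var 9 / 2 + 2) ;; .asg 12 (.wl / .var 11 + 1) ;; .asg 2 (.wl / .var 12) ;;
  .asg 1 (.var 12 * .var 2) ;; .asg 3 (.var 9 / .var 10) ;; .asg 4 (.var 10 + .var 10) ;;
  .asg 13 (.bin .shl 1 (.var 2)) ;; .asg 5 (.var 13 + .var 9 + 2)

/-- Building the data structures. -/
def buildS : Sm :=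
  .blk paramS ;; .blk tableS ;; .blk zeroS ;; .blk countS ;; .blk prefixS ;;
  .asg 6 (xDB + 2 * (xN / xb / xg) + 2) ;; .blk fillS ;; .blk dirS ;; .blk clearS

/-- The whole algorithm. -/
def mainS : Sm := .blk buildS ;; .blk searchS

/-- The number of chunks in a word: slightly more than `w / h` for an `h` slightly more than half
the length of `n`. -/
def chunks (n w : ℕ) : ℕ := w / (Nat.size n / 2 + 2) + 1

/-- The number of bits of a chunk. -/
def chunk (n w : ℕ) : ℕ := w / chunks n w

section Params

variable {n w : ℕ}

theorem size_pos_of_pos (hn : 0 < n) : 0 < Nat.size n := Nat.size_pos.2 hn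

theorem two_pow_size_le_two_mul (hn : 0 < n) : 2 ^ Nat.size n ≤ 2 * n := by
  have h1 := size_pos_of_pos hn
  have h2 : 2 ^ (Nat.size n - 1) ≤ n := Nat.lt_size.1 (by omega)
  calc 2 ^ Nat.size n = 2 * 2 ^ (Nat.size n - 1) := by
        rw [← pow_succ']; congr 1; omega
    _ ≤ 2 * n := by omega

theorem chunks_le (hw : 2 * Nat.size n + 10 ≤ w) : chunks n w ≤ w := by
  have h1 : w / (Nat.size n / 2 + 2) ≤ w / 2 := Nat.div_le_div_left (by omega) (by norm_num)
  rw [chunks]; omega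

theorem two_le_chunks (hw : 2 * Nat.size n + 10 ≤ w) : 2 ≤ chunks n w := by
  have h1 : 0 < w / (Nat.size n / 2 + 2) := Nat.div_pos (by omega) (by omega)
  rw [chunks]; omega

theorem chunk_pos (hw : 2 * Nat.size n + 10 ≤ w) : 0 < chunk n w :=
  Nat.div_pos (chunks_le hw) (by have := two_le_chunks hw; omega)

/-- A table for all chunks has `O(√n)` entries. -/
theorem chunk_le : chunk n w ≤ Nat.size n / 2 + 1 := by
  refine Nat.lt_succ_iff.1 ?_
  rw [chunk, Nat.div_lt_iff_lt_mul (show 0 < chunks n w from Nat.succ_pos _), chunks]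
  exact Nat.lt_mul_div_succ w (by omega)

/-- Chunks are long enough for a directory of `O(N log log n / (log n)²)` words. -/
theorem size_le_chunk (hw : 2 * Nat.size n + 10 ≤ w) : Nat.size n ≤ 4 * chunk n w := by
  have h1 : (Nat.size n / 2 + 2) / 2 ≤ chunk n w := by
    rw [chunk, Nat.le_div_iff_mul_le (show 0 < chunks n w from Nat.succ_pos _), chunks, mul_add, mul_one]
    have h2 := Nat.mul_div_le w (Nat.size n / 2 + 2)
    have h3 : (Nat.size n / 2 + 2) / 2 * (w / (Nat.size n / 2 + 2)) * 2 ≤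
        (Nat.size n / 2 + 2) * (w / (Nat.size n / 2 + 2)) := by
      rw [mul_right_comm]
      exact Nat.mul_le_mul_right _ (Nat.div_mul_le_self _ _)
    omega
  omega

theorem chunk_lt (hw : 2 * Nat.size n + 10 ≤ w) : chunk n w < w :=
  Nat.div_lt_self (by omega) (two_le_chunks hw)

theorem two_pow_chunk_le (hn : 0 < n) : 2 ^ chunk n w ≤ 2 * n := by
  have h1 := chunk_le (n := n) (w := w)
  have h2 := size_pos_of_pos hn
  exact (Nat.pow_le_pow_right (by norm_num) (by omega)).trans (two_pow_size_le_two_mul hn)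

end Params

section Layout

variable {n : ℕ} {G : Digraph (Fin n)} (R : AdjArrays G) (w : ℕ)

/-- The number of bits of each of the two bit arrays of the fields. -/
def fieldBits : ℕ := n + ∑ v ∈ Finset.range n, Nat.size (idg R v)

/-- The number of bits of the bit array. -/
def arrayBits : ℕ := 2 * fieldBits R + ∑ v ∈ Finset.range n, width R v

/-- Where the directory starts. -/
def dirStart (n w : ℕ) : ℕ := 2 ^ chunk n w + Nat.size n + 2

/-- Where the bit array starts. -/
def arrayStart : ℕ :=
  dirStart n w + 2 * (fieldBits R / chunk n w / (Nat.size n / Nat.size (Nat.size n))) + 2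

/-- The number of words of memory used. -/
def memWords : ℕ := arrayStart R w + arrayBits R / (chunks n w * chunk n w) + 1

theorem arrayStart_lt : arrayStart R w < memWords R w := by
  rw [memWords]
  generalize arrayBits R / (chunks n w * chunk n w) = q
  omega

theorem dirStart_lt : dirStart n w +
    2 * (fieldBits R / chunk n w / (Nat.size n / Nat.size (Nat.size n))) + 1 < arrayStart R w := by
  rw [arrayStart]
  exact Nat.lt_succ_self _

theorem size_idg_le (v : ℕ) : Nat.size (idg R v) ≤ Nat.size n := Nat.size_le_size (idg_le R v)

theorem width_le (v : ℕ) : width R v ≤ Nat.size n + 1 := by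
  rw [width, Nat.size_le]
  have h1 := idg_le R v
  have h2 := od_le R v
  have h3 := Nat.lt_size_self n
  rw [pow_succ]
  omega

theorem fieldBits_le : fieldBits R ≤ n * (Nat.size n + 1) := by
  have : ∑ v ∈ Finset.range n, Nat.size (idg R v) ≤ n * Nat.size n := by
    calc _ ≤ ∑ v ∈ Finset.range n, Nat.size n := Finset.sum_le_sum fun v _ => size_idg_le R v
      _ = _ := by simp
  rw [fieldBits, mul_add, mul_one]; omega

theorem arrayBits_le : arrayBits R ≤ 3 * (n * (Nat.size n + 1)) := by
  have h1 : ∑ v ∈ Finset.range n, width R v ≤ n * (Nat.size n + 1) := by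
    calc _ ≤ ∑ v ∈ Finset.range n, (Nat.size n + 1) := Finset.sum_le_sum fun v _ => width_le R v
      _ = _ := by simp
  have h2 := fieldBits_le R
  rw [arrayBits]; omega

variable {w}

theorem size_mul_le (n : ℕ) : n * (Nat.size n + 1) ≤ 2 ^ (2 * Nat.size n) := by
  have h1 := Nat.lt_size_self n
  have h2 : Nat.size n + 1 ≤ 2 ^ Nat.size n := Nat.lt_two_pow_self
  rw [two_mul, pow_add]
  exact Nat.mul_le_mul h1.le h2

/-- Addresses fit into words, because `w` exceeds `2 log n` by a constant. -/
theorem memWords_lt (hn : 0 < n) (hw : 2 * Nat.size n + 10 ≤ w) : memWords R w < 2 ^ w := by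
  have h1 := fieldBits_le R
  have h2 := arrayBits_le R
  have h3 := two_pow_chunk_le (w := w) hn
  have h4 := size_mul_le n
  have h5 : fieldBits R / chunk n w / (Nat.size n / Nat.size (Nat.size n)) ≤ fieldBits R :=
    (Nat.div_le_self _ _).trans (Nat.div_le_self _ _)
  have h6 : arrayBits R / (chunks n w * chunk n w) ≤ arrayBits R := Nat.div_le_self _ _
  have h7 : n ≤ n * (Nat.size n + 1) := Nat.le_mul_of_pos_right _ (by omega)
  have h8 : Nat.size n ≤ n := size_le_self n
  have h9 : 2 ^ (2 * Nat.size n) * 2 ^ 10 ≤ 2 ^ w := by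
    rw [← pow_add]; exact Nat.pow_le_pow_right (by norm_num) hw
  rw [memWords, arrayStart, dirStart]
  omega

theorem arrayBits_lt (hn : 0 < n) (hw : 2 * Nat.size n + 10 ≤ w) : arrayBits R < 2 ^ w := by
  have h2 := arrayBits_le R
  have h4 := size_mul_le n
  have h7 : n ≤ n * (Nat.size n + 1) := Nat.le_mul_of_pos_right _ (by omega)
  have h9 : 2 ^ (2 * Nat.size n) * 2 ^ 10 ≤ 2 ^ w := by
    rw [← pow_add]; exact Nat.pow_le_pow_right (by norm_num) hw
  omega

/-- The layout. -/
def layout (hn : 0 < n) (hw : 2 * Nat.size n + 10 ≤ w) : Lay w (memWords R w) where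
  n := n
  l v := Nat.size (idg R v)
  W := chunks n w * chunk n w
  b := chunk n w
  r := chunks n w
  g := Nat.size n / Nat.size (Nat.size n)
  q := 2 * Nat.size (Nat.size n)
  N := fieldBits R
  DB := dirStart n w
  BB := arrayStart R w
  NB := arrayBits R
  W_eq := rfl
  b_pos := chunk_pos hw
  r_pos := by have := two_le_chunks hw; omega
  g_pos := Nat.div_pos (size_le_self _) (size_pos_of_pos (size_pos_of_pos hn))
  W_le := Nat.mul_div_le _ _
  b_lt := chunk_lt hw
  q_lt := by have := size_le_self (Nat.size n); omega
  gq_le := by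
    have := Nat.div_mul_le_self (Nat.size n) (Nat.size (Nat.size n))
    calc _ = 2 * (Nat.size n / Nat.size (Nat.size n) * Nat.size (Nat.size n)) := by ring
      _ ≤ w := by omega
  tab_le := by rw [dirStart]; omega
  dir_le := le_rfl
  bits_le := le_rfl
  M_lt := memWords_lt R hn hw
  NB_lt := arrayBits_lt R hn hw
  N_eq := rfl
  N_le := by rw [arrayBits]; omega
  l_lt v _ := by
    have := size_idg_le R v
    exact Nat.pow_lt_pow_right (by norm_num) (by omega)

theorem layout_for (hn : 0 < n) (hw : 2 * Nat.size n + 10 ≤ w) : (layout R hn hw).For R :=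
  ⟨rfl, hn, fun _ _ => rfl, le_rfl⟩

/-- The number of ones in a superblock fits into a field of the directory. -/
theorem group_lt (hn : 0 < n) :
    Nat.size n / Nat.size (Nat.size n) * chunk n w < 2 ^ (2 * Nat.size (Nat.size n)) := by
  have h1 := chunk_le (n := n) (w := w)
  have h2 := size_pos_of_pos hn
  have h3 := Nat.lt_size_self (Nat.size n)
  calc _ ≤ Nat.size n * Nat.size n := Nat.mul_le_mul (Nat.div_le_self _ _) (by omega)
    _ < 2 ^ Nat.size (Nat.size n) * 2 ^ Nat.size (Nat.size n) := Nat.mul_self_lt_mul_self h3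
    _ = _ := by rw [← pow_add, two_mul]

theorem sizeS_spec {M y m : ℕ} {σ : St} {t : ℕ} (hy : y ≠ 8) (hm : σ.v 8 = m)
    (hw : Nat.size m < 2 ^ w) (hw2 : 2 < 2 ^ w) :
    WP R w M (sizeS y) σ t fun σ' t' => σ'.v y = Nat.size m ∧
      (∀ i, i ≠ 8 → i ≠ y → σ'.v i = σ.v i) ∧ σ'.mem = σ.mem ∧ σ'.out = σ.out ∧
      t' ≤ t + 20 * (Nat.size m + 1) := by
  have hw0 : w ≠ 0 := by rintro rfl; simp at hw2
  let Inv : ℕ → St → ℕ → Prop := fun i σ' t' => ∃ k, i + k = Nat.size m ∧ σ'.v 8 = m / 2 ^ k ∧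
    σ'.v y = k ∧ (∀ i, i ≠ 8 → i ≠ y → σ'.v i = σ.v i) ∧ σ'.mem = σ.mem ∧ σ'.out = σ.out ∧
    t' ≤ t + 5 + 20 * k
  apply WP.of_wp
  refine wp_asg_seq (a := 0) (by simp) rfl (WP.wh_count Inv ?_ ?_ ?_ (Nat.size m) _ _ ?_)
  · rintro i σ' t' ⟨k, hi, h8, hk, hf, hm, ho, ht⟩
    refine ⟨by simp, trivial, ?_⟩
    simp only [Cmp.holds, eval_var, eval_num, h8]
    rw [half_pos]; omega
  · rintro i σ' t' ⟨k, hi, h8, hk, hf, hm, ho, ht⟩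
    apply WP.of_wp
    refine wp_asg_seq (a := m / 2 ^ (k + 1)) ?_ ?_ (wp_asg (a := k + 1) ?_ ?_
      ⟨k + 1, by omega, ?_, ?_, ?_, hm, ho, ?_⟩)
    · simp [hw2]
    · simp [h8, Nat.div_div_eq_div_mul, pow_succ]
    · simp [hy, hk, hw0]; omega
    · simp [hy, hk]
    · simp [Ne.symm hy]
    · simp
    · intro i h1 h2
      simp [h1, h2, hf i h1 h2]
    · simp; omega
  · rintro σ' t' ⟨k, hi, h8, hk, hf, hm, ho, ht⟩
    refine ⟨by omega, hf, hm, ho, ?_⟩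
    simp; omega
  · refine ⟨0, by simp, by simp [Ne.symm hy, hm], by simp, fun i h1 h2 => by simp [h2], rfl, rfl, ?_⟩
    simp

/-- The length of `n` is found by halving, and the other parameters by a constant number of operations. -/
theorem paramS_spec {M : ℕ} {σ : St} {t : ℕ} (hn : 0 < n) (hw : 2 * Nat.size n + 10 ≤ w) :
    WP R w M paramS σ t fun σ' t' => σ'.v 0 = n ∧ σ'.v 1 = chunks n w * chunk n w ∧
      σ'.v 2 = chunk n w ∧ σ'.v 3 = Nat.size n / Nat.size (Nat.size n) ∧
      σ'.v 4 = 2 * Nat.size (Nat.size n) ∧ σ'.v 5 = dirStart n w ∧ σ'.v 13 = 2 ^ chunk n w ∧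
      σ'.out = σ.out ∧ t' ≤ t + 120 * (Nat.size n + 1) := by
  have hM := memWords_lt R hn hw
  have hDB : dirStart n w < 2 ^ w := by
    have h1 := dirStart_lt R w
    have h2 := arrayStart_lt R w
    generalize fieldBits R / chunk n w / (Nat.size n / Nat.size (Nat.size n)) = q at h1
    omega
  have hww : w < 2 ^ w := Nat.lt_two_pow_self
  have hw0 : w ≠ 0 := by omega
  have hss := size_le_self (Nat.size n)
  have hcl := chunks_le hw
  have hc := chunks.eq_def n w
  have hpc : 2 ^ chunk n w < 2 ^ w := Nat.pow_lt_pow_right (by norm_num) (chunk_lt hw)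
  have hmul : chunks n w * chunk n w ≤ w := Nat.mul_div_le _ _
  apply WP.of_wp
  refine wp_asg_seq (a := n) trivial rfl (wp_asg_seq (a := n) trivial rfl (wp_seq
    ((sizeS_spec R (m := n) (by norm_num) (by simp) (by omega) (by omega)).mono ?_)))
  rintro σ₁ t₁ ⟨a1, a2, a3, a4, a5⟩
  refine wp_asg_seq (a := Nat.size n) trivial a1 (wp_seq
    ((sizeS_spec R (m := Nat.size n) (by norm_num) (by simp) (by omega) (by omega)).mono ?_))
  rintro σ₂ t₂ ⟨b1, b2, b3, b4, b5⟩
  have h9 : σ₂.v 9 = Nat.size n := by rw [b2 9 (by norm_num) (by norm_num)]; simp [a1]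
  have h0 : σ₂.v 0 = n := by
    rw [b2 0 (by norm_num) (by norm_num)]; simp [a2]
  have hw2 : 2 < 2 ^ w := by omega
  refine wp_asg_seq (a := Nat.size n / 2 + 2) ?_ ?_ (wp_asg_seq (a := chunks n w) ?_ ?_
    (wp_asg_seq (a := chunk n w) ?_ ?_ (wp_asg_seq (a := chunks n w * chunk n w) ?_ ?_
    (wp_asg_seq (a := Nat.size n / Nat.size (Nat.size n)) ?_ ?_
    (wp_asg_seq (a := 2 * Nat.size (Nat.size n)) ?_ ?_ (wp_asg_seq (a := 2 ^ chunk n w) ?_ ?_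
    (wp_asg (a := dirStart n w) ?_ ?_ ⟨?_, ?_, ?_, ?_, ?_, ?_, ?_, ?_, ?_⟩)))))))
  · simp [h9, hw2]; omega
  · simp [h9]
  · simp [← hc, hw0]; omega
  · simp [hc]
  · simp
  · simp [chunk]
  · simp; omega
  · simp
  · simp
  · simp [h9, b1]
  · simp [b1]; omega
  · simp [b1]; ring
  · simp [hw0, hpc]
  · simp
  · rw [dirStart] at hDB
    simp [h9, hw2]; omega
  · simp [h9, dirStart]
  · simp [h0]
  · simp
  · simp
  · simp
  · simp
  · simp
  · simp
  · exact b4.trans a4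
  · simp at a5 b5 ⊢; omega

/-- All data structures are built in linear time, from arbitrary contents of the memory. -/
theorem buildS_spec {σ : St} {t : ℕ} (hn : 0 < n) (hw : 2 * Nat.size n + 10 ≤ w)
    (ho : σ.out = []) :
    WP R w (memWords R w) buildS σ t fun σ' t' => ∃ B, (layout R hn hw).Stat B σ' ∧
      (∀ y < n, (layout R hn hw).bt σ'.mem ((layout R hn hw).N + y) = 0) ∧ σ'.out = [] ∧
      t' ≤ t + 2000 * (n + numEdges G) := by
  have hΛ := layout_for R hn hw
  set Λ := layout R hn hw with hΛdef
  have hM := memWords_lt R hn hw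
  have hAM := arrayStart_lt R w
  have hDA : dirStart n w + 1 < arrayStart R w := by
    have h := dirStart_lt R w
    generalize fieldBits R / chunk n w / (Nat.size n / Nat.size (Nat.size n)) = q at h
    omega
  have hDeq : dirStart n w = 2 ^ chunk n w + Nat.size n + 2 := rfl
  have hww : w < 2 ^ w := Nat.lt_two_pow_self
  have hw0 : w ≠ 0 := by omega
  have hw2 : 2 < 2 ^ w := by omega
  have h2n := hΛ.two_n_lt
  have hss : ∀ v < n, Nat.size (idg R v) < Nat.size n + 2 := fun v _ => by
    have := size_idg_le R v
    omega
  have hN : n + ∑ v ∈ Finset.range n, Nat.size (idg R v) < 2 ^ w := by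
    have h1 := Λ.N_le
    have h2 := Λ.NB_lt
    have h3 : Λ.N = n + ∑ v ∈ Finset.range n, Nat.size (idg R v) := rfl
    omega
  have hdirw : dirStart n w +
      2 * (fieldBits R / chunk n w / (Nat.size n / Nat.size (Nat.size n))) + 2 < 2 ^ w := by
    have h := dirStart_lt R w
    generalize fieldBits R / chunk n w / (Nat.size n / Nat.size (Nat.size n)) = q at h ⊢
    omega
  apply WP.of_wp
  refine wp_seq ((paramS_spec R hn hw).mono ?_)
  rintro σ₁ t₁ ⟨a0, a1, a2, a3, a4, a5, a13, ao, at'⟩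
  refine wp_seq ((tableS_spec a13 (by positivity) (by omega) hM hw2).mono ?_)
  rintro σ₂ t₂ ⟨b1, b2, b3, b4⟩
  refine wp_seq ((zeroS_spec ((b2 13 (by omega)).trans a13) ((b2 5 (by omega)).trans a5) (by omega)
    (by omega) hM hw2).mono ?_)
  rintro σ₃ t₃ ⟨c1, c2, c3, c4, c5⟩
  refine wp_seq ((countS_spec (s := Nat.size n + 2) (((c3 13 (by omega)).trans
    (b2 13 (by omega))).trans a13) (((c3 0 (by omega)).trans (b2 0 (by omega))).trans a0) hss
    (by omega) hM hw2 (by omega) (fun j hj => c1 _ (by omega) (by omega))).mono ?_)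
  rintro σ₄ t₄ ⟨d1, d2, d3, d4, d5⟩
  have f4 : ∀ i, i < 6 ∨ i = 13 → σ₄.v i = σ₁.v i := fun i hi => by
    rw [d3 i hi, c3 i hi, b2 i hi]
  refine wp_seq ((prefixS_spec (s := Nat.size n + 2) ((f4 13 (by omega)).trans a13)
    ((f4 5 (by omega)).trans a5) (by omega) (by omega) hM hw2 hN d1).mono ?_)
  rintro σ₅ t₅ ⟨e1, e2, e3, e4, e5, e6⟩
  rw [off_eq hss, ← fieldBits] at e2
  have f5 : ∀ i, i < 6 ∨ i = 13 → σ₅.v i = σ₁.v i := fun i hi => by rw [e4 i hi, f4 i hi]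
  have hV : Λ.Vars (σ₅.set 6 (arrayStart R w)) := by
    refine ⟨?_, ?_, ?_, ?_, ?_, ?_, ?_, ?_⟩
    · simp [f5, a0, hΛdef, layout]
    · simp [f5, a1, hΛdef, layout]
    · simp [f5, a2, hΛdef, layout]
    · simp [f5, a3, hΛdef, layout]
    · simp [f5, a4, hΛdef, layout]
    · simp [f5, a5, hΛdef, layout]
    · simp [hΛdef, layout]
    · simp [e2, hΛdef, layout]
  refine wp_asg_seq (a := arrayStart R w) ?_ ?_ (wp_seq ((Lay.fillS_spec hΛ (PB := 2 ^ chunk n w)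
    (s := Nat.size n + 2) hV ?_ hss ?_ e1).mono ?_))
  · simp [f5, a2, a3, a5, e2, hw2, hdirw]; omega
  · simp [f5, a2, a3, a5, e2, arrayStart]
  · simp [f5, a13]
  · change _ ≤ arrayStart R w; omega
  rintro σ₆ t₆ ⟨g1, g2, g3, g4, g5⟩
  refine wp_seq ((Lay.dirS_spec (hV.frC g3) (group_lt hn) (fun x hx => ?_) g2).mono ?_)
  · rw [g1 x hx, St.set_mem, e3 x hx, d2 x hx, c2 x hx, b1 x hx]
  rintro σ₇ t₇ ⟨i1, i2, i3⟩
  refine (Lay.clearS_spec i1).mono ?_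
  rintro σ₈ t₈ ⟨j1, j2, j3, j4⟩
  refine ⟨_, j1, fun y hy => j2 _ (Nat.le_add_right _ _) ?_, ?_, ?_⟩
  · have := hΛ.n_le
    omega
  · rw [j3, i2, g4, St.set_out, e5, d4, c4, b3, ao, ho]
  · have k1 : Λ.N ≤ n + numEdges G := Nat.add_le_add_left (sum_size R) n
    have k2 := sum_size R
    have k3 := size_le_self n
    have k4 := two_pow_chunk_le (w := w) hn
    have k5 : dirStart n w - 2 ^ chunk n w = Nat.size n + 2 := by omega
    rw [Finset.sum_add_distrib] at d5
    rw [k5] at c5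
    simp only [Finset.sum_const, Finset.card_range, smul_eq_mul, mul_one] at d5
    simp at g5
    omega

theorem mainS_spec {σ : St} {t : ℕ} (hn : 0 < n) (hw : 2 * Nat.size n + 10 ≤ w)
    (ho : σ.out = []) :
    WP R w (memWords R w) mainS σ t fun σ' t' => OutOK R (Finset.range n) σ'.out ∧
      t' ≤ t + 12000 * (n + numEdges G) := by
  apply WP.of_wp
  refine wp_seq ((buildS_spec R hn hw ho).mono ?_)
  rintro σ₁ t₁ ⟨B, h1, h2, h3, h4⟩
  refine (Lay.searchS_spec (layout_for R hn hw) h1 h2 h3).mono ?_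
  rintro σ₂ t₂ ⟨h5, h6⟩
  exact ⟨h5, by omega⟩

end Layout

/-! ### The output -/

section Output

variable {n : ℕ} {G : Digraph (Fin n)} (R : AdjArrays G)

theorem edge_iff {u v : Fin n} : Edge (nb R) (dg R) u v ↔ G.Adj u v := by
  rw [adj_iff R, Edge]
  simp only [dg, nb, if_neg u.2.ne]

/-- The additional vertex is not reachable from others and does not change reachability between them. -/
theorem reach_iff {u v : Fin n} :
    Reach (nb R) (dg R) u v ↔ Relation.ReflTransGen G.Adj u v := by
  constructor
  · intro h
    have key : ∀ b, Reach (nb R) (dg R) u b → ∀ hb : b < n,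
        Relation.ReflTransGen G.Adj u ⟨b, hb⟩ := by
      intro b h
      induction h with
      | refl => exact fun _ => .refl
      | tail h1 h2 ih =>
        intro hb
        have h3 := reach_lt R u.2 h1
        exact (ih h3).tail ((edge_iff R (u := ⟨_, h3⟩) (v := ⟨_, hb⟩)).1 h2)
    exact key v h v.2
  · intro h
    induction h with
    | refl => exact .refl
    | tail _ h2 ih => exact ih.tail ((edge_iff R).2 h2)

theorem sc_iff {u v : Fin n} : SC (nb R) (dg R) u v ↔ StronglyEquiv G u v :=
  and_congr (reach_iff R) (reach_iff R)

theorem OutOK.outputsSCCs {out : List (Option ℕ)} (h : OutOK R (Finset.range n) out) :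
    OutputsSCCs G out := by
  obtain ⟨comps, rfl, h1, h2, h3⟩ := h
  have hlt : ∀ C ∈ comps, ∀ y ∈ C, y < n := fun C hC y hy =>
    Finset.mem_range.1 ((h3 y).1 (List.mem_flatten.2 ⟨C, hC, hy⟩))
  obtain ⟨D, rfl⟩ : ∃ D : List (List (Fin n)), D.map (List.map Fin.val) = comps := by
    clear h1 h2 h3
    induction comps with
    | nil => exact ⟨[], rfl⟩
    | cons C l ih =>
      obtain ⟨D, rfl⟩ := ih fun C hC => hlt C (List.mem_cons_of_mem _ hC)
      lift C to List (Fin n) using hlt C List.mem_cons_self with C'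
      exact ⟨C' :: D, rfl⟩
  rw [← List.map_flatten] at h2
  refine ⟨D, ?_, ?_, ?_, List.Nodup.of_map _ h2⟩
  · rw [List.flatMap_map]
    refine List.flatMap_congr fun C _ => ?_
    simp only [List.map_map, List.pure_def, List.bind_eq_flatMap]
    rw [← List.map_eq_flatMap, List.map_map]
  · intro C hC
    obtain ⟨v, hv, h⟩ := h1 _ (List.mem_map_of_mem hC)
    refine ⟨⟨v, hv⟩, Set.ext fun u => ?_⟩
    have := h u
    rw [List.mem_map_of_injective Fin.val_injective] at this
    exact this.trans (sc_iff R (u := ⟨v, hv⟩))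
  · intro v
    have := (h3 v).2 (Finset.mem_range.2 v.2)
    rwa [← List.map_flatten, List.mem_map_of_injective Fin.val_injective] at this

theorem mainS_fits : mainS.fits = true := by decide

/-- The compiled program outputs the strongly connected components. -/
theorem exec_mainS {w : ℕ} (hn : 0 < n) (hw : 2 * Nat.size n + 10 ≤ w) {s₀ : State 48}
    (h₀ : s₀.Initial w) : ∃ s t S, Exec R w mainS.comp s₀ s t S ∧ OutputsSCCs G s.out ∧
      t ≤ 12000 * (n + numEdges G) ∧ S ≤ memWords R w := by
  have hnw : n < 2 ^ w := (Nat.lt_size_self n).trans_le (Nat.pow_le_pow_right (by norm_num) (by omega))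
  obtain ⟨s, t, S, σ', h1, h2, h3, h4, h5⟩ := mainS_spec R
    (σ := ⟨fun i => s₀.reg (rg i), s₀.mem, []⟩)
    (t := 0) hn hw rfl hnw mainS_fits s₀ ⟨fun _ _ => rfl, rfl, h₀.2.2, h₀.1, h₀.2.1⟩
  exact ⟨s, t, S, h1, h3.out ▸ h4.outputsSCCs R, by omega, h2⟩

end Output

/-! ### The size of the bit array -/

theorem ceil_logb_succ (i : ℕ) : ⌈Real.logb 2 ((i : ℝ) + 1)⌉ = Nat.size i := by
  rcases Nat.eq_zero_or_pos i with rfl | hi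
  · simp
  have h0 : 0 < Nat.size i := Nat.size_pos.2 hi
  have h1 : 2 ^ (Nat.size i - 1) ≤ i := Nat.lt_size.1 (by omega)
  have h2 : i + 1 ≤ 2 ^ Nat.size i := Nat.lt_size_self i
  rw [Int.ceil_eq_iff]
  constructor
  · rw [Real.lt_logb_iff_rpow_lt one_lt_two (by positivity)]
    have h3 : ((Nat.size i : ℤ) : ℝ) - 1 = ((Nat.size i - 1 : ℕ) : ℝ) := by
      rw [Nat.cast_sub h0]; simp
    rw [h3, Real.rpow_natCast]
    exact_mod_cast Nat.lt_succ_of_le h1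
  · rw [Real.logb_le_iff_le_rpow one_lt_two (by positivity), Int.cast_natCast, Real.rpow_natCast]
    exact_mod_cast h2

section Bits

variable {n : ℕ} {G : Digraph (Fin n)} (R : AdjArrays G)

theorem Lin_one_eq : Lin 1 G = ∑ v ∈ Finset.range n, (Nat.size (idg R v) : ℤ) := by
  rw [Lin, sumCeilLog, Finset.sum_range]
  refine Finset.sum_congr rfl fun v _ => ?_
  rw [← idg_eq_inDegree R]
  have := ceil_logb_succ (idg R v)
  split_ifs with h
  · simpa using this
  · have h0 : idg R v = 0 := by omega
    simp [h0]

theorem L_neg_one_eq : L (-1) G = ∑ v ∈ Finset.range n, (width R v : ℤ) := by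
  rw [L, sumCeilLog, Finset.sum_range]
  refine Finset.sum_congr rfl fun v _ => ?_
  rw [degree, ← idg_eq_inDegree R, ← od_eq_outDegree R, width]
  split_ifs with h
  · obtain ⟨d, hd⟩ : ∃ d, idg R v + od R v = d + 2 := ⟨idg R v + od R v - 2, by omega⟩
    rw [hd, Nat.add_sub_cancel, ← ceil_logb_succ d]
    congr 2
    push_cast; ring
  · rw [show idg R v + od R v - 2 = 0 by omega]; simp

/-- The bit array has exactly as many bits as the leading term of the space bound. -/
theorem arrayBits_eq : (arrayBits R : ℝ) = 2 * n + (L (-1) G : ℝ) + 2 * (Lin 1 G : ℝ) := by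
  rw [Lin_one_eq R, L_neg_one_eq R, arrayBits, fieldBits]
  push_cast; ring

theorem two_mul_le_arrayBits : 2 * n ≤ arrayBits R := by rw [arrayBits, fieldBits]; omega

/-! ### The space bound -/

theorem sq_le_two_pow : ∀ h : ℕ, (2 * h + 3) ^ 2 ≤ 16 * 2 ^ h
  | 0 => by norm_num
  | 1 => by norm_num
  | h + 2 => by
    have := sq_le_two_pow (h + 1)
    calc (2 * (h + 2) + 3) ^ 2 ≤ 2 * (2 * (h + 1) + 3) ^ 2 := by ring_nf; omega
      _ ≤ 2 * (16 * 2 ^ (h + 1)) := Nat.mul_le_mul_left 2 this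
      _ = 16 * 2 ^ (h + 2) := by ring

theorem size_sq_le (n : ℕ) : Nat.size n ^ 2 ≤ 16 * 2 ^ (Nat.size n / 2) :=
  (Nat.pow_le_pow_left (by omega) 2).trans (sq_le_two_pow (Nat.size n / 2))

theorem two_pow_half_sq_le {n : ℕ} (hn : 0 < n) : 2 ^ (Nat.size n / 2) * 2 ^ (Nat.size n / 2) ≤ 2 * n := by
  rw [← pow_add]
  exact (Nat.pow_le_pow_right (by norm_num) (by omega)).trans (two_pow_size_le_two_mul hn)

theorem size_cube_le {n : ℕ} (hn : 0 < n) : Nat.size n ^ 3 ≤ 64 * n := by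
  have h1 := size_sq_le n
  have h2 := two_pow_half_sq_le hn
  have h3 : Nat.size n ≤ 2 * 2 ^ (Nat.size n / 2) := by
    have : Nat.size n / 2 < 2 ^ (Nat.size n / 2) := Nat.lt_two_pow_self
    omega
  calc Nat.size n ^ 3 = Nat.size n ^ 2 * Nat.size n := by ring
    _ ≤ 16 * 2 ^ (Nat.size n / 2) * (2 * 2 ^ (Nat.size n / 2)) := Nat.mul_le_mul h1 h3
    _ = 32 * (2 ^ (Nat.size n / 2) * 2 ^ (Nat.size n / 2)) := by ring
    _ ≤ 64 * n := by omega

/-- The words of the table of popcounts are few even in comparison with `n / (log n)²`. -/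
theorem table_le {n : ℕ} (w : ℕ) (hn : 0 < n) : 2 ^ chunk n w * Nat.size n ^ 2 ≤ 64 * n := by
  have h1 := size_sq_le n
  have h2 := two_pow_half_sq_le hn
  have h3 : 2 ^ chunk n w ≤ 2 * 2 ^ (Nat.size n / 2) := by
    rw [← pow_succ']
    exact Nat.pow_le_pow_right (by norm_num) chunk_le
  calc _ ≤ 2 * 2 ^ (Nat.size n / 2) * (16 * 2 ^ (Nat.size n / 2)) := Nat.mul_le_mul h3 h1
    _ = 32 * (2 ^ (Nat.size n / 2) * 2 ^ (Nat.size n / 2)) := by ring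
    _ ≤ 64 * n := by omega

/-- Packing the bit array into words, whose last `w mod (chunks n w)` bits stay unused, costs a
factor of at most `1 + 4 / log n`. -/
theorem packed_le {w : ℕ} (hn : 0 < n) (hw : 2 * Nat.size n + 10 ≤ w) :
    ((arrayBits R / (chunks n w * chunk n w) : ℕ) : ℝ) * w ≤
      arrayBits R * (1 + 4 / (Nat.size n : ℝ)) := by
  have hr : 0 < chunks n w := Nat.succ_pos _
  have hb := chunk_pos hw
  have hs := size_pos_of_pos hn
  have h1 : (w : ℝ) ≤ chunks n w * chunk n w + chunks n w := by
    have h := Nat.div_add_mod w (chunks n w)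
    have h' := Nat.mod_lt w hr
    have : w ≤ chunks n w * chunk n w + chunks n w := by rw [chunk]; omega
    exact_mod_cast this
  have h2 : (Nat.size n : ℝ) ≤ 4 * chunk n w := by exact_mod_cast size_le_chunk hw
  have hr' : (0 : ℝ) < chunks n w := by exact_mod_cast hr
  have hb' : (0 : ℝ) < chunk n w := by exact_mod_cast hb
  have hs' : (0 : ℝ) < Nat.size n := by exact_mod_cast hs
  have h3 : (1 : ℝ) / chunk n w ≤ 4 / Nat.size n := by
    rw [div_le_div_iff₀ hb' hs']; linarith
  calc _ ≤ (arrayBits R : ℝ) / (chunks n w * chunk n w) * w := by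
        gcongr
        exact_mod_cast Nat.cast_div_le (α := ℝ)
    _ ≤ (arrayBits R : ℝ) / (chunks n w * chunk n w) * (chunks n w * chunk n w + chunks n w) := by
        gcongr
    _ = arrayBits R * (1 + 1 / chunk n w) := by field_simp
    _ ≤ _ := by gcongr

/-- The directory takes `O(log log n / log n)` bits per bit of the bit array. -/
theorem directory_le {A w : ℕ} (hn : 0 < n) (hw : 2 * Nat.size n + 10 ≤ w)
    (hA : w ≤ A * Nat.size n) :
    ((2 * (fieldBits R / chunk n w / (Nat.size n / Nat.size (Nat.size n))) : ℕ) : ℝ) * w ≤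
      arrayBits R * (16 * A * (Nat.size (Nat.size n) / Nat.size n)) := by
  have hs := size_pos_of_pos hn
  have hsl := size_pos_of_pos hs
  have hb := chunk_pos hw
  have hg : 0 < Nat.size n / Nat.size (Nat.size n) := Nat.div_pos (size_le_self _) hsl
  have h1 : (Nat.size n : ℝ) ≤
      2 * (Nat.size (Nat.size n) * (Nat.size n / Nat.size (Nat.size n) : ℕ)) := by
    have h := Nat.lt_mul_div_succ (Nat.size n) hsl
    have : Nat.size n ≤ 2 * (Nat.size (Nat.size n) * (Nat.size n / Nat.size (Nat.size n))) := by
      have h' := Nat.le_mul_of_pos_right (Nat.size (Nat.size n)) hg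
      rw [mul_add, mul_one] at h
      omega
    exact_mod_cast this
  have h2 : (Nat.size n : ℝ) ≤ 4 * chunk n w := by exact_mod_cast size_le_chunk hw
  have h3 : (w : ℝ) ≤ A * Nat.size n := by exact_mod_cast hA
  have h4 : (fieldBits R : ℝ) ≤ arrayBits R := by
    exact_mod_cast (show fieldBits R ≤ arrayBits R by rw [arrayBits]; omega)
  generalize Nat.size n / Nat.size (Nat.size n) = g at *
  have hg' : (0 : ℝ) < g := by exact_mod_cast hg
  have hb' : (0 : ℝ) < chunk n w := by exact_mod_cast hb
  have hs' : (0 : ℝ) < Nat.size n := by exact_mod_cast hs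
  have h5 : ((fieldBits R / chunk n w / g : ℕ) : ℝ) ≤ fieldBits R / chunk n w / g :=
    Nat.cast_div_le.trans (div_le_div_of_nonneg_right Nat.cast_div_le hg'.le)
  have h6 : (1 : ℝ) / g ≤ 2 * (Nat.size (Nat.size n) / Nat.size n) := by
    rw [← mul_div_assoc, div_le_div_iff₀ hg' hs']; linarith
  have h7 : (1 : ℝ) / chunk n w ≤ 4 / Nat.size n := by
    rw [div_le_div_iff₀ hb' hs']; linarith
  push_cast
  calc 2 * ((fieldBits R / chunk n w / g : ℕ) : ℝ) * w
      ≤ 2 * (fieldBits R / chunk n w / g) * w := by gcongr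
    _ = 2 * (fieldBits R * (1 / chunk n w) * (1 / g)) * w := by ring
    _ ≤ 2 * (arrayBits R * (4 / Nat.size n) * (2 * (Nat.size (Nat.size n) / Nat.size n))) *
        (A * Nat.size n) := by gcongr
    _ = _ := by field_simp; ring

/-- The relative excess of the space over the size of the bit array. -/
noncomputable def excess (A n : ℕ) : ℝ :=
  (4 + 1776 * A) * ((Nat.size (Nat.size n) : ℝ) / Nat.size n)

theorem excess_nonneg (A n : ℕ) : 0 ≤ excess A n := by
  unfold excess; positivity

/-- The registers, the pointers, the table of popcounts, the directory and the bit array together. -/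
theorem space_le {A w : ℕ} (hn : 0 < n) (hw : 2 * Nat.size n + 10 ≤ w)
    (hA : w ≤ A * Nat.size n) :
    ((48 + memWords R w : ℕ) : ℝ) * w ≤ arrayBits R * (1 + excess A n) := by
  have hs := size_pos_of_pos hn
  have hsl := size_pos_of_pos hs
  have h1 := packed_le R hn hw
  have h2 := directory_le R hn hw hA
  have hs' : (0 : ℝ) < Nat.size n := by exact_mod_cast hs
  have hsl' : (1 : ℝ) ≤ Nat.size (Nat.size n) := by exact_mod_cast hsl
  have h3 : (w : ℝ) ≤ A * Nat.size n := by exact_mod_cast hA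
  have h4 : (Nat.size n : ℝ) ^ 3 ≤ 64 * n := by exact_mod_cast size_cube_le hn
  have h5 : (2 : ℝ) ^ chunk n w * (Nat.size n : ℝ) ^ 2 ≤ 64 * n := by
    exact_mod_cast table_le w hn
  have h6 : (2 : ℝ) * n ≤ arrayBits R := by exact_mod_cast two_mul_le_arrayBits R
  have h7 : (53 + Nat.size n : ℝ) * w ≤ arrayBits R * (1728 * A * (1 / Nat.size n)) := by
    have hs1 : (1 : ℝ) ≤ Nat.size n := by exact_mod_cast hs
    calc (53 + Nat.size n : ℝ) * w ≤ (54 * Nat.size n) * (A * Nat.size n) := by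
          gcongr; linarith
      _ = 54 * A * ((Nat.size n : ℝ) ^ 3) * (1 / Nat.size n) := by field_simp
      _ ≤ 54 * A * (64 * n) * (1 / Nat.size n) := by gcongr
      _ = 2 * n * (1728 * A * (1 / Nat.size n)) := by ring
      _ ≤ _ := by gcongr
  have h8 : (2 : ℝ) ^ chunk n w * w ≤ arrayBits R * (32 * A * (1 / Nat.size n)) := by
    calc (2 : ℝ) ^ chunk n w * w ≤ 2 ^ chunk n w * (A * Nat.size n) := by gcongr
      _ = A * (2 ^ chunk n w * (Nat.size n : ℝ) ^ 2) * (1 / Nat.size n) := by field_simp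
      _ ≤ A * (64 * n) * (1 / Nat.size n) := by gcongr
      _ = 2 * n * (32 * A * (1 / Nat.size n)) := by ring
      _ ≤ _ := by gcongr
  have h9 : (1 : ℝ) / Nat.size n ≤ Nat.size (Nat.size n) / Nat.size n := by gcongr
  have h10 : (48 + memWords R w) = (53 + Nat.size n) + 2 ^ chunk n w +
      2 * (fieldBits R / chunk n w / (Nat.size n / Nat.size (Nat.size n))) +
      arrayBits R / (chunks n w * chunk n w) := by
    rw [memWords, arrayStart, dirStart]; ring
  -- 53 = 48 registers and the summands 2, 2 and 1 in `dirStart`, `arrayStart` and `memWords`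
  rw [h10, Nat.cast_add, Nat.cast_add, add_mul, add_mul]
  calc _ ≤ (arrayBits R : ℝ) * (1728 * A * (1 / Nat.size n)) +
        arrayBits R * (32 * A * (1 / Nat.size n)) +
        arrayBits R * (16 * A * (Nat.size (Nat.size n) / Nat.size n)) +
        arrayBits R * (1 + 4 * (1 / Nat.size n)) := by
        refine add_le_add (add_le_add ?_ h2) (by rw [mul_one_div]; exact h1)
        push_cast
        rw [add_mul]
        exact add_le_add h7 h8
    _ ≤ (arrayBits R : ℝ) * (1728 * A * (Nat.size (Nat.size n) / Nat.size n)) +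
        arrayBits R * (32 * A * (Nat.size (Nat.size n) / Nat.size n)) +
        arrayBits R * (16 * A * (Nat.size (Nat.size n) / Nat.size n)) +
        arrayBits R * (1 + 4 * (Nat.size (Nat.size n) / Nat.size n)) := by gcongr
    _ = _ := by rw [excess]; ring

/-- `log log n / log n` in terms of lengths of binary representations. -/
theorem excess_isBigO (A : ℕ) : excess A =O[atTop]
    fun n : ℕ => Real.logb 2 (Real.logb 2 (n : ℝ)) / Real.logb 2 (n : ℝ) := by
  refine IsBigO.const_mul_left (IsBigO.of_bound 3 ?_) _
  filter_upwards [eventually_ge_atTop 4] with n hn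
  have hs : 0 < Nat.size n := size_pos_of_pos (by omega)
  have hsl := size_pos_of_pos hs
  have hn' : (4 : ℝ) ≤ n := by exact_mod_cast hn
  have h1 : (2 : ℝ) ≤ Real.logb 2 n := by
    rw [Real.le_logb_iff_rpow_le one_lt_two (by linarith)]; norm_num; exact hn
  have h2 : (1 : ℝ) ≤ Real.logb 2 (Real.logb 2 n) := by
    rw [Real.le_logb_iff_rpow_le one_lt_two (by linarith)]; norm_num; exact h1
  have key : ∀ m : ℕ, 0 < m → (Nat.size m : ℝ) ≤ 1 + Real.logb 2 m := fun m hm => by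
    have h3 : 2 ^ (Nat.size m - 1) ≤ m := Nat.lt_size.1 (by have := size_pos_of_pos hm; omega)
    have h4 : ((Nat.size m - 1 : ℕ) : ℝ) ≤ Real.logb 2 m := by
      rw [Real.le_logb_iff_rpow_le one_lt_two (by exact_mod_cast hm), Real.rpow_natCast]
      exact_mod_cast h3
    rw [Nat.cast_sub (size_pos_of_pos hm)] at h4
    push_cast at h4
    linarith
  have h3 : Real.logb 2 n ≤ Nat.size n := by
    rw [Real.logb_le_iff_le_rpow one_lt_two (by linarith), Real.rpow_natCast]
    exact_mod_cast (Nat.lt_size_self n).le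
  have h4 : (Nat.size (Nat.size n) : ℝ) ≤ 3 * Real.logb 2 (Real.logb 2 n) := by
    have h5 := key n (by omega)
    have h6 := key _ hs
    have h7 : Real.logb 2 (Nat.size n) ≤ Real.logb 2 (2 * Real.logb 2 n) :=
      Real.logb_le_logb_of_le one_lt_two (by exact_mod_cast hs) (by linarith)
    rw [Real.logb_mul two_ne_zero (by linarith), Real.logb_self_eq_one one_lt_two] at h7
    linarith
  rw [Real.norm_of_nonneg (by positivity), Real.norm_of_nonneg (by positivity), ← mul_div_assoc]
  gcongr

/-! ### The bound in terms of `n` and `m` -/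

/-- Jensen's inequality for the logarithm. -/
theorem sum_logb_le (hn : 0 < n) (f : ℕ → ℝ) (hf : ∀ v, 0 < f v) :
    ∑ v ∈ Finset.range n, Real.logb 2 (f v) ≤
      n * Real.logb 2 ((∑ v ∈ Finset.range n, f v) / n) := by
  have hn' : (0 : ℝ) < n := by exact_mod_cast hn
  have h := strictConcaveOn_log_Ioi.concaveOn.le_map_sum (t := Finset.range n)
    (w := fun _ => (1 : ℝ) / n) (p := f) (fun _ _ => by positivity)
    (by simp [hn'.ne']) (fun v _ => hf v)
  simp only [smul_eq_mul, one_div_mul_eq_div, ← Finset.sum_div] at h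
  simp only [Real.logb, ← Finset.sum_div]
  rw [← mul_div_assoc]
  gcongr
  rw [div_le_iff₀ hn'] at h
  linarith

theorem size_le_logb {d : ℕ} {x : ℝ} (h : 2 * (d : ℝ) + 1 ≤ x) : (Nat.size d : ℝ) ≤ Real.logb 2 x := by
  rw [Real.le_logb_iff_rpow_le one_lt_two (by linarith [d.cast_nonneg (α := ℝ)]), Real.rpow_natCast]
  exact le_trans (by exact_mod_cast two_pow_size_le d) h

/-- With `x = m / n`, the average indegree is `x` and the average total degree is `2 x`. By concavity
the number of bits per vertex is at most
`2 + log (2 + 4 x) + 2 log (1 + 2 x) = 3 log (2 + 4 x)`. -/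
theorem arrayBits_le_log (hn : 0 < n) :
    (arrayBits R : ℝ) ≤ 3 * n * Real.logb 2 (2 + 4 * (numEdges G : ℝ) / n) := by
  have hn' : (0 : ℝ) < n := by exact_mod_cast hn
  have hi : (∑ v ∈ Finset.range n, (idg R v : ℝ)) = numEdges G := by
    rw [numEdges_eq_idg R]; push_cast; rfl
  have ho : (∑ v ∈ Finset.range n, (od R v : ℝ)) = numEdges G := by
    rw [numEdges_eq_od R]; push_cast; rfl
  have h1 : ∑ v ∈ Finset.range n, (Nat.size (idg R v) : ℝ) ≤
      n * Real.logb 2 (1 + 2 * (numEdges G / n)) := by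
    refine (Finset.sum_le_sum fun v _ => size_le_logb (x := 1 + 2 * (idg R v : ℝ)) (by linarith)).trans
      ((sum_logb_le hn _ fun v => by positivity).trans_eq ?_)
    rw [Finset.sum_add_distrib, ← Finset.mul_sum, hi]
    simp only [Finset.sum_const, Finset.card_range, nsmul_eq_mul, mul_one]
    congr 2
    field_simp
  have h2 : ∑ v ∈ Finset.range n, (width R v : ℝ) ≤
      n * Real.logb 2 (2 + 4 * (numEdges G : ℝ) / n) := by
    refine (Finset.sum_le_sum fun v _ => size_le_logb (x := 2 + 2 * ((idg R v : ℝ) + od R v))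
      ?_).trans ((sum_logb_le hn _ fun v => by positivity).trans_eq ?_)
    · have : ((idg R v + od R v - 2 : ℕ) : ℝ) ≤ (idg R v : ℝ) + od R v := by
        exact_mod_cast Nat.sub_le _ _
      linarith
    · rw [Finset.sum_add_distrib, ← Finset.mul_sum, Finset.sum_add_distrib, hi, ho]
      simp only [Finset.sum_const, Finset.card_range, nsmul_eq_mul]
      congr 2
      field_simp
      ring
  have h3 : Real.logb 2 (2 + 4 * (numEdges G : ℝ) / n) =
      1 + Real.logb 2 (1 + 2 * (numEdges G / n)) := by
    rw [show 2 + 4 * (numEdges G : ℝ) / n = 2 * (1 + 2 * (numEdges G / n)) by ring,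
      Real.logb_mul two_ne_zero (by positivity), Real.logb_self_eq_one one_lt_two]
  rw [arrayBits, fieldBits]
  push_cast
  rw [h3] at h2 ⊢
  linarith

end Bits

end SpaceSCC

theorem mainTheorem9 :
    ∃ (k : ℕ) (P : WordRAM.Program k) (c κ : ℕ), ∀ A : ℕ, ∃ ε : ℕ → ℝ,
      ε =O[atTop] (fun n : ℕ => Real.logb 2 (Real.logb 2 (n : ℝ)) / Real.logb 2 (n : ℝ)) ∧
      ∀ n : ℕ, 1 ≤ n → ∀ (G : Digraph (Fin n)) (R : DirGraph.AdjArrays G) (w : ℕ),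
        2 * Nat.size n + κ ≤ w → w ≤ A * Nat.size n →
        ∀ s₀ : WordRAM.State k, s₀.Initial w →
        ∃ (s : WordRAM.State k) (t S : ℕ),
          WordRAM.Exec R w P s₀ s t S ∧
          WordRAM.OutputsSCCs G s.out ∧
          t ≤ c * (n + DirGraph.numEdges G) ∧
          (((k + S) * w : ℕ) : ℝ) ≤
            (2 * (n : ℝ) + (DirGraph.L (-1) G : ℝ) + 2 * (DirGraph.Lin 1 G : ℝ)) * (1 + ε n) ∧
          (2 * (n : ℝ) + (DirGraph.L (-1) G : ℝ) + 2 * (DirGraph.Lin 1 G : ℝ)) * (1 + ε n) ≤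
            3 * (n : ℝ) * Real.logb 2 (2 + 4 * (DirGraph.numEdges G : ℝ) / (n : ℝ)) *
              (1 + ε n) := by
  refine ⟨48, SpaceSCC.mainS.comp, 12000, 10, fun A => ⟨SpaceSCC.excess A,
    SpaceSCC.excess_isBigO A, fun n hn G R w hw hA s₀ h₀ => ?_⟩⟩
  obtain ⟨s, t, S, h1, h2, h3, h4⟩ := SpaceSCC.exec_mainS R hn hw h₀
  refine ⟨s, t, S, h1, h2, h3, ?_, ?_⟩
  · rw [← SpaceSCC.arrayBits_eq R, Nat.cast_mul]
    refine le_trans ?_ (SpaceSCC.space_le R hn hw hA)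
    gcongr
  · rw [← SpaceSCC.arrayBits_eq R]
    exact mul_le_mul_of_nonneg_right (SpaceSCC.arrayBits_le_log R hn)
      (add_nonneg zero_le_one (SpaceSCC.excess_nonneg A n))
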